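/- An instance consists of agents $[n]$, items $[m]$, additive valuation functions $v_i : 2^{[m]} \to \mathbb{R}_{\ge 0}$ for $i \in [n]$, and a finite simple conflict graph $G$ on $[m]$. An allocation is a partition of $[m]$ into $n$ possibly empty bundles $A_1, \dots, A_n$; it is feasible if no bundle contains two adjacent vertices of $G$. A feasible allocation is EF1 (envy-free up to one good) if $v_i(A_i) \ge v_i(A_{i'}) - \max_{j \in A_{i'}} v_i(\{j\})$ for all $i, i' \in [n]$ with $A_{i'} \ne \emptyset$. The instance has identical values if $v_i(\{j\}) = v_{i'}(\{j'\})$ for all $i, i' \in [n]$ and $j, j' \in [m]$. A proper colouring of $G$ with colours $[n]$ (not all of which need be used) is equitable if the sizes of any two colour classes differ by at most one. Let $\Delta(G)$ be the maximum degree of $G$. (1) Every instance with identical values and $n > \Delta(G)$ has an EF1 allocation. (2) Such an allocation can be found in time polynomial in $n + m$. More precisely, there are a single program for a random access machine (with unit-cost addition, truncated subtraction and comparison of natural numbers) and a polynomial $p$ such that, given $n$, $m$ and the adjacency matrix of any graph $G$ on $[m]$ with $\Delta(G) < n$, the program halts after at most $p(n + m)$ steps and outputs an allocation whose bundles are the colour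 classes of an equitable $n$-colouring of $G$, and which is EF1 for every instance with $n$ agents, conflict graph $G$ and identical values. (3) For an instance with identical values (and no assumption on $\Delta(G)$), every allocation whose bundles are the colour classes of an equitable $n$-colouring of $G$ is EF1; if the common value is nonzero, an allocation is EF1 if and only if its bundles are the colour classes of an equitable $n$-colouring of $G$. -/

import Mathlib

namespace FairAlloc

/-- A problem instance with agents `[n]` and items `[m]`: additive, non-negative valuation
functions on sets of items, and an undirected conflict graph on the items. -/
structure Instance (n m : ℕ) where
  /-- `v i S` is the value of the set of items `S` to agent `i` -/
  v : Fin n → Finset (Fin m) → ℝ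
  nonneg : ∀ i S, 0 ≤ v i S
  additive : ∀ i S, v i S = ∑ j ∈ S, v i {j}
  /-- the conflict graph -/
  G : SimpleGraph (Fin m)

/-- A (complete) allocation: an `n`-partition of the items, where bundles may be empty. -/
structure Allocation (n m : ℕ) where
  bundle : Fin n → Finset (Fin m)
  disjoint : ∀ i i', i ≠ i' → Disjoint (bundle i) (bundle i')
  cover : ∀ j, ∃ i, j ∈ bundle i

/-- No bundle contains a pair of conflicting items. -/
def Allocation.IsFeasible {n m : ℕ} (A : Allocation n m) (G : SimpleGraph (Fin m)) : Prop :=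
  ∀ i, ∀ j ∈ A.bundle i, ∀ j' ∈ A.bundle i, ¬ G.Adj j j'

/-- Envy-freeness up to one good (of a feasible allocation). -/
def Instance.IsEF1 {n m : ℕ} (I : Instance n m) (A : Allocation n m) : Prop :=
  A.IsFeasible I.G ∧
    ∀ i i', ∀ h : (A.bundle i').Nonempty,
      I.v i (A.bundle i) ≥
        I.v i (A.bundle i') - (A.bundle i').sup' h (fun j => I.v i {j})

/-- All agents give all items one and the same value. -/
def Instance.HasIdenticalValues {n m : ℕ} (I : Instance n m) : Prop :=
  ∀ (i i' : Fin n) (j j' : Fin m), I.v i {j} = I.v i' {j'}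

/-- A proper colouring is equitable if the sizes of any two colour classes differ by at
most one. (The two colours range over all pairs, so one inequality suffices.) -/
def IsEquitable {n m : ℕ} {G : SimpleGraph (Fin m)} (C : G.Coloring (Fin n)) : Prop :=
  ∀ a b : Fin n,
    (Finset.univ.filter (fun j => C j = a)).card ≤
      (Finset.univ.filter (fun j => C j = b)).card + 1

/-- The bundles of the allocation are the colour classes of an equitable `n`-colouring. -/
def Allocation.IsEquitableColoring {n m : ℕ} (A : Allocation n m)
    (G : SimpleGraph (Fin m)) : Prop :=
  ∃ C : G.Coloring (Fin n), (∀ i j, j ∈ A.bundle i ↔ C j = i) ∧ IsEquitable C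

/-! ### A random access machine with a step count

Programs are structured programs over registers and arrays that hold natural numbers. The only
arithmetic is addition, truncated subtraction and comparison. A step lengthens the longest
stored number by at most one bit, up to a constant that depends on the program, so polynomially
many unit-cost steps can be simulated by polynomially many steps of a Turing machine, and
conversely. A program is a finite text, so it uses finitely many registers and arrays. -/

/-- The contents of the registers and of the arrays. -/
structure State where
  reg : ℕ → ℕ
  arr : ℕ → ℕ → ℕ

inductive Expr where
  /-- constant -/
  | lit (k : ℕ)
  /-- contents of register `x` -/
  | reg (x : ℕ)
  /-- contents of the cell of array `a` whose address is the value of `e` -/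
  | get (a : ℕ) (e : Expr)
  | add (e f : Expr)
  /-- truncated subtraction -/
  | sub (e f : Expr)
  /-- `1` if equal, else `0` -/
  | eq (e f : Expr)
  /-- `1` if less, else `0` -/
  | lt (e f : Expr)

def Expr.eval (s : State) : Expr → ℕ
  | .lit k => k
  | .reg x => s.reg x
  | .get a e => s.arr a (e.eval s)
  | .add e f => e.eval s + f.eval s
  | .sub e f => e.eval s - f.eval s
  | .eq e f => if e.eval s = f.eval s then 1 else 0
  | .lt e f => if e.eval s < f.eval s then 1 else 0

/-- The number of steps for evaluating an expression: one for each operation in it. -/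
def Expr.cost : Expr → ℕ
  | .lit _ => 1
  | .reg _ => 1
  | .get _ e => 1 + e.cost
  | .add e f => 1 + e.cost + f.cost
  | .sub e f => 1 + e.cost + f.cost
  | .eq e f => 1 + e.cost + f.cost
  | .lt e f => 1 + e.cost + f.cost

inductive Program where
  | skip
  /-- write the value of `e` to register `x` -/
  | set (x : ℕ) (e : Expr)
  /-- write the value of `f` to the cell of array `a` whose address is the value of `e` -/
  | put (a : ℕ) (e f : Expr)
  | seq (P Q : Program)
  /-- run `P` if the value of `e` is nonzero, else run `Q` -/
  | cond (e : Expr) (P Q : Program)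
  /-- run `P` as long as the value of `e` is nonzero -/
  | loop (e : Expr) (P : Program)

/-- `Exec P s s' t`: started in state `s`, the program `P` halts in state `s'` after exactly
`t` steps. -/
inductive Exec : Program → State → State → ℕ → Prop where
  | skip (s : State) : Exec .skip s s 1
  | set (s : State) (x : ℕ) (e : Expr) :
      Exec (.set x e) s { s with reg := Function.update s.reg x (e.eval s) } (1 + e.cost)
  | put (s : State) (a : ℕ) (e f : Expr) :
      Exec (.put a e f) s
        { s with arr := Function.update s.arr a
                  (Function.update (s.arr a) (e.eval s) (f.eval s)) }
        (1 + e.cost + f.cost)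
  | seq {P Q : Program} {s s' s'' : State} {t t' : ℕ} :
      Exec P s s' t → Exec Q s' s'' t' → Exec (.seq P Q) s s'' (t + t')
  | cond_true {e : Expr} {P Q : Program} {s s' : State} {t : ℕ} :
      e.eval s ≠ 0 → Exec P s s' t → Exec (.cond e P Q) s s' (1 + e.cost + t)
  | cond_false {e : Expr} {P Q : Program} {s s' : State} {t : ℕ} :
      e.eval s = 0 → Exec Q s s' t → Exec (.cond e P Q) s s' (1 + e.cost + t)
  | loop_true {e : Expr} {P : Program} {s s' s'' : State} {t t' : ℕ} :
      e.eval s ≠ 0 → Exec P s s' t → Exec (.loop e P) s' s'' t' →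
        Exec (.loop e P) s s'' (1 + e.cost + t + t')
  | loop_false {e : Expr} {P : Program} {s : State} :
      e.eval s = 0 → Exec (.loop e P) s s (1 + e.cost)

open Classical in
/-- The input: register `0` holds the number `n` of agents, register `1` the number `m` of
items, and array `0` the adjacency matrix of the conflict graph, row by row. All other registers
and cells hold `0`. -/
noncomputable def inputState (n : ℕ) {m : ℕ} (G : SimpleGraph (Fin m)) : State where
  reg := fun x => if x = 0 then n else if x = 1 then m else 0
  arr := fun a k =>
    if a = 0 ∧ ∃ i j : Fin m, k = (i : ℕ) * m + (j : ℕ) ∧ G.Adj i j then 1 else 0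

/-- The output: cell `j` of array `1` holds the agent who receives item `j`. -/
def State.Outputs {n m : ℕ} (s : State) (A : Allocation n m) : Prop :=
  ∀ (i : Fin n) (j : Fin m), j ∈ A.bundle i ↔ s.arr 1 (j : ℕ) = (i : ℕ)

end FairAlloc

/-! If every item has the value `c > 0`, a bundle of size `b` is worth `b * c`, and `(b - 1) * c`
after the loss of one item. So EF1 says exactly that bundle sizes differ by at most one, while
feasibility says that bundles are independent sets. What remains is the algorithmic Hajnal–Szemerédi
theorem: a graph of maximum degree less than `n` has an equitable `n`-colouring, and it can be found
in polynomial time.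

A disjoint clique on fewer than `n` vertices makes the number `N` of vertices a multiple of `n`. A
class of a balanced colouring contains at most one clique vertex, so the colouring restricts to an
equitable one (`exists_allocation`). Vertices are coloured modulo `n` in the edgeless graph, and
edges are switched on vertex by vertex. Giving the current vertex a free colour keeps the colouring
proper and leaves at worst a class `lo` with one vertex too few and a class `hi` with one too many
(`Near`).

Let `K` be the active colours and `S` those that reach `lo` by moves of single vertices. If `hi` is
in `S`, a surplus vertex is shifted along a route. Otherwise every vertex coloured in `K \ S` has
neighbours in all classes of `S`. Let `W` be terminal: the rest of `S` reaches `lo` without it. Two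
improvements are used. Release (`Near.release`): some `z` of colour `W` is the only neighbour in `W`
of an outside vertex `y`, and `z` can move elsewhere in `S`. After this move the surplus goes to
`lo` around `W`, and `y` takes the place of `z`. All classes of `S` then have the right size and are
frozen; the degrees on `K \ S` still fit. Swap (`Near.swap`): `z` is the only neighbour in `W` of
two nonadjacent outside vertices `y` and `y'`. Then `y` replaces `z`, which moves outside;
afterwards `y'` can move to `W`, so one more colour is accessible. Double counting
(`lt_of_solo_degree_le`, `exists_common_solo`) shows that one of them is always available
(`exists_improvement`). The pair (active colours, accessible colours) improves lexicographically, so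
`N * N` sweeps suffice (`run_improve`).

The algorithm is written in a language `LP` of bounded loops and bounded searches with total
semantics. `LP.exec_comp` compiles it once and for all into machine programs with polynomial time
bounds, so the correctness proofs never count steps. -/

namespace FairAlloc

open Finset Relation

/-! ### Nearly equitable colourings: existence of an improvement by double counting. -/

section Core

variable {N : ℕ} {A : ℕ → ℕ → Prop} {f : ℕ → ℕ}

/-- Vertex `y` has no neighbour of colour `d`. -/
def Free (N : ℕ) (A : ℕ → ℕ → Prop) (f : ℕ → ℕ) (y d : ℕ) : Prop :=
  ∀ w < N, A y w → f w ≠ d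

/-- Some vertex of colour `c` can be recoloured with `d`. -/
def Mov (N : ℕ) (A : ℕ → ℕ → Prop) (f : ℕ → ℕ) (c d : ℕ) : Prop :=
  ∃ y < N, f y = c ∧ Free N A f y d

/-- Colour `c` reaches colour `t` by moves between colours in `S`. -/
def Conn (N : ℕ) (A : ℕ → ℕ → Prop) (f : ℕ → ℕ) (S : Finset ℕ) : ℕ → ℕ → Prop :=
  ReflTransGen (fun a b => a ∈ S ∧ b ∈ S ∧ Mov N A f a b)

/-- `z` is the only neighbour of `y` in the colour class of `z`. -/
def Solo (N : ℕ) (A : ℕ → ℕ → Prop) (f : ℕ → ℕ) (z y : ℕ) : Prop :=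
  z < N ∧ y < N ∧ A y z ∧ ∀ w < N, A y w → f w = f z → w = z

def cls (N : ℕ) (f : ℕ → ℕ) (c : ℕ) : Finset ℕ := (range N).filter (fun v => f v = c)

def verts (N : ℕ) (f : ℕ → ℕ) (S : Finset ℕ) : Finset ℕ := (range N).filter (fun v => f v ∈ S)

open Classical in
/-- The number of neighbours of `v` of colour `c`. -/
noncomputable def nb (N : ℕ) (A : ℕ → ℕ → Prop) (f : ℕ → ℕ) (v c : ℕ) : ℕ :=
  ((cls N f c).filter (fun w => A v w)).card

theorem mem_cls {v c : ℕ} : v ∈ cls N f c ↔ v < N ∧ f v = c := by simp [cls]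

theorem mem_verts {v : ℕ} {S : Finset ℕ} : v ∈ verts N f S ↔ v < N ∧ f v ∈ S := by simp [verts]

theorem nb_pos {v c : ℕ} : 1 ≤ nb N A f v c ↔ ¬ Free N A f v c := by
  classical
  rw [Nat.one_le_iff_ne_zero, nb, Ne, Finset.card_eq_zero, ← Ne, ← Finset.nonempty_iff_ne_empty]
  simp only [Free, Finset.Nonempty, mem_filter, mem_cls]
  push Not
  constructor
  · rintro ⟨w, ⟨h1, h2⟩, h3⟩; exact ⟨w, h1, h3, h2⟩
  · rintro ⟨w, h1, h3, h2⟩; exact ⟨w, ⟨h1, h2⟩, h3⟩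

theorem card_verts (S : Finset ℕ) : (verts N f S).card = ∑ c ∈ S, (cls N f c).card := by
  rw [Finset.card_eq_sum_card_fiberwise (s := verts N f S) (f := f) (t := S)]
  · refine sum_congr rfl fun c hc => ?_
    congr 1
    ext v
    simp only [mem_filter, mem_verts, mem_cls]
    constructor
    · rintro ⟨⟨h1, _⟩, h2⟩; exact ⟨h1, h2⟩
    · rintro ⟨h1, rfl⟩; exact ⟨⟨h1, hc⟩, rfl⟩
  · intro v hv
    exact (mem_verts.1 hv).2

open Classical in
theorem sum_nb (v : ℕ) (S : Finset ℕ) :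
    ∑ c ∈ S, nb N A f v c = ((verts N f S).filter (fun w => A v w)).card := by
  rw [Finset.card_eq_sum_card_fiberwise (s := (verts N f S).filter (fun w => A v w)) (f := f)
    (t := S)]
  · refine sum_congr rfl fun c hc => ?_
    rw [nb]
    congr 1
    ext w
    simp only [mem_filter, mem_verts, mem_cls]
    constructor
    · rintro ⟨⟨h1, rfl⟩, h2⟩; exact ⟨⟨⟨h1, hc⟩, h2⟩, rfl⟩
    · rintro ⟨⟨⟨h1, _⟩, h2⟩, rfl⟩; exact ⟨⟨h1, rfl⟩, h2⟩
  · intro w hw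
    simp only [coe_filter, mem_verts, Set.mem_ofPred_eq] at hw
    exact hw.1.2

open Classical in
theorem double_count (hA : ∀ v w, A v w → A w v) (X Y : Finset ℕ) :
    ∑ x ∈ X, (Y.filter (fun y => A x y)).card = ∑ y ∈ Y, (X.filter (fun x => A y x)).card := by
  have := Finset.sum_card_bipartiteAbove_eq_sum_card_bipartiteBelow (s := X) (t := Y) A
  simp only [bipartiteAbove, bipartiteBelow] at this
  rw [this]
  refine sum_congr rfl fun y _ => ?_
  congr 1
  ext x
  simp only [mem_filter]
  exact ⟨fun h => ⟨h.1, hA _ _ h.2⟩, fun h => ⟨h.1, hA _ _ h.2⟩⟩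

/-- A proper colouring with `n` colours, and a family `K` of active colours, on which the degrees
are less than `K.card`. All classes have size `s`, except that a member is missing in `lo` and
there is an extra one in `hi`. -/
structure Near (N : ℕ) (A : ℕ → ℕ → Prop) (n s : ℕ) (f : ℕ → ℕ) (K : Finset ℕ) (lo hi : ℕ) :
    Prop where
  col : ∀ v < N, f v < n
  proper : ∀ v < N, ∀ w < N, A v w → f v ≠ f w
  sub : K ⊆ range n
  deg : ∀ v < N, f v ∈ K → ∑ c ∈ K, nb N A f v c < K.card
  bal : ∀ c < n, (cls N f c).card + (if c = lo then 1 else 0) = s + (if c = hi then 1 else 0)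
  lo_mem : lo ∈ K
  hi_mem : hi ∈ K

theorem Conn.mono {S T : Finset ℕ} (h : S ⊆ T) {c t : ℕ} (hc : Conn N A f S c t) :
    Conn N A f T c t :=
  ReflTransGen.mono (fun _ _ hab => ⟨h hab.1, h hab.2.1, hab.2.2⟩) _ _ hc

/-- A walk that meets `U` is cut after its last visit to `U`; the rest avoids `U`. -/
theorem Conn.eq_or_avoid {S : Finset ℕ} {lo U c : ℕ} (hc : Conn N A f S c lo) (hU : U ≠ lo) :
    Conn N A f (S.erase U) c lo ∨ ∃ d ∈ S, d ≠ U ∧ Mov N A f U d ∧ Conn N A f (S.erase U) d lo := by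
  unfold Conn at hc
  induction hc using ReflTransGen.head_induction_on with
  | refl => exact Or.inl .refl
  | head hab hb' ih =>
    rename_i a b
    rcases ih with ih | ih
    · by_cases hb : b = U
      · subst hb
        rcases ReflTransGen.cases_head ih with h | ⟨d, h, _⟩
        · exact absurd h hU
        · simp at h
      · by_cases ha : a = U
        · subst ha
          exact Or.inr ⟨b, hab.2.1, hb, hab.2.2, ih⟩
        · exact Or.inl (ReflTransGen.head
            ⟨mem_erase.2 ⟨ha, hab.1⟩, mem_erase.2 ⟨hb, hab.2.1⟩, hab.2.2⟩ ih)
    · exact Or.inr ih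

theorem Conn.exists_step {S : Finset ℕ} {lo U : ℕ} (hc : Conn N A f S U lo) (hU : U ≠ lo) :
    ∃ d ∈ S, d ≠ U ∧ Mov N A f U d ∧ Conn N A f (S.erase U) d lo := by
  rcases hc.eq_or_avoid hU with h | h
  · rcases ReflTransGen.cases_head h with h | ⟨d, h, _⟩
    · exact absurd h hU
    · simp at h
  · exact h

/-- Every colour other than `W` still reaches `lo` when `W` is removed. -/
def Terminal (N : ℕ) (A : ℕ → ℕ → Prop) (f : ℕ → ℕ) (S : Finset ℕ) (lo W : ℕ) : Prop :=
  W ∈ S ∧ W ≠ lo ∧ ∀ c ∈ S.erase W, Conn N A f (S.erase W) c lo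

/-- Among the colours whose removal cuts some colour off from `lo`, let `U` cut off the fewest, and
let `T` be the set cut off. A colour `W` in `T` cuts off neither `U` nor anything outside `T`, so if
it cut off anything, that set would be a proper subset of `T`. A move from `T` to a colour of `S`
outside `T` other than `U` would be a way around `U`. -/
theorem exists_terminal_family {S : Finset ℕ} {lo : ℕ} (hlo : lo ∈ S) (hS : 2 ≤ S.card)
    (hr : ∀ c ∈ S, Conn N A f S c lo) :
    ∃ U ∈ S, ∃ T ⊆ S, T.Nonempty ∧ U ∉ T ∧ (∀ W ∈ T, Terminal N A f S lo W) ∧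
      ∀ W ∈ T, ∀ c ∈ S, c ∉ T → c ≠ U → ¬ Mov N A f W c := by
  classical
  let T : ℕ → Finset ℕ := fun U => (S.erase U).filter (fun c => ¬ Conn N A f (S.erase U) c lo)
  have hT : ∀ U c, c ∈ T U ↔ (c ≠ U ∧ c ∈ S) ∧ ¬ Conn N A f (S.erase U) c lo := by
    intro U c; simp only [T, mem_filter, mem_erase]
  -- Removing `lo` cuts off every other colour, so there is a candidate.
  have hcand : (S.filter (fun U => (T U).Nonempty)).Nonempty := by
    refine ⟨lo, mem_filter.2 ⟨hlo, ?_⟩⟩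
    obtain ⟨c, hc, hne⟩ := Finset.exists_mem_ne (s := S) (by omega) lo
    refine ⟨c, (hT _ _).2 ⟨⟨hne, hc⟩, fun h => ?_⟩⟩
    rcases ReflTransGen.cases_tail h with h | ⟨d, _, h⟩
    · exact hne h.symm
    · simp at h
  obtain ⟨U, hU, hmin⟩ := Finset.exists_min_image _ (fun U => (T U).card) hcand
  rw [mem_filter] at hU
  have hTlo : lo ∉ T U := by
    intro h
    exact ((hT _ _).1 h).2 .refl
  refine ⟨U, hU.1, T U, fun c hc => ((hT _ _).1 hc).1.2, hU.2, fun h => ((hT _ _).1 h).1.1 rfl,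
    ?_, ?_⟩
  · intro W hW
    have hW' := (hT _ _).1 hW
    have hWlo : W ≠ lo := fun h => hTlo (h ▸ hW)
    -- classes that avoid `U` also avoid `W`
    have key : ∀ c, Conn N A f (S.erase U) c lo → Conn N A f (S.erase W) c lo := by
      intro c hc
      unfold Conn at hc
      induction hc using ReflTransGen.head_induction_on with
      | refl => exact .refl
      | head hab hb ih =>
        rename_i a b
        refine ReflTransGen.head ⟨mem_erase.2 ⟨?_, (mem_erase.1 hab.1).2⟩,
          mem_erase.2 ⟨?_, (mem_erase.1 hab.2.1).2⟩, hab.2.2⟩ ih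
        · rintro rfl
          exact hW'.2 (ReflTransGen.head hab hb)
        · rintro rfl
          exact hW'.2 hb
    have hUc : Conn N A f (S.erase W) U lo := by
      by_cases hUlo : U = lo
      · subst hUlo; exact .refl
      · obtain ⟨d, hd, hdU, hm, hd'⟩ := (hr U hU.1).exists_step hUlo
        refine ReflTransGen.head ⟨mem_erase.2 ⟨hW'.1.1.symm, hU.1⟩, mem_erase.2 ⟨?_, hd⟩, hm⟩
          (key d hd')
        rintro rfl
        exact hW'.2 hd'
    refine ⟨hW'.1.2, hWlo, ?_⟩
    by_contra hcon
    push Not at hcon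
    obtain ⟨c, hc, hcn⟩ := hcon
    have hWc : W ∈ S.filter (fun U => (T U).Nonempty) :=
      mem_filter.2 ⟨hW'.1.2, c, (hT _ _).2 ⟨mem_erase.1 hc, hcn⟩⟩
    have hlt : (T W).card < (T U).card := by
      refine card_lt_card ⟨fun x hx => ?_, fun h => ((hT _ _).1 (h hW)).1.1 rfl⟩
      have hx' := (hT _ _).1 hx
      refine (hT _ _).2 ⟨⟨?_, hx'.1.2⟩, fun h => hx'.2 (key x h)⟩
      rintro rfl
      exact hx'.2 hUc
    exact absurd (hmin W hWc) (not_le.2 hlt)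
  · intro W hW c hc hcT hcU hm
    have hW' := (hT _ _).1 hW
    have hcc : Conn N A f (S.erase U) c lo := by
      by_contra h
      exact hcT ((hT _ _).2 ⟨⟨hcU, hc⟩, h⟩)
    exact hW'.2 (ReflTransGen.head ⟨mem_erase.2 ⟨hW'.1.1, hW'.1.2⟩, mem_erase.2 ⟨hcU, hc⟩, hm⟩ hcc)

/-- A vertex `z` of colour `W` with a private neighbour outside can be moved within `S`. -/
def CanRelease (N : ℕ) (A : ℕ → ℕ → Prop) (f : ℕ → ℕ) (S K : Finset ℕ) (W z y X : ℕ) : Prop :=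
  Solo N A f z y ∧ f z = W ∧ f y ∈ K \ S ∧ X ∈ S ∧ X ≠ W ∧ Free N A f z X

/-- Two nonadjacent vertices outside `S` have the same only neighbour `z` of colour `W`. -/
def CanSwap (N : ℕ) (A : ℕ → ℕ → Prop) (f : ℕ → ℕ) (S K : Finset ℕ) (W Y z y y' : ℕ) : Prop :=
  Solo N A f z y ∧ Solo N A f z y' ∧ f z = W ∧ f y = Y ∧ f y' ∈ K \ S ∧ y ≠ y' ∧ ¬ A y y'

theorem sum_nb_ge {S : Finset ℕ} {v : ℕ} (h : ∀ c ∈ S, ¬ Free N A f v c) :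
    S.card ≤ ∑ c ∈ S, nb N A f v c := by
  simpa using Finset.card_nsmul_le_sum S (fun c => nb N A f v c) 1 (fun c hc => nb_pos.2 (h c hc))

theorem sum_split {S K : Finset ℕ} (h : S ⊆ K) (g : ℕ → ℕ) :
    ∑ c ∈ K \ S, g c + ∑ c ∈ S, g c = ∑ c ∈ K, g c := Finset.sum_sdiff h

open Classical in
theorem solo_of_nb_eq_one {y W : ℕ} (hy : y < N) (h : nb N A f y W = 1) :
    ∃ z ∈ cls N f W, Solo N A f z y := by
  rw [nb, card_eq_one] at h
  obtain ⟨z, hz⟩ := h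
  have hz' : z ∈ (cls N f W).filter (fun w => A y w) := by rw [hz]; simp
  rw [mem_filter, mem_cls] at hz'
  refine ⟨z, mem_cls.2 hz'.1, hz'.1.1, hy, hz'.2, fun w hw hyw hfw => ?_⟩
  have : w ∈ (cls N f W).filter (fun w => A y w) :=
    mem_filter.2 ⟨mem_cls.2 ⟨hw, hfw.trans hz'.1.2⟩, hyw⟩
  rw [hz] at this
  simpa using this

-- Count the edges between `B` and the class `W`, and count those at vertices of `B` with a single
-- neighbour in `W` twice. Each vertex of `B` contributes at least two. If `t ≤ q`, each vertex of
-- `W` contributes at most `2 * q`: a solo one has degree at most `q`, and any other has degree at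
-- most `q + t` but no doubled edge. This bounds `2 * (q * s + 1)` by `2 * q * s`.
open Classical in
theorem lt_of_solo_degree_le (hA : ∀ v w, A v w → A w v) {B : Finset ℕ} {W q s t : ℕ}
    (hBN : ∀ y ∈ B, y < N) (hB : B.card = q * s + 1) (hW : (cls N f W).card = s)
    (hpos : ∀ y ∈ B, 1 ≤ nb N A f y W)
    (hdeg : ∀ x ∈ cls N f W, (B.filter (fun y => A x y)).card ≤ q + t)
    (hsolo : ∀ x ∈ cls N f W, (∃ y ∈ B, Solo N A f x y) →
      (B.filter (fun y => A x y)).card ≤ q) : q < t := by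
  by_contra hqt
  push Not at hqt
  set e : ℕ → ℕ := fun x => (B.filter (fun y => A x y)).card with he
  set P : ℕ → Prop := fun x => ∃ y ∈ B, Solo N A f x y with hP
  have h1 : 2 * B.card ≤ ∑ y ∈ B, nb N A f y W + (B.filter (fun y => nb N A f y W = 1)).card := by
    rw [card_filter, ← sum_add_distrib, mul_comm, ← smul_eq_mul]
    refine card_nsmul_le_sum _ _ _ fun y hy => ?_
    have := hpos y hy
    split_ifs <;> omega
  have h2 : ∑ y ∈ B, nb N A f y W = ∑ x ∈ cls N f W, e x := double_count hA B (cls N f W)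
  have h3 : (B.filter (fun y => nb N A f y W = 1)).card ≤ ∑ x ∈ (cls N f W).filter P, e x := by
    refine (card_le_card (t := ((cls N f W).filter P).biUnion
      (fun x => B.filter (fun y => A x y))) fun y hy => ?_).trans card_biUnion_le
    rw [mem_filter] at hy
    obtain ⟨z, hz, hs⟩ := solo_of_nb_eq_one (hBN y hy.1) hy.2
    exact mem_biUnion.2 ⟨z, mem_filter.2 ⟨hz, y, hy.1, hs⟩, mem_filter.2 ⟨hy.1, hA _ _ hs.2.2.1⟩⟩
  have h4 : ∑ x ∈ cls N f W, e x + ∑ x ∈ (cls N f W).filter P, e x ≤ s * (2 * q) := by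
    rw [sum_filter, ← sum_add_distrib, ← hW, ← smul_eq_mul]
    refine sum_le_card_nsmul _ _ _ fun x hx => ?_
    have := hdeg x hx
    by_cases hPx : P x
    · have := hsolo x hx hPx
      rw [if_pos hPx]
      simp only [he]; omega
    · rw [if_neg hPx]
      simp only [he]; omega
  rw [hB] at h1
  nlinarith

-- The closed neighbourhoods of the vertices of a largest independent set cover `B`.
open Classical in
theorem exists_maximal_independent (hA : ∀ v w, A v w → A w v) (B : Finset ℕ) :
    ∃ I ⊆ B, (∀ y ∈ I, ∀ y' ∈ I, y ≠ y' → ¬ A y y') ∧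
      B.card ≤ ∑ y ∈ I, ((B.filter (fun w => A y w)).card + 1) := by
  let P : Finset ℕ → Prop := fun I => ∀ y ∈ I, ∀ y' ∈ I, y ≠ y' → ¬ A y y'
  have hne : (B.powerset.filter P).Nonempty := ⟨∅, by simp [P]⟩
  obtain ⟨I, hI, hmax⟩ := exists_max_image _ Finset.card hne
  rw [mem_filter, mem_powerset] at hI
  refine ⟨I, hI.1, hI.2, ?_⟩
  refine (card_le_card (t := I.biUnion (fun y => insert y (B.filter (fun w => A y w))))
    fun v hv => ?_).trans (card_biUnion_le.trans (sum_le_sum fun y _ => card_insert_le _ _))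
  rw [mem_biUnion]
  by_cases hvI : v ∈ I
  · exact ⟨v, hvI, mem_insert_self _ _⟩
  · by_contra hcon
    push Not at hcon
    have hno : ∀ y ∈ I, ¬ A y v := fun y hy h =>
      hcon y hy (mem_insert_of_mem (mem_filter.2 ⟨hv, h⟩))
    have := hmax (insert v I) (mem_filter.2 ⟨mem_powerset.2 (insert_subset hv hI.1), ?_⟩)
    · rw [card_insert_of_notMem hvI] at this
      omega
    · intro y hy y' hy' hyy
      rcases mem_insert.1 hy with h1 | h1 <;> rcases mem_insert.1 hy' with h2 | h2
      · exact absurd (h1.trans h2.symm) hyy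
      · exact fun h => hno y' h2 (hA _ _ (h1 ▸ h))
      · exact h2 ▸ hno y h1
      · exact hI.2 y h1 y' h2 hyy

theorem Near.card_cls {n s : ℕ} {K : Finset ℕ} {lo hi c : ℕ} (h : Near N A n s f K lo hi)
    (hc : c ∈ K) (hlo : c ≠ lo) : (cls N f c).card = s + (if c = hi then 1 else 0) := by
  have := h.bal c (mem_range.1 (h.sub hc))
  rwa [if_neg hlo, add_zero] at this

theorem Near.card_verts {n s : ℕ} {K T : Finset ℕ} {lo hi : ℕ} (h : Near N A n s f K lo hi)
    (hT : T ⊆ K) (hlo : lo ∉ T) : (verts N f T).card = T.card * s + (if hi ∈ T then 1 else 0) := by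
  rw [FairAlloc.card_verts, sum_congr rfl (fun c hc => h.card_cls (hT hc) fun hcl => hlo (hcl ▸ hc)),
    sum_add_distrib]
  simp

/-- If a family of terminal colours is larger than the number `R.card` of colours that the large
class reaches, then two nonadjacent vertices have the same solo neighbour. -/
theorem exists_common_solo (hA : ∀ v w, A v w → A w v) {n s : ℕ} {K S T R : Finset ℕ} {lo hi : ℕ}
    (h : Near N A n s f K lo hi) (hS : S ⊆ K) (hT : T ⊆ S) (hR : R ⊆ K \ S) (hhi : hi ∈ R)
    (hloS : lo ∈ S) (hloT : lo ∉ T)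
    (hnS : ∀ y < N, f y ∈ R → ∀ c ∈ S, ¬ Free N A f y c)
    (hnR : ∀ y < N, f y ∈ R → ∀ c ∈ (K \ S) \ R, ¬ Free N A f y c)
    (hRT : R.card ≤ T.card) :
    ∃ z y y', f z ∈ T ∧ f y ∈ R ∧ f y' ∈ R ∧ Solo N A f z y ∧ Solo N A f z y' ∧ y ≠ y' ∧
      ¬ A y y' := by
  classical
  by_contra hcon
  push Not at hcon
  have hRK : R ⊆ K := hR.trans sdiff_subset
  have hloR : lo ∉ R := fun hl => (mem_sdiff.1 (hR hl)).2 hloS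
  have hhiT : hi ∉ T := fun hl => (mem_sdiff.1 (hR hhi)).2 (hT hl)
  have hB : (verts N f R).card = R.card * s + 1 := by
    rw [h.card_verts hRK hloR, if_pos hhi]
  have hA' : (verts N f T).card = T.card * s := by
    rw [h.card_verts (hT.trans hS) hloT, if_neg hhiT, add_zero]
  obtain ⟨I, hIB, hI, hcov⟩ := exists_maximal_independent hA (verts N f R)
  have hKS : (K \ S).card + S.card = K.card := card_sdiff_add_card_eq_card hS
  have hKR : ((K \ S) \ R).card + R.card = (K \ S).card := card_sdiff_add_card_eq_card hR
  set D : ℕ → ℕ := fun y => ((verts N f R).filter (fun w => A y w)).card with hD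
  set σ : ℕ → ℕ := fun y => (T.filter (fun c => nb N A f y c = 1)).card with hσ
  -- The degree of `y` is less than `K.card`. It has a neighbour in each class of `S` and a second
  -- one in each class of `T` not counted by `σ y`, one in each class of `(K \ S) \ R`, and `D y` in
  -- the classes of `R`.
  have key : ∀ y ∈ I, T.card + (D y + 1) ≤ R.card + σ y := by
    intro y hy
    obtain ⟨hyN, hyR⟩ := mem_verts.1 (hIB hy)
    have h1 := h.deg y hyN (hRK hyR)
    rw [← sum_split hS, ← sum_split hR, sum_nb y R] at h1
    have h2 := sum_nb_ge (hnR y hyN hyR)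
    have h3 : S.card + (T.filter (fun c => ¬ nb N A f y c = 1)).card ≤ ∑ c ∈ S, nb N A f y c := by
      have : (T.filter (fun c => ¬ nb N A f y c = 1)).card ≤
          (S.filter (fun c => ¬ nb N A f y c = 1)).card :=
        card_le_card (filter_subset_filter _ hT)
      refine (Nat.add_le_add_left this _).trans ?_
      rw [card_eq_sum_ones, card_filter, ← sum_add_distrib]
      refine sum_le_sum fun c hc => ?_
      have := nb_pos.2 (hnS y hyN hyR c hc)
      split_ifs <;> omega
    have h4 := card_filter_add_card_filter_not (s := T) (fun c => nb N A f y c = 1)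
    simp only [hD, hσ]
    omega
  have hσT : ∀ y, σ y ≤ T.card := fun y => card_filter_le _ _
  -- By `key` and `σ y ≤ T.card`, each closed neighbourhood has at most `R.card` vertices; since
  -- they cover, `I` has more than `s` members.
  have hIs : R.card * s + 1 ≤ I.card * R.card := by
    rw [← hB, ← smul_eq_mul]
    refine hcov.trans (sum_le_card_nsmul _ _ _ fun y hy => ?_)
    have := key y hy
    have := hσT y
    simp only [hD] at *
    omega
  have hsum : I.card * T.card + (R.card * s + 1) ≤ I.card * R.card + ∑ y ∈ I, σ y := by
    have := sum_le_sum key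
    simp only [sum_add_distrib, sum_const, smul_eq_mul] at this
    have hcov' : _ ≤ ∑ y ∈ I, (D y + 1) := hcov
    rw [hB] at hcov'
    simp only [sum_add_distrib, sum_const, smul_eq_mul] at hcov'
    omega
  -- By assumption the solo neighbours of `z` are pairwise adjacent, so the independent set `I`
  -- contains at most one of them.
  have hσsum : ∑ y ∈ I, σ y ≤ T.card * s := by
    rw [← hA']
    calc ∑ y ∈ I, σ y ≤ ∑ y ∈ I, ((verts N f T).filter (fun z => Solo N A f z y)).card := by
          refine sum_le_sum fun y hy => ?_
          refine (card_le_card (t := ((verts N f T).filter (fun z => Solo N A f z y)).image f)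
            fun c hc => ?_).trans card_image_le
          rw [mem_filter] at hc
          obtain ⟨z, hz, hs⟩ := solo_of_nb_eq_one (mem_verts.1 (hIB hy)).1 hc.2
          rw [mem_cls] at hz
          exact mem_image.2 ⟨z, mem_filter.2 ⟨mem_verts.2 ⟨hz.1, hz.2 ▸ hc.1⟩, hs⟩, hz.2⟩
      _ = ∑ z ∈ verts N f T, (I.filter (fun y => Solo N A f z y)).card :=
          sum_card_bipartiteAbove_eq_sum_card_bipartiteBelow (fun y z => Solo N A f z y)
      _ ≤ ∑ z ∈ verts N f T, 1 := by
          refine sum_le_sum fun z hz => card_le_one.2 fun y hy y' hy' => ?_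
          rw [mem_filter] at hy hy'
          by_contra hne
          exact hI y hy.1 y' hy'.1 hne (hcon z y y' (mem_verts.1 hz).2
            (mem_verts.1 (hIB hy.1)).2 (mem_verts.1 (hIB hy'.1)).2 hy.2 hy'.2 hne)
      _ = (verts N f T).card := by simp
  -- With `e = T.card - R.card`, the two sums give `I.card * e + 1 ≤ s * e`, against `s < I.card`.
  obtain ⟨e, he⟩ := Nat.exists_eq_add_of_le hRT
  rw [he] at hsum hσsum
  have hlt : s < I.card := by
    by_contra hle
    push Not at hle
    nlinarith [Nat.mul_le_mul_right R.card hle]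
  nlinarith [Nat.mul_le_mul_left e hlt.le]

/-- If only `lo` were accessible, its `s - 1` vertices, each with at most `q = (K \ S).card`
neighbours outside, would have to dominate `q * s + 1` vertices. -/
theorem Near.two_le_card (hA : ∀ v w, A v w → A w v) {n s : ℕ} {K S : Finset ℕ} {lo hi : ℕ}
    (h : Near N A n s f K lo hi) (hS : S ⊆ K) (hlo : lo ∈ S) (hhi : hi ∉ S)
    (hcl : ∀ c ∈ K \ S, ∀ d ∈ S, ¬ Mov N A f c d) : 2 ≤ S.card := by
  classical
  by_contra hcon
  have hS1 : S = {lo} := by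
    refine (eq_singleton_iff_unique_mem.2 ⟨hlo, fun c hc => ?_⟩)
    exact card_le_one.1 (by omega) c hc lo hlo
  have hKS : (K \ S).card + S.card = K.card := card_sdiff_add_card_eq_card hS
  have hB : (verts N f (K \ S)).card = (K \ S).card * s + 1 := by
    rw [h.card_verts sdiff_subset (fun hl => (mem_sdiff.1 hl).2 hlo),
      if_pos (mem_sdiff.2 ⟨h.hi_mem, hhi⟩)]
  have hlos : (cls N f lo).card + 1 = s := by
    have := h.bal lo (mem_range.1 (h.sub h.lo_mem))
    rwa [if_pos rfl, if_neg (show ¬ lo = hi from fun hl => hhi (hl ▸ hlo)), add_zero] at this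
  have h1 : (verts N f (K \ S)).card ≤ ∑ y ∈ verts N f (K \ S), nb N A f y lo := by
    rw [card_eq_sum_ones]
    refine sum_le_sum fun y hy => nb_pos.2 fun hf => ?_
    obtain ⟨hyN, hyK⟩ := mem_verts.1 hy
    exact hcl _ hyK lo hlo ⟨y, hyN, rfl, hf⟩
  have h2 : ∑ y ∈ verts N f (K \ S), nb N A f y lo ≤ (cls N f lo).card * (K \ S).card := by
    have := double_count hA (verts N f (K \ S)) (cls N f lo)
    simp only [nb]
    rw [this, ← smul_eq_mul]
    refine sum_le_card_nsmul _ _ _ fun x hx => ?_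
    obtain ⟨hxN, hxl⟩ := mem_cls.1 hx
    have hd := h.deg x hxN (hxl ▸ h.lo_mem)
    rw [← sum_split hS, sum_nb] at hd
    rw [hS1, card_singleton] at hKS
    rw [hS1] at hd ⊢
    omega
  rw [hB] at h1
  nlinarith

/-- If the large class does not reach the small one, then the colouring can be improved at some
terminal colour. -/
theorem exists_improvement (hA : ∀ v w, A v w → A w v) {n s : ℕ} {K S : Finset ℕ} {lo hi : ℕ}
    (h : Near N A n s f K lo hi) (hS : S ⊆ K) (hlo : lo ∈ S) (hhi : hi ∉ S)
    (hcl : ∀ c ∈ K \ S, ∀ d ∈ S, ¬ Mov N A f c d) (hr : ∀ c ∈ S, Conn N A f S c lo) :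
    ∃ W, Terminal N A f S lo W ∧ ((∃ z y X, CanRelease N A f S K W z y X) ∨
      ∃ Y z y y', Conn N A f (K \ S) hi Y ∧ Y ∈ K \ S ∧ CanSwap N A f S K W Y z y y') := by
  classical
  obtain ⟨U, hU, T, hTS, ⟨W, hW⟩, hUT, hterm, hnm⟩ :=
    exists_terminal_family hlo (h.two_le_card hA hS hlo hhi hcl) hr
  by_contra hcon
  push Not at hcon
  have hhiK : hi ∈ K \ S := mem_sdiff.2 ⟨h.hi_mem, hhi⟩
  have hKS : (K \ S).card + S.card = K.card := card_sdiff_add_card_eq_card hS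
  have hloT : lo ∉ T := fun hl => (hterm lo hl).2.1 rfl
  have hfreeS : ∀ y < N, f y ∈ K \ S → ∀ d ∈ S, ¬ Free N A f y d := fun y hy hyK d hd hf =>
    hcl _ hyK d hd ⟨y, hy, rfl, hf⟩
  -- A vertex coloured in `T` has neighbours in all classes of `S` outside `insert U T`, which
  -- leaves at most `(K \ S).card + T.card` neighbours outside `S`. A solo one cannot be released,
  -- so it has neighbours in all other classes of `S`, which leaves at most `(K \ S).card`.
  have hqt : (K \ S).card < T.card := by
    refine lt_of_solo_degree_le (W := W) (s := s) hA (fun y hy => (mem_verts.1 hy).1)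
      (by rw [h.card_verts sdiff_subset (fun hl => (mem_sdiff.1 hl).2 hlo), if_pos hhiK])
      (by rw [h.card_cls (hS (hTS hW)) (hterm W hW).2.1,
            if_neg (show ¬ W = hi from fun hl => hhi (hl ▸ hTS hW)), add_zero])
      (fun y hy => nb_pos.2 (hfreeS y (mem_verts.1 hy).1 (mem_verts.1 hy).2 W (hTS hW))) ?_ ?_
    · intro x hx
      obtain ⟨hxN, rfl⟩ := mem_cls.1 hx
      have hd := h.deg x hxN (hS (hTS hW))
      have hUT' : insert U T ⊆ S := insert_subset hU hTS
      rw [← sum_split hS, sum_nb, ← sum_split hUT'] at hd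
      have h1 : (S \ insert U T).card ≤ ∑ c ∈ S \ insert U T, nb N A f x c := by
        refine sum_nb_ge fun c hc hf => ?_
        rw [mem_sdiff, mem_insert, not_or] at hc
        exact hnm (f x) hW c hc.1 hc.2.2 hc.2.1 ⟨x, hxN, rfl, hf⟩
      have h2 : (S \ insert U T).card + (insert U T).card = S.card :=
        card_sdiff_add_card_eq_card hUT'
      rw [card_insert_of_notMem hUT] at h2
      omega
    · rintro x hx ⟨y, hy, hxy⟩
      obtain ⟨hxN, rfl⟩ := mem_cls.1 hx
      have hd := h.deg x hxN (hS (hTS hW))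
      rw [← sum_split hS, sum_nb, ← sum_split (erase_subset (f x) S)] at hd
      have h1 : (S.erase (f x)).card ≤ ∑ c ∈ S.erase (f x), nb N A f x c := by
        refine sum_nb_ge fun c hc hf => ?_
        rw [mem_erase] at hc
        exact (hcon (f x) (hterm _ hW)).1 x y c
          ⟨hxy, rfl, (mem_verts.1 hy).2, hc.2, hc.1, hf⟩
      have h2 : (S.erase (f x)).card + 1 = S.card := card_erase_add_one (hTS hW)
      have h3 := sum_split (erase_subset (f x) S) (nb N A f x)
      omega
  -- These are the colours to which the surplus can be shifted before a swap. They are closed under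
  -- moves, so their vertices have neighbours in every other class of `K \ S`.
  set R := (K \ S).filter (fun c => Conn N A f (K \ S) hi c) with hR
  have hRK : R ⊆ K \ S := filter_subset _ _
  obtain ⟨z, y, y', hz, hy, hy', hs, hs', hne, hadj⟩ := exists_common_solo hA h hS hTS hRK
    (mem_filter.2 ⟨hhiK, .refl⟩) hlo hloT (fun y hy hyR => hfreeS y hy (hRK hyR))
    (by
      intro y hy hyR c hc hf
      rw [mem_sdiff] at hc
      rw [hR, mem_filter] at hyR
      exact hc.2 (mem_filter.2 ⟨hc.1, hyR.2.tail ⟨hyR.1, hc.1, y, hy, rfl, hf⟩⟩))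
    ((card_le_card hRK).trans hqt.le)
  rw [hR, mem_filter] at hy
  exact (hcon (f z) (hterm _ hz)).2 (f y) z y y' hy.2 hy.1
    ⟨hs, hs', rfl, rfl, hRK hy', hne, hadj⟩

end Core

end FairAlloc

namespace FairAlloc

open Finset Relation

/-! ### The effect of shifts, releases and swaps on the colouring. -/

section Recolour

variable {N : ℕ} {A : ℕ → ℕ → Prop} {f : ℕ → ℕ}

def Proper (N : ℕ) (A : ℕ → ℕ → Prop) (f : ℕ → ℕ) : Prop :=
  ∀ v < N, ∀ w < N, A v w → f v ≠ f w

theorem Proper.update (hA : ∀ v w, A v w → A w v) (h : Proper N A f) {y d : ℕ}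
    (hy : y < N) (hf : Free N A f y d) : Proper N A (Function.update f y d) := by
  intro v hv w hw hvw
  have hne : v ≠ w := fun h' => h v hv w hw hvw (congrArg f h')
  by_cases hvy : v = y
  · subst hvy
    rw [Function.update_self, Function.update_of_ne hne.symm]
    exact (hf w hw hvw).symm
  · rw [Function.update_of_ne hvy]
    by_cases hwy : w = y
    · subst hwy
      rw [Function.update_self]
      exact hf v hv (hA _ _ hvw)
    · rw [Function.update_of_ne hwy]
      exact h v hv w hw hvw

/-- Indicators on both sides avoid subtraction and cover the case `d = f y`. -/
theorem card_cls_update {y : ℕ} (hy : y < N) (d c : ℕ) :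
    (cls N (Function.update f y d) c).card + (if c = f y then 1 else 0) =
      (cls N f c).card + (if c = d then 1 else 0) := by
  have key : ∀ g : ℕ → ℕ, (cls N g c).card =
      (((range N).erase y).filter (fun v => g v = c)).card + (if c = g y then 1 else 0) := by
    intro g
    rw [cls, ← insert_erase (mem_range.2 hy), filter_insert]
    by_cases h : g y = c
    · rw [if_pos h, if_pos h.symm, card_insert_of_notMem (by simp), erase_insert (by simp)]
    · rw [if_neg h, if_neg (Ne.symm h), erase_insert (by simp), add_zero]
  rw [key f, key (Function.update f y d), Function.update_self]
  have : ((range N).erase y).filter (fun v => Function.update f y d v = c) =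
      ((range N).erase y).filter (fun v => f v = c) := by
    refine filter_congr fun v hv => ?_
    rw [Function.update_of_ne (ne_of_mem_erase hv)]
  rw [this]
  omega

/-- Every colour `c ≠ t` in `R` of rank at most `r` has a vertex `wit c` that can be moved to the
colour `par c` of smaller rank. -/
def Routed (N : ℕ) (A : ℕ → ℕ → Prop) (f : ℕ → ℕ) (t : ℕ) (R : ℕ → Prop) (par wit ρ : ℕ → ℕ)
    (r : ℕ) : Prop :=
  ∀ c, R c → c ≠ t → ρ c ≤ r →
    R (par c) ∧ ρ (par c) < ρ c ∧ wit c < N ∧ f (wit c) = c ∧ Free N A f (wit c) (par c)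

/-- The remaining routes from `d` survive the move of `y`: their witnesses do not have the colour
`x`, so `y` is not among them, and their targets have rank below `ρ d`, so the new colour `d` of `y`
blocks none of them. -/
theorem Routed.update {t r x y d : ℕ} {R : ℕ → Prop} {par wit ρ : ℕ → ℕ}
    (h : Routed N A f t R par wit ρ r) (hy : f y = x) (hd : ρ d ≤ r)
    (hx : ∀ c, R c → ρ c ≤ ρ d → c ≠ x) :
    Routed N A (Function.update f y d) t R par wit ρ (ρ d) := by
  intro c hc hct hcr
  obtain ⟨h1, h2, h3, h4, h5⟩ := h c hc hct (hcr.trans hd)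
  refine ⟨h1, h2, h3, ?_, fun w hw hA' => ?_⟩
  · rw [Function.update_of_ne, h4]
    rintro h'
    rw [h', hy] at h4
    exact hx c hc hcr h4.symm
  · by_cases hwy : w = y
    · subst hwy
      rw [Function.update_self]
      rintro rfl
      omega
    · rw [Function.update_of_ne hwy]
      exact h5 w hw hA'

/-- `g` arises from `f` by moving the surplus vertex of class `x₀` towards `t`, up to `x`. -/
structure Shifted (N : ℕ) (A : ℕ → ℕ → Prop) (f : ℕ → ℕ) (x₀ t : ℕ) (R : ℕ → Prop) (g : ℕ → ℕ)
    (x : ℕ) : Prop where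
  proper : Proper N A g
  card : ∀ c, (cls N g c).card + (if c = x₀ then 1 else 0) =
    (cls N f c).card + (if c = x then 1 else 0)
  stay : ∀ v, g v = f v ∨ R (f v) ∧ R (g v)
  target : ∀ v, f v = t → g v = t

theorem Shifted.refl (h : Proper N A f) (x t : ℕ) (R : ℕ → Prop) : Shifted N A f x t R f x :=
  ⟨h, fun _ => rfl, fun _ => Or.inl rfl, fun _ h => h⟩

theorem Shifted.step (hA : ∀ v w, A v w → A w v) {g : ℕ → ℕ} {x₀ t x y d : ℕ} {R : ℕ → Prop}
    (h : Shifted N A f x₀ t R g x) (hx : R x) (hxt : x ≠ t) (hd : R d) (hy : y < N) (hyx : g y = x)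
    (hf : Free N A g y d) : Shifted N A f x₀ t R (Function.update g y d) d where
  proper := h.proper.update hA hy hf
  card := by
    intro c
    have h1 := h.card c
    have h2 := card_cls_update (f := g) hy d c
    rw [hyx] at h2
    omega
  stay := by
    intro v
    by_cases hv : v = y
    · subst hv
      rw [Function.update_self]
      rcases h.stay v with h' | h'
      · rw [hyx] at h'
        exact Or.inr ⟨h' ▸ hx, hd⟩
      · exact Or.inr ⟨h'.1, hd⟩
    · rw [Function.update_of_ne hv]
      exact h.stay v
  target := by
    intro v hv
    have := h.target v hv
    rw [Function.update_of_ne, this]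
    rintro rfl
    exact hxt (hyx.symm.trans this)

theorem sum_nb_le_of_subset {S S' : Finset ℕ} {g : ℕ → ℕ} (v : ℕ)
    (h : ∀ w < N, g w ∈ S' → f w ∈ S) :
    ∑ c ∈ S', nb N A g v c ≤ ∑ c ∈ S, nb N A f v c := by
  classical
  rw [sum_nb, sum_nb]
  refine card_le_card (filter_subset_filter _ fun w hw => ?_)
  rw [mem_verts] at hw ⊢
  exact ⟨hw.1, h w hw.1 hw.2⟩

/-- `W` exchanges `z` for `y`, the class `X` passes its surplus on, and `lo` is filled, so all
classes of `S` end with `s` vertices. The deficit is now in the old class of `y`; if that class is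
`hi`, the colouring is balanced. -/
theorem Near.release (hA : ∀ v w, A v w → A w v) {n s : ℕ} {K S : Finset ℕ}
    {lo hi W z y X : ℕ} (h : Near N A n s f K lo hi) (hS : S ⊆ K) (hhi : hi ∉ S)
    (hcl : ∀ c ∈ K \ S, ∀ d ∈ S, ¬ Mov N A f c d) (hW : W ∈ S)
    (hc : CanRelease N A f S K W z y X) {g : ℕ → ℕ}
    (hg : Shifted N A (Function.update f z X) X lo (· ∈ S.erase W) g lo) :
    g y = f y ∧ Near N A n s (Function.update g y W) (K \ S) (f y) hi := by
  obtain ⟨⟨hz, hy, hyz, huniq⟩, hzW, hyK, hX, hXW, hfree⟩ := hc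
  have hyS : f y ∉ S := (mem_sdiff.1 hyK).2
  have hyz' : y ≠ z := by
    rintro rfl
    exact hyS (hzW ▸ hW)
  have hgy : g y = f y := by
    rcases hg.stay y with h' | h'
    · rwa [Function.update_of_ne hyz'] at h'
    · rw [Function.update_of_ne hyz'] at h'
      exact absurd (mem_of_mem_erase h'.1) hyS
  have hback : ∀ v, g v ∉ S.erase W → v ≠ z ∧ g v = f v := by
    intro v hv
    rcases hg.stay v with h' | h'
    · by_cases hvz : v = z
      · subst hvz
        rw [Function.update_self] at h'
        exact absurd (mem_erase.2 ⟨hXW, hX⟩) (h' ▸ hv)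
      · rw [Function.update_of_ne hvz] at h'
        exact ⟨hvz, h'⟩
    · exact absurd h'.2 hv
  -- The shift brings no vertex into `W`, and the only neighbour of `y` there has left.
  have hfreeW : Free N A g y W := by
    intro w hw hyw hgw
    obtain ⟨h1, h2⟩ := hback w (by rw [hgw]; simp)
    exact h1 (huniq w hw hyw (by rw [← h2, hgw, hzW]))
  have hverts : ∀ v, Function.update g y W v ∈ K \ S → v ≠ y ∧ f v ∈ K \ S := by
    intro v hv
    by_cases hvy : v = y
    · subst hvy
      rw [Function.update_self] at hv
      exact absurd hW (mem_sdiff.1 hv).2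
    · rw [Function.update_of_ne hvy] at hv
      obtain ⟨_, h2⟩ := hback v (fun h' => (mem_sdiff.1 hv).2 (mem_of_mem_erase h'))
      exact ⟨hvy, h2 ▸ hv⟩
  refine ⟨hgy, ?_, hg.proper.update hA hy hfreeW, sdiff_subset.trans h.sub, ?_, ?_, hyK,
    mem_sdiff.2 ⟨h.hi_mem, hhi⟩⟩
  · intro v hv
    by_cases hvy : v = y
    · subst hvy
      rw [Function.update_self]
      exact mem_range.1 (h.sub (hS hW))
    · rw [Function.update_of_ne hvy]
      by_cases hgv : g v ∈ S.erase W
      · exact mem_range.1 (h.sub (hS (mem_of_mem_erase hgv)))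
      · rw [(hback v hgv).2]
        exact h.col v hv
  · intro v hv hvK
    have hvK' := (hverts v hvK).2
    have h1 := sum_nb_le_of_subset (N := N) (A := A) (f := f) (S := K \ S) (S' := K \ S)
      (g := Function.update g y W) v (fun w _ hw => (hverts w hw).2)
    have h2 := h.deg v hv (mem_sdiff.1 hvK').1
    rw [← sum_split hS] at h2
    -- Dropping `S` lowers the number of active colours by `S.card` and the degree of `v` by at
    -- least as much.
    have h3 : S.card ≤ ∑ c ∈ S, nb N A f v c :=
      sum_nb_ge fun d hd hf => hcl _ hvK' d hd ⟨v, hv, rfl, hf⟩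
    have h4 : (K \ S).card + S.card = K.card := card_sdiff_add_card_eq_card hS
    omega
  · intro c hc
    have h1 := card_cls_update (f := g) hy W c
    have h2 := hg.card c
    have h3 := card_cls_update (f := f) hz X c
    have h4 := h.bal c hc
    rw [hgy] at h1
    rw [hzW] at h3
    omega

/-- As `z` cannot be released, it has neighbours in all classes of `S.erase W`, hence at most `(K \
S).card` neighbours outside `S`. One of them is `y`; the others are too few to meet every colour of
`K \ S`, and the shift only permutes colours inside that set. -/
theorem Near.exists_free_class (hA : ∀ v w, A v w → A w v) {n s : ℕ} {K S : Finset ℕ}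
    {lo hi W Y z y y' : ℕ} (h : Near N A n s f K lo hi) (hS : S ⊆ K) (hW : W ∈ S)
    (hY : Y ∈ K \ S) (hno : ∀ z y X, ¬ CanRelease N A f S K W z y X)
    (hc : CanSwap N A f S K W Y z y y') {g : ℕ → ℕ}
    (hg : Shifted N A f hi Y (· ∈ K \ S) g Y) :
    ∃ Q ∈ K \ S, ∀ w < N, A z w → g w = Q → w = y := by
  classical
  obtain ⟨hs, hs', hzW, hyY, hyK', hne, hadj⟩ := hc
  have hd := h.deg z hs.1 (hS (hzW ▸ hW))
  rw [← sum_split hS, ← sum_split (erase_subset W S), sum_nb] at hd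
  have h1 : (S.erase W).card ≤ ∑ c ∈ S.erase W, nb N A f z c := by
    refine sum_nb_ge fun c hc hf => ?_
    rw [mem_erase] at hc
    exact hno z y c ⟨hs, hzW, hyY ▸ hY, hc.2, hc.1, hf⟩
  have h2 : (S.erase W).card + 1 = S.card := card_erase_add_one hW
  have h3 : (K \ S).card + S.card = K.card := card_sdiff_add_card_eq_card hS
  by_contra hcon
  push Not at hcon
  have hsub : K \ S ⊆ (((verts N f (K \ S)).filter (fun w => A z w)).erase y).image g := by
    intro Q hQ
    obtain ⟨w, hw, hzw, hgw, hwy⟩ := hcon Q hQ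
    refine mem_image.2 ⟨w, mem_erase.2 ⟨hwy, mem_filter.2 ⟨mem_verts.2 ⟨hw, ?_⟩, hzw⟩⟩, hgw⟩
    rcases hg.stay w with h' | h'
    · rw [← h', hgw]; exact hQ
    · exact h'.1
  have h4 := (card_le_card hsub).trans card_image_le
  have h5 : y ∈ (verts N f (K \ S)).filter (fun w => A z w) :=
    mem_filter.2 ⟨mem_verts.2 ⟨hs.2.1, hyY ▸ hY⟩, hA _ _ hs.2.2.1⟩
  have h6 := card_erase_add_one h5
  omega

open Classical in
/-- The active colours that reach `lo`. -/
noncomputable def acc (N : ℕ) (A : ℕ → ℕ → Prop) (f : ℕ → ℕ) (K : Finset ℕ) (lo : ℕ) : Finset ℕ :=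
  K.filter (fun c => Conn N A f K c lo)

/-- The surplus, first shifted to `Y`, leaves it with `y`; `W` exchanges `z` for `y`, and `Q`
receives `z`, so `Q` is the new large class. The old accessible colours survive because `W` is
terminal, and the colour of `y'` joins them. -/
theorem Near.swap (hA : ∀ v w, A v w → A w v) {n s : ℕ} {K S : Finset ℕ}
    {lo hi W Y z y y' Q : ℕ} (h : Near N A n s f K lo hi) (hS : S ⊆ K)
    (hr : ∀ c ∈ S, Conn N A f S c lo) (hW : Terminal N A f S lo W)
    (hY : Y ∈ K \ S) (hno : ∀ z y X, ¬ CanRelease N A f S K W z y X)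
    (hc : CanSwap N A f S K W Y z y y') {g : ℕ → ℕ}
    (hg : Shifted N A f hi Y (· ∈ K \ S) g Y) (hQ : Q ∈ K \ S)
    (hQf : ∀ w < N, A z w → g w = Q → w = y) :
    Near N A n s (Function.update (Function.update g y W) z Q) K lo Q ∧
      S.card < (acc N A (Function.update (Function.update g y W) z Q) K lo).card := by
  classical
  obtain ⟨hs, hs', hzW, hyY, hyK', hne, hadj⟩ := hc
  obtain ⟨hWS, hWlo, hterm⟩ := hW
  set F := Function.update (Function.update g y W) z Q with hF
  have hback : ∀ v, g v ∉ K \ S → g v = f v := fun v hv =>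
    (hg.stay v).resolve_right fun h' => hv h'.2
  have hforw : ∀ v, f v ∉ K \ S → g v = f v := fun v hv =>
    (hg.stay v).resolve_right fun h' => hv h'.1
  have hyS : f y ∉ S := hyY ▸ (mem_sdiff.1 hY).2
  have hyS' : f y' ∉ S := (mem_sdiff.1 hyK').2
  have hyz : y ≠ z := by rintro rfl; exact hyS (hzW ▸ hWS)
  have hyz' : y' ≠ z := by rintro rfl; exact hyS' (hzW ▸ hWS)
  -- A shift towards `Y` never moves a vertex out of `Y`.
  have hgy : g y = Y := hg.target y hyY
  have hWK : W ∉ K \ S := fun h' => (mem_sdiff.1 h').2 hWS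
  have hgz : g z = W := by rw [hforw z (hzW ▸ hWK), hzW]
  have hQW : Q ≠ W := by rintro rfl; exact hWK hQ
  have hFz : F z = Q := by simp [hF]
  have hFy : F y = W := by simp [hF, hyz]
  have hFo : ∀ v, v ≠ z → v ≠ y → F v = g v := fun v h1 h2 => by simp [hF, h1, h2]
  have hgW : ∀ w, g w = W → f w = W := fun w hw => by rw [← hback w (hw ▸ hWK), hw]
  have hloc : ∀ v w, v < N → w < N → A v w → v = z → F v ≠ F w := by
    rintro v w hv hw hvw rfl
    rw [hFz]
    have hwv : w ≠ v := by
      rintro rfl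
      exact h.proper w hv w hv hvw rfl
    by_cases hwy : w = y
    · subst hwy; rw [hFy]; exact hQW
    · rw [hFo w hwv hwy]
      exact fun h' => hwy (hQf w hw hvw h'.symm)
  have hloc' : ∀ v w, v < N → w < N → A v w → w ≠ z → v = y → F v ≠ F w := by
    rintro v w hv hw hvw hwz rfl
    have hwv : w ≠ v := by
      rintro rfl
      exact h.proper w hv w hv hvw rfl
    rw [hFy, hFo w hwz hwv]
    intro h'
    exact hwz (hs.2.2.2 w hw hvw (by rw [hgW w h'.symm, hzW]))
  have hFK : ∀ v, F v ∈ K → f v ∈ K := by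
    intro v hv
    by_cases hvz : v = z
    · rw [hvz, hzW]; exact hS hWS
    by_cases hvy : v = y
    · rw [hvy, hyY]; exact (mem_sdiff.1 hY).1
    rw [hFo v hvz hvy] at hv
    rcases hg.stay v with h' | h'
    · rwa [h'] at hv
    · exact (mem_sdiff.1 h'.1).1
  have hE : ∀ w c, c ∈ S.erase W → (F w = c ↔ f w = c) := by
    intro w c hc
    have hcW := ne_of_mem_erase hc
    have hcS := mem_of_mem_erase hc
    have hcK : c ∉ K \ S := fun h' => (mem_sdiff.1 h').2 hcS
    by_cases hwz : w = z
    · subst hwz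
      rw [hFz, hzW]
      exact ⟨fun h' => absurd (h' ▸ hQ) hcK, fun h' => absurd h'.symm hcW⟩
    by_cases hwy : w = y
    · subst hwy
      rw [hFy]
      exact ⟨fun h' => absurd h'.symm hcW, fun h' => absurd (h' ▸ hcS) hyS⟩
    rw [hFo w hwz hwy]
    exact ⟨fun h' => by rw [← hback w (h' ▸ hcK), h'], fun h' => by rw [hforw w (h' ▸ hcK), h']⟩
  constructor
  · refine ⟨?_, ?_, h.sub, ?_, ?_, h.lo_mem, (mem_sdiff.1 hQ).1⟩
    · intro v hv
      by_cases hvz : v = z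
      · rw [hvz, hFz]; exact mem_range.1 (h.sub (mem_sdiff.1 hQ).1)
      by_cases hvy : v = y
      · rw [hvy, hFy]; exact mem_range.1 (h.sub (hS hWS))
      rw [hFo v hvz hvy]
      rcases hg.stay v with h' | h'
      · rw [h']; exact h.col v hv
      · exact mem_range.1 (h.sub (mem_sdiff.1 h'.2).1)
    · intro v hv w hw hvw
      by_cases hvz : v = z
      · exact hloc v w hv hw hvw hvz
      by_cases hwz : w = z
      · exact (hloc w v hw hv (hA _ _ hvw) hwz).symm
      by_cases hvy : v = y
      · exact hloc' v w hv hw hvw hwz hvy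
      by_cases hwy : w = y
      · exact (hloc' w v hw hv (hA _ _ hvw) hvz hwy).symm
      rw [hFo v hvz hvy, hFo w hwz hwy]
      exact hg.proper v hv w hw hvw
    · intro v hv hvK
      exact (sum_nb_le_of_subset v (fun w _ hw => hFK w hw)).trans_lt (h.deg v hv (hFK v hvK))
    · intro c hc
      have h1 := card_cls_update (f := Function.update g y W) hs.1 Q c
      have h2 := card_cls_update (f := g) hs.2.1 W c
      have h3 := hg.card c
      have h4 := h.bal c hc
      rw [Function.update_of_ne hyz.symm, hgz] at h1
      rw [hgy] at h2
      rw [← hF] at h1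
      linarith
  · have hmov : ∀ x < N, ∀ d ∈ S.erase W, Free N A f x d → Free N A F x d := by
      intro x _ d hd hf w hw hxw hFw
      exact hf w hw hxw ((hE w d hd).1 hFw)
    have hconn : ∀ c, Conn N A f (S.erase W) c lo → Conn N A F K c lo := by
      intro c hc
      refine ReflTransGen.mono (fun a b hab => ?_) _ _ hc
      obtain ⟨ha, hb, x, hx, hxa, hxf⟩ := hab
      exact ⟨hS (mem_of_mem_erase ha), hS (mem_of_mem_erase hb), x, hx, (hE x a ha).2 hxa,
        hmov x hx b hb hxf⟩
    -- The vertex that let `W` move on is not `z`, since `z` cannot be released; so it still has the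
    -- colour `W`.
    have hWc : Conn N A F K W lo := by
      obtain ⟨d, hd, hdW, ⟨x, hx, hxW, hxf⟩, hdc⟩ := (hr W hWS).exists_step hWlo
      refine ReflTransGen.head ⟨hS hWS, hS hd, x, hx, ?_, hmov x hx d (mem_erase.2 ⟨hdW, hd⟩) hxf⟩
        (hconn d hdc)
      have hxz : x ≠ z := by
        rintro rfl
        exact hno x y d ⟨hs, hzW, hyY ▸ hY, hd, hdW, hxf⟩
      have hxy : x ≠ y := by
        rintro rfl
        exact hyS (hxW ▸ hWS)
      rw [hFo x hxz hxy, hforw x (hxW ▸ hWK), hxW]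
    have hFy' : F y' ∈ K \ S := by
      rw [hFo y' hyz' hne.symm]
      rcases hg.stay y' with h' | h'
      · rw [h']; exact hyK'
      · exact h'.2
    -- The only neighbour `z` of `y'` in `W` is gone, and its replacement `y` is not adjacent to
    -- `y'`.
    have hyc : Conn N A F K (F y') lo := by
      refine ReflTransGen.head ⟨(mem_sdiff.1 hFy').1, hS hWS, y', hs'.2.1, rfl, ?_⟩ hWc
      intro w hw hyw hFw
      by_cases hwz : w = z
      · subst hwz
        exact hQW (hFz.symm.trans hFw)
      by_cases hwy : w = y
      · subst hwy
        exact hadj (hA _ _ hyw)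
      rw [hFo w hwz hwy] at hFw
      exact hwz (hs'.2.2.2 w hw hyw (by rw [hgW w hFw, hzW]))
    have hsub : insert (F y') S ⊆ acc N A F K lo := by
      refine insert_subset (mem_filter.2 ⟨(mem_sdiff.1 hFy').1, hyc⟩) fun c hc => ?_
      refine mem_filter.2 ⟨hS hc, ?_⟩
      by_cases hcW : c = W
      · rw [hcW]; exact hWc
      · exact hconn c (hterm c (mem_erase.2 ⟨hcW, hc⟩))
    have := card_le_card hsub
    rw [card_insert_of_notMem (mem_sdiff.1 hFy').2] at this
    omega

/-- With equal small and large colours the indicators in `Near` cancel: the colouring is balanced.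
-/
theorem Near.shift {n s : ℕ} {K : Finset ℕ} {lo hi : ℕ} (h : Near N A n s f K lo hi)
    {g : ℕ → ℕ} {R : ℕ → Prop} (hR : ∀ c, R c → c ∈ K) (hg : Shifted N A f hi lo R g lo) :
    Near N A n s g K lo lo := by
  have hK : ∀ v, g v ∈ K → f v ∈ K := by
    intro v hv
    rcases hg.stay v with h' | h'
    · rwa [h'] at hv
    · exact hR _ h'.1
  refine ⟨?_, hg.proper, h.sub, ?_, ?_, h.lo_mem, h.lo_mem⟩
  · intro v hv
    rcases hg.stay v with h' | h'
    · rw [h']; exact h.col v hv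
    · exact mem_range.1 (h.sub (hR _ h'.2))
  · intro v hv hvK
    exact (sum_nb_le_of_subset v (fun w _ hw => hK w hw)).trans_lt (h.deg v hv (hK v hvK))
  · intro c hc
    have h1 := hg.card c
    have h2 := h.bal c hc
    omega

end Recolour

end FairAlloc

namespace FairAlloc

/-! ### Loop programs: a structured language with total semantics, compiled to programs -/

def State.setR (s : State) (x v : ℕ) : State := { s with reg := Function.update s.reg x v }

def State.setA (s : State) (a k v : ℕ) : State :=
  { s with arr := Function.update s.arr a (Function.update (s.arr a) k v) }

@[simp] theorem State.setR_arr (s : State) (x v : ℕ) : (s.setR x v).arr = s.arr := rfl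

@[simp] theorem State.setA_reg (s : State) (a k v : ℕ) : (s.setA a k v).reg = s.reg := rfl

@[simp] theorem State.setR_reg_self (s : State) (x v : ℕ) : (s.setR x v).reg x = v := by
  simp [State.setR]

theorem State.setR_reg_ne (s : State) {x y : ℕ} (v : ℕ) (h : y ≠ x) :
    (s.setR x v).reg y = s.reg y := by simp [State.setR, h]

theorem State.setR_reg (s : State) (x v y : ℕ) :
    (s.setR x v).reg y = if y = x then v else s.reg y := by
  simp [State.setR, Function.update_apply]

@[simp] theorem State.setA_arr_self (s : State) (a k v : ℕ) :
    (s.setA a k v).arr a = Function.update (s.arr a) k v := by simp [State.setA]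

theorem State.setA_arr_ne (s : State) {a b : ℕ} (k v : ℕ) (h : b ≠ a) :
    (s.setA a k v).arr b = s.arr b := by simp [State.setA, h]

/-- All registers read by the expression are less than `D`. -/
def Expr.ok (D : ℕ) : Expr → Bool
  | .lit _ => true
  | .reg x => decide (x < D)
  | .get _ e => e.ok D
  | .add e f => e.ok D && f.ok D
  | .sub e f => e.ok D && f.ok D
  | .eq e f => e.ok D && f.ok D
  | .lt e f => e.ok D && f.ok D

theorem Expr.eval_congr {D : ℕ} {s σ : State} (ha : s.arr = σ.arr)
    (hr : ∀ x < D, s.reg x = σ.reg x) (e : Expr) (h : e.ok D = true) : e.eval s = e.eval σ := by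
  induction e with
  | lit k => rfl
  | reg x => exact hr x (by simpa [Expr.ok] using h)
  | get a e ih => simp only [Expr.eval]; rw [ih h, ha]
  | add e f ihe ihf | sub e f ihe ihf | eq e f ihe ihf | lt e f ihe ihf =>
    simp only [Expr.ok, Bool.and_eq_true] at h
    simp only [Expr.eval]; rw [ihe h.1, ihf h.2]

/-- Conditions with quantifiers bounded by the contents of a fixed register. -/
inductive Fm where
  | atom (e : Expr)
  | not (φ : Fm)
  | and (φ ψ : Fm)
  | ex (x : ℕ) (φ : Fm)

def Fm.Holds (β : ℕ) : Fm → State → Prop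
  | .atom e, s => e.eval s ≠ 0
  | .not φ, s => ¬ φ.Holds β s
  | .and φ ψ, s => φ.Holds β s ∧ ψ.Holds β s
  | .ex x φ, s => ∃ i < s.reg β, φ.Holds β (s.setR x i)

/-- The registers less than `D` may occur freely; quantifiers bind the registers from `D` on. -/
def Fm.ok (D : ℕ) : Fm → Bool
  | .atom e => e.ok D
  | .not φ => φ.ok D
  | .and φ ψ => φ.ok D && ψ.ok D
  | .ex x φ => decide (x = D ∧ x < 200) && φ.ok (D + 1)

theorem Fm.holds_congr {β D : ℕ} (hβ : β < D) {s σ : State} (ha : s.arr = σ.arr)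
    (hr : ∀ x < D, s.reg x = σ.reg x) (φ : Fm) (h : φ.ok D = true) :
    φ.Holds β s ↔ φ.Holds β σ := by
  induction φ generalizing D s σ with
  | atom e => simp only [Fm.Holds]; rw [Expr.eval_congr ha hr e h]
  | not φ ih => simp only [Fm.Holds]; rw [ih hβ ha hr h]
  | and φ ψ ih1 ih2 =>
    simp only [Fm.ok, Bool.and_eq_true] at h
    simp only [Fm.Holds]; rw [ih1 hβ ha hr h.1, ih2 hβ ha hr h.2]
  | ex x φ ih =>
    simp only [Fm.ok, Bool.and_eq_true, decide_eq_true_eq] at h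
    simp only [Fm.Holds]; rw [hr β hβ]
    refine exists_congr fun i => and_congr_right fun _ => ih (D := D + 1) (by omega) ha ?_ h.2
    intro y hy
    rw [State.setR_reg, State.setR_reg]
    split_ifs with hyx
    · rfl
    · exact hr y (by omega)

/-- Writes the truth value of a condition to register `r`, with scratch registers above `r`. -/
def Fm.comp (β : ℕ) : Fm → ℕ → Program
  | .atom e, r => .cond e (.set r (.lit 1)) (.set r (.lit 0))
  | .not φ, r => .seq (φ.comp β r) (.set r (.eq (.reg r) (.lit 0)))
  | .and φ ψ, r => .seq (φ.comp β r) (.seq (ψ.comp β (r + 1))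
      (.cond (.reg r) (.set r (.reg (r + 1))) .skip))
  | .ex x φ, r => .seq (.set r (.lit 0)) (.seq (.set x (.lit 0))
      (.loop (.lt (.reg x) (.reg β)) (.seq (φ.comp β (r + 1))
        (.seq (.cond (.reg (r + 1)) (.set r (.lit 1)) .skip)
          (.set x (.add (.reg x) (.lit 1)))))))

-- The indeterminate stands for the content of the register that bounds the quantifiers.
open Polynomial in
noncomputable def Fm.time : Fm → ℕ[X]
  | .atom e => C (e.cost + 3)
  | .not φ => φ.time + C 4
  | .and φ ψ => φ.time + ψ.time + C 4
  | .ex _ φ => X * (φ.time + C 12) + C 8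

theorem exec_set (s : State) (x : ℕ) (e : Expr) :
    Exec (.set x e) s (s.setR x (e.eval s)) (1 + e.cost) := Exec.set s x e

/-- Total correctness of a counting loop. -/
theorem exec_count {β x N T : ℕ} {body : Program} (Inv : ℕ → State → Prop)
    (hx : ∀ i s, Inv i s → s.reg x = i ∧ s.reg β = N)
    (hstep : ∀ i < N, ∀ s, Inv i s → ∃ s' t, Exec body s s' t ∧ t ≤ T ∧ Inv (i + 1) s') :
    ∀ k ≤ N, ∀ s, Inv (N - k) s →
      ∃ s' t, Exec (.loop (.lt (.reg x) (.reg β)) body) s s' t ∧ t ≤ k * (T + 4) + 4 ∧ Inv N s' := by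
  intro k
  induction k with
  | zero =>
    intro _ s hs
    obtain ⟨h1, h2⟩ := hx _ _ hs
    refine ⟨s, _, Exec.loop_false ?_, ?_, hs⟩
    · simp [Expr.eval, h1, h2]
    · simp [Expr.cost]
  | succ k ih =>
    intro hk s hs
    obtain ⟨h1, h2⟩ := hx _ _ hs
    obtain ⟨s', t, he, ht, hs'⟩ := hstep _ (by omega) s hs
    rw [show N - (k + 1) + 1 = N - k by omega] at hs'
    obtain ⟨s'', t', he', ht', hs''⟩ := ih (by omega) s' hs'
    refine ⟨s'', _, Exec.loop_true ?_ he he', ?_, hs''⟩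
    · simp [Expr.eval, h1, h2]; omega
    · simp only [Expr.cost]
      ring_nf at ht' ⊢
      omega

-- Registers are used like a stack. Bound variables occupy consecutive registers from `D` up to
-- `199`, by nesting depth; truth values occupy those from `200` on. A subformula evaluated into `r
-- + 1` leaves the value in `r` intact.
open Classical in
theorem Fm.exec_comp {β : ℕ} (φ : Fm) : ∀ {D r : ℕ}, β < D → D ≤ 200 → 200 ≤ r →
    φ.ok D = true → ∀ s : State, ∃ s' t, Exec (φ.comp β r) s s' t ∧
      t ≤ φ.time.eval (s.reg β) ∧ s'.arr = s.arr ∧ (∀ x < D, s'.reg x = s.reg x) ∧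
      (∀ x, 200 ≤ x → x < r → s'.reg x = s.reg x) ∧
      s'.reg r = if φ.Holds β s then 1 else 0 := by
  induction φ with
  | atom e =>
    intro D r hβ hD hr hok s
    by_cases he : e.eval s = 0
    · refine ⟨_, _, Exec.cond_false he (exec_set _ _ _), ?_, rfl, ?_, ?_, ?_⟩
      · simp [Fm.time, Expr.cost]; omega
      · intro x hx; rw [State.setR_reg_ne]; omega
      · intro x _ hx; rw [State.setR_reg_ne]; omega
      · simp [Fm.Holds, he, Expr.eval]
    · refine ⟨_, _, Exec.cond_true he (exec_set _ _ _), ?_, rfl, ?_, ?_, ?_⟩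
      · simp [Fm.time, Expr.cost]; omega
      · intro x hx; rw [State.setR_reg_ne]; omega
      · intro x _ hx; rw [State.setR_reg_ne]; omega
      · simp [Fm.Holds, he, Expr.eval]
  | not φ ih =>
    intro D r hβ hD hr hok s
    obtain ⟨s', t, h1, h2, h3, h4, h5, h6⟩ := ih hβ hD hr hok s
    refine ⟨_, _, Exec.seq h1 (exec_set _ _ _), ?_, h3, ?_, ?_, ?_⟩
    · simp [Fm.time, Expr.cost]; omega
    · intro x hx; rw [State.setR_reg_ne _ _ (by omega), h4 x hx]
    · intro x hx hxr; rw [State.setR_reg_ne _ _ (by omega), h5 x hx hxr]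
    · rw [State.setR_reg_self]
      simp only [Expr.eval, h6, Fm.Holds]
      by_cases hφ : φ.Holds β s <;> simp [hφ]
  | and φ ψ ih1 ih2 =>
    intro D r hβ hD hr hok s
    simp only [Fm.ok, Bool.and_eq_true] at hok
    obtain ⟨s', t, h1, h2, h3, h4, h5, h6⟩ := ih1 hβ hD hr hok.1 s
    obtain ⟨s'', t', g1, g2, g3, g4, g5, g6⟩ := ih2 (r := r + 1) hβ hD (by omega) hok.2 s'
    rw [Fm.holds_congr hβ h3 h4 ψ hok.2] at g6
    rw [h4 β hβ] at g2
    have g7 : s''.reg r = if φ.Holds β s then 1 else 0 := by rw [g5 r hr (by omega), h6]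
    by_cases hφ : φ.Holds β s
    · rw [if_pos hφ] at g7
      refine ⟨_, _, Exec.seq h1 (Exec.seq g1 (Exec.cond_true (by simp [Expr.eval, g7])
        (exec_set _ _ _))), ?_, by rw [State.setR_arr, g3, h3], ?_, ?_, ?_⟩
      · simp [Fm.time, Expr.cost]; omega
      · intro x hx; rw [State.setR_reg_ne _ _ (by omega), g4 x hx, h4 x hx]
      · intro x hx hxr
        rw [State.setR_reg_ne _ _ (by omega), g5 x hx (by omega), h5 x hx hxr]
      · rw [State.setR_reg_self]
        simp only [Expr.eval, g6, Fm.Holds, hφ, true_and]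
    · rw [if_neg hφ] at g7
      refine ⟨_, _, Exec.seq h1 (Exec.seq g1 (Exec.cond_false (by simp [Expr.eval, g7])
        (Exec.skip _))), ?_, by rw [g3, h3], ?_, ?_, ?_⟩
      · simp [Fm.time, Expr.cost]; omega
      · intro x hx; rw [g4 x hx, h4 x hx]
      · intro x hx hxr; rw [g5 x hx (by omega), h5 x hx hxr]
      · simp [g7, Fm.Holds, hφ]
  | ex x φ ih =>
    intro D r hβ hD hr hok s
    simp only [Fm.ok, Bool.and_eq_true, decide_eq_true_eq] at hok
    obtain ⟨⟨rfl, hx⟩, hok⟩ := hok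
    set N := s.reg β with hN
    -- After `i` rounds, register `r` says whether one of the first `i` instances holds.
    let Inv : ℕ → State → Prop := fun i s' => s'.arr = s.arr ∧ (∀ y < x, s'.reg y = s.reg y) ∧
      (∀ y, 200 ≤ y → y < r → s'.reg y = s.reg y) ∧ s'.reg x = i ∧
      s'.reg r = if ∃ j < i, φ.Holds β (s.setR x j) then 1 else 0
    have hloop := exec_count (β := β) (x := x) (N := N) (T := φ.time.eval N + 8)
      (body := .seq (φ.comp β (r + 1)) (.seq (.cond (.reg (r + 1)) (.set r (.lit 1)) .skip)
          (.set x (.add (.reg x) (.lit 1))))) Inv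
      (fun i s' h => ⟨h.2.2.2.1, h.2.1 β hβ⟩) (by
        rintro i hi s' ⟨i1, i2, i3, i4, i5⟩
        obtain ⟨s'', t, h1, h2, h3, h4, h5, h6⟩ :=
          ih (D := x + 1) (r := r + 1) (by omega) (by omega) (by omega) hok s'
        have hcongr : φ.Holds β s' ↔ φ.Holds β (s.setR x i) := by
          refine Fm.holds_congr (β := β) (D := x + 1) (σ := s.setR x i) (by omega) i1 (fun y hy => ?_) φ hok
          rw [State.setR_reg]
          split_ifs with hyx
          · rw [hyx, i4]
          · exact i2 y (by omega)
        rw [hcongr] at h6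
        rw [i2 β hβ, ← hN] at h2
        have hex : (∃ j < i + 1, φ.Holds β (s.setR x j)) ↔
            (∃ j < i, φ.Holds β (s.setR x j)) ∨ φ.Holds β (s.setR x i) := by
          constructor
          · rintro ⟨j, hj, hφ⟩
            rcases Nat.lt_succ_iff_lt_or_eq.1 hj with h | rfl
            · exact Or.inl ⟨j, h, hφ⟩
            · exact Or.inr hφ
          · rintro (⟨j, hj, hφ⟩ | hφ)
            · exact ⟨j, by omega, hφ⟩
            · exact ⟨i, by omega, hφ⟩
        by_cases hφ : φ.Holds β (s.setR x i)
        · rw [if_pos hφ] at h6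
          refine ⟨_, _, Exec.seq h1 (Exec.seq (Exec.cond_true (by simp [Expr.eval, h6])
            (exec_set _ _ _)) (exec_set _ _ _)), ?_, ?_, ?_, ?_, ?_, ?_⟩
          · simp [Expr.cost]; omega
          · simp [h3, i1]
          · intro y hy
            rw [State.setR_reg_ne _ _ (by omega), State.setR_reg_ne _ _ (by omega),
              h4 y (by omega), i2 y hy]
          · intro y hy hyr
            rw [State.setR_reg_ne _ _ (by omega), State.setR_reg_ne _ _ (by omega),
              h5 y hy (by omega), i3 y hy hyr]
          · rw [State.setR_reg_self]
            simp only [Expr.eval]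
            rw [State.setR_reg_ne _ _ (by omega), h4 x (by omega), i4]
          · rw [State.setR_reg_ne _ _ (by omega), State.setR_reg_self,
              if_pos (hex.2 (Or.inr hφ))]
            rfl
        · rw [if_neg hφ] at h6
          refine ⟨_, _, Exec.seq h1 (Exec.seq (Exec.cond_false (by simp [Expr.eval, h6])
            (Exec.skip _)) (exec_set _ _ _)), ?_, ?_, ?_, ?_, ?_, ?_⟩
          · simp [Expr.cost]; omega
          · simp [h3, i1]
          · intro y hy
            rw [State.setR_reg_ne _ _ (by omega), h4 y (by omega), i2 y hy]
          · intro y hy hyr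
            rw [State.setR_reg_ne _ _ (by omega), h5 y hy (by omega), i3 y hy hyr]
          · rw [State.setR_reg_self]
            simp only [Expr.eval]
            rw [h4 x (by omega), i4]
          · rw [State.setR_reg_ne _ _ (by omega), h5 r hr (by omega), i5]
            simp only [hex, hφ, or_false])
      N le_rfl ((s.setR r 0).setR x 0) (by
        refine ⟨rfl, ?_, ?_, ?_, ?_⟩
        · intro y hy
          rw [State.setR_reg_ne _ _ (by omega), State.setR_reg_ne _ _ (by omega)]
        · intro y hy hyr
          rw [State.setR_reg_ne _ _ (by omega), State.setR_reg_ne _ _ (by omega)]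
        · simp
        · rw [State.setR_reg_ne _ _ (by omega), State.setR_reg_self]
          simp)
    obtain ⟨s', t, h1, h2, i1, i2, i3, i4, i5⟩ := hloop
    refine ⟨s', _, Exec.seq (exec_set _ _ _) (Exec.seq (exec_set _ _ _) h1), ?_, i1, i2, i3, ?_⟩
    · simp only [Expr.cost, Fm.time, Polynomial.eval_add, Polynomial.eval_mul, Polynomial.eval_X,
        Polynomial.eval_C]
      ring_nf at h2 ⊢
      omega
    · by_cases hφ : ∃ j < N, φ.Holds β (s.setR x j)
      · rw [if_pos hφ] at i5
        rw [i5, if_pos (show (Fm.ex x φ).Holds β s from hφ)]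
      · rw [if_neg hφ] at i5
        rw [i5, if_neg (show ¬ (Fm.ex x φ).Holds β s from hφ)]

/-- Programs whose loops are bounded by the contents of a fixed register. -/
inductive LP where
  | skip
  | set (x : ℕ) (e : Expr)
  | put (a : ℕ) (e f : Expr)
  | seq (P Q : LP)
  | cond (φ : Fm) (P Q : LP)
  /-- run `P` for `x = 0, 1, …` up to the bound -/
  | iter (x : ℕ) (P : LP)
  /-- write the least number below the bound that satisfies the condition to `x` -/
  | choose (x : ℕ) (φ : Fm)

/-- The counter is reset before every round. The compiled loop increments it instead; both agree
because `LP.ok` forbids the body to write to it. -/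
def forLoop (F : State → State) (x : ℕ) : ℕ → State → State
  | 0, s => s
  | i + 1, s => F ((forLoop F x i s).setR x i)

open Classical in
/-- The least number below `N` that satisfies `p`, or `N` if there is none. -/
noncomputable def search (N : ℕ) (p : ℕ → Prop) : ℕ :=
  Nat.find (p := fun i => N ≤ i ∨ p i) ⟨N, Or.inl le_rfl⟩

theorem search_spec {N : ℕ} {p : ℕ → Prop} (h : ∃ i < N, p i) :
    search N p < N ∧ p (search N p) := by
  classical
  obtain ⟨i, hi, hp⟩ := h
  have h1 : search N p ≤ i := Nat.find_min' _ (Or.inr hp)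
  have h2 : N ≤ search N p ∨ p (search N p) :=
    Nat.find_spec (p := fun i => N ≤ i ∨ p i) ⟨N, Or.inl le_rfl⟩
  exact ⟨by omega, h2.resolve_left (by omega)⟩

-- This semantics is a total function, so the algorithm can be verified without regard to halting or
-- step counts.
open Classical in
noncomputable def LP.run (β : ℕ) : LP → State → State
  | .skip, s => s
  | .set x e, s => s.setR x (e.eval s)
  | .put a e f, s => s.setA a (e.eval s) (f.eval s)
  | .seq P Q, s => Q.run β (P.run β s)
  | .cond φ P Q, s => if φ.Holds β s then P.run β s else Q.run β s
  | .iter x P, s => (forLoop (P.run β) x (s.reg β) s).setR x (s.reg β)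
  | .choose x φ, s => s.setR x (search (s.reg β) fun i => φ.Holds β (s.setR x i))

/-- A syntactic check, so that for a concrete program the fact that a register is untouched is
proved by `rfl`. -/
def LP.writesR (y : ℕ) : LP → Bool
  | .skip => false
  | .set x _ => decide (y = x)
  | .put _ _ _ => false
  | .seq P Q => P.writesR y || Q.writesR y
  | .cond _ P Q => P.writesR y || Q.writesR y
  | .iter x P => decide (y = x) || P.writesR y
  | .choose x _ => decide (y = x)

def LP.writesA (b : ℕ) : LP → Bool
  | .skip => false
  | .set _ _ => false
  | .put a _ _ => decide (b = a)
  | .seq P Q => P.writesA b || Q.writesA b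
  | .cond _ P Q => P.writesA b || Q.writesA b
  | .iter _ P => P.writesA b
  | .choose _ _ => false

theorem LP.run_reg (β : ℕ) {y : ℕ} (P : LP) (h : P.writesR y = false) (s : State) :
    (P.run β s).reg y = s.reg y := by
  induction P generalizing s with
  | skip => rfl
  | set x e => exact State.setR_reg_ne _ _ (by simpa [LP.writesR] using h)
  | put a e f => rfl
  | seq P Q ih1 ih2 =>
    simp only [LP.writesR, Bool.or_eq_false_iff] at h
    simp only [LP.run]
    rw [ih2 h.2, ih1 h.1]
  | cond φ P Q ih1 ih2 =>
    simp only [LP.writesR, Bool.or_eq_false_iff] at h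
    simp only [LP.run]
    split_ifs
    · exact ih1 h.1 s
    · exact ih2 h.2 s
  | iter x P ih =>
    simp only [LP.writesR, Bool.or_eq_false_iff, decide_eq_false_iff_not] at h
    simp only [LP.run]
    rw [State.setR_reg_ne _ _ h.1]
    generalize s.reg β = N
    induction N with
    | zero => rfl
    | succ i ihi => simp only [forLoop]; rw [ih h.2, State.setR_reg_ne _ _ h.1, ihi]
  | choose x φ => exact State.setR_reg_ne _ _ (by simpa [LP.writesR] using h)

theorem LP.run_arr (β : ℕ) {b : ℕ} (P : LP) (h : P.writesA b = false) (s : State) :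
    (P.run β s).arr b = s.arr b := by
  induction P generalizing s with
  | skip => rfl
  | set x e => rfl
  | put a e f => exact State.setA_arr_ne _ _ _ (by simpa [LP.writesA] using h)
  | seq P Q ih1 ih2 =>
    simp only [LP.writesA, Bool.or_eq_false_iff] at h
    simp only [LP.run]
    rw [ih2 h.2, ih1 h.1]
  | cond φ P Q ih1 ih2 =>
    simp only [LP.writesA, Bool.or_eq_false_iff] at h
    simp only [LP.run]
    split_ifs
    · exact ih1 h.1 s
    · exact ih2 h.2 s
  | iter x P ih =>
    simp only [LP.writesA] at h
    simp only [LP.run, State.setR_arr]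
    generalize s.reg β = N
    induction N with
    | zero => rfl
    | succ i ihi => simp only [forLoop]; rw [ih h, State.setR_arr, ihi]
  | choose x φ => rfl

/-- The program reads and writes only registers less than `100`, and loops do not change their
counters. -/
def LP.ok : LP → Bool
  | .skip => true
  | .set x e => decide (x < 100) && e.ok 100
  | .put _ e f => e.ok 100 && f.ok 100
  | .seq P Q => P.ok && Q.ok
  | .cond φ P Q => φ.ok 100 && P.ok && Q.ok
  | .iter x P => decide (x < 100) && P.ok && !P.writesR x
  | .choose x φ => decide (x < 100) && φ.ok 100

def LP.comp (β : ℕ) : LP → Program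
  | .skip => .skip
  | .set x e => .set x e
  | .put a e f => .put a e f
  | .seq P Q => .seq (P.comp β) (Q.comp β)
  | .cond φ P Q => .seq (φ.comp β 200) (.cond (.reg 200) (P.comp β) (Q.comp β))
  | .iter x P => .seq (.set x (.lit 0)) (.loop (.lt (.reg x) (.reg β))
      (.seq (P.comp β) (.set x (.add (.reg x) (.lit 1)))))
  | .choose x φ => .seq (.set x (.lit 0)) (.seq (φ.comp β 200)
      -- On truth values, `a < b` means that `a` is false and `b` is true: the search goes on while
      -- the condition fails and the bound is not reached.
      (.loop (.lt (.reg 200) (.lt (.reg x) (.reg β)))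
        (.seq (.set x (.add (.reg x) (.lit 1))) (φ.comp β 200))))

open Polynomial in
noncomputable def LP.time : LP → ℕ[X]
  | .skip => C 1
  | .set _ e => C (1 + e.cost)
  | .put _ e f => C (1 + e.cost + f.cost)
  | .seq P Q => P.time + Q.time
  | .cond φ P Q => φ.time + P.time + Q.time + C 2
  | .iter _ P => X * (P.time + C 8) + C 6
  | .choose _ φ => X * (φ.time + C 10) + φ.time + C 8

/-- The states agree apart from scratch registers. -/
def State.Sim (s σ : State) : Prop := s.arr = σ.arr ∧ ∀ x < 100, s.reg x = σ.reg x

theorem State.Sim.setR {s σ : State} (h : s.Sim σ) (x v : ℕ) : (s.setR x v).Sim (σ.setR x v) := by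
  refine ⟨h.1, fun y hy => ?_⟩
  rw [State.setR_reg, State.setR_reg, h.2 y hy]

theorem Fm.exec_sim {β : ℕ} (hβ : β < 100) {φ : Fm} (hok : φ.ok 100 = true) {s σ : State}
    (h : s.Sim σ) : ∃ σ' t, Exec (φ.comp β 200) σ σ' t ∧ t ≤ φ.time.eval (s.reg β) ∧ s.Sim σ' ∧
      (φ.Holds β s → σ'.reg 200 = 1) ∧ (¬ φ.Holds β s → σ'.reg 200 = 0) := by
  classical
  obtain ⟨σ', t, h1, h2, h3, h4, _, h6⟩ := φ.exec_comp hβ (by norm_num) le_rfl hok σ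
  rw [← Fm.holds_congr hβ h.1 h.2 φ hok] at h6
  refine ⟨σ', t, h1, by rwa [h.2 β hβ], ⟨by rw [h3, h.1], fun x hx => by rw [h4 x hx, h.2 x hx]⟩,
    fun hφ => by rw [h6, if_pos hφ], fun hφ => by rw [h6, if_neg hφ]⟩

/-- Induction on a bound `k` for the remaining candidates. On entry the candidates before `i` have
failed, and register `200` already holds the verdict on `i`. -/
theorem LP.exec_choose {β x : ℕ} (hβ : β < 100) (hx : x < 100) (hxβ : β ≠ x) {φ : Fm}
    (hok : φ.ok 100 = true) (s : State) (k : ℕ) :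
    ∀ i σ, s.reg β ≤ i + k → i ≤ search (s.reg β) (fun i => φ.Holds β (s.setR x i)) →
      (s.setR x i).Sim σ → (φ.Holds β (s.setR x i) → σ.reg 200 = 1) →
      (¬ φ.Holds β (s.setR x i) → σ.reg 200 = 0) →
      ∃ σ' t, Exec (.loop (.lt (.reg 200) (.lt (.reg x) (.reg β)))
        (.seq (.set x (.add (.reg x) (.lit 1))) (φ.comp β 200))) σ σ' t ∧
        t ≤ k * (φ.time.eval (s.reg β) + 10) + 6 ∧
        (s.setR x (search (s.reg β) fun i => φ.Holds β (s.setR x i))).Sim σ' := by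
  classical
  set p : ℕ → Prop := fun i => φ.Holds β (s.setR x i) with hp
  induction k with
  | zero =>
    intro i σ hi hle hsim h1 h0
    have h2 : search (s.reg β) p = i := le_antisymm (Nat.find_min' _ (Or.inl (by omega))) hle
    rw [h2]
    refine ⟨σ, _, Exec.loop_false ?_, by simp [Expr.cost], hsim⟩
    have e1 := hsim.2 x hx
    have e2 := hsim.2 β hβ
    rw [State.setR_reg_self] at e1
    rw [State.setR_reg_ne _ _ hxβ] at e2
    simp only [Expr.eval, ← e1, ← e2]
    rw [if_neg (by omega : ¬ i < s.reg β)]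
    simp
  | succ k ih =>
    intro i σ hi hle hsim h1 h0
    have e1 := hsim.2 x hx
    have e2 := hsim.2 β hβ
    rw [State.setR_reg_self] at e1
    rw [State.setR_reg_ne _ _ hxβ] at e2
    by_cases hend : s.reg β ≤ i ∨ p i
    · have h2 : search (s.reg β) p = i := le_antisymm (Nat.find_min' _ hend) hle
      rw [h2]
      refine ⟨σ, _, Exec.loop_false ?_, by simp [Expr.cost], hsim⟩
      simp only [Expr.eval, ← e1, ← e2]
      rcases hend with h | h
      · rw [if_neg (by omega : ¬ i < s.reg β)]
        simp
      · rw [h1 h]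
        split_ifs <;> omega
    · have hlt : i + 1 ≤ search (s.reg β) p := by
        rcases Nat.lt_or_ge i (search (s.reg β) p) with h | h
        · exact h
        · have h2 : search (s.reg β) p = i := le_antisymm h hle
          have := Nat.find_spec (p := fun i => s.reg β ≤ i ∨ p i) ⟨s.reg β, Or.inl le_rfl⟩
          exact absurd (h2 ▸ this) hend
      push Not at hend
      have hsim' : (s.setR x (i + 1)).Sim (σ.setR x (i + 1)) := by
        refine ⟨hsim.1, fun y hy => ?_⟩
        have := hsim.2 y hy
        rw [State.setR_reg] at this ⊢
        rw [State.setR_reg]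
        split_ifs with hyx
        · rfl
        · rwa [if_neg hyx] at this
      obtain ⟨σ', t, g1, g2, g3, g4, g5⟩ := Fm.exec_sim hβ hok hsim'
      rw [State.setR_reg_ne _ _ hxβ] at g2
      obtain ⟨σ'', t', f1, f2, f3⟩ := ih (i + 1) σ' (by omega) hlt g3 g4 g5
      have hset : Exec (.set x (.add (.reg x) (.lit 1))) σ (σ.setR x (i + 1)) 4 := by
        have := exec_set σ x (.add (.reg x) (.lit 1))
        simp only [Expr.eval, ← e1, Expr.cost] at this
        exact this
      refine ⟨σ'', _, Exec.loop_true ?_ (Exec.seq hset g1) f1, ?_, f3⟩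
      · simp only [Expr.eval, ← e1, ← e2, h0 hend.2]
        rw [if_pos hend.1]
        simp
      · simp only [Expr.cost]
        ring_nf at f2 ⊢
        omega

/-- Since register `β` never changes, every part of the program has its time bounded by a polynomial
in the same number. -/
theorem LP.exec_comp {β : ℕ} (hβ : β < 100) (P : LP) : P.ok = true → P.writesR β = false →
    ∀ {s σ : State}, s.Sim σ → ∃ σ' t, Exec (P.comp β) σ σ' t ∧
      t ≤ P.time.eval (s.reg β) ∧ (P.run β s).Sim σ' := by
  induction P with
  | skip => exact fun _ _ s σ h => ⟨σ, 1, Exec.skip σ, by simp [LP.time], h⟩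
  | set x e =>
    intro hok _ s σ h
    simp only [LP.ok, Bool.and_eq_true] at hok
    refine ⟨_, _, exec_set _ _ _, by simp [LP.time], ?_⟩
    rw [← Expr.eval_congr h.1 h.2 e hok.2]
    exact h.setR _ _
  | put a e f =>
    intro hok _ s σ h
    simp only [LP.ok, Bool.and_eq_true] at hok
    refine ⟨_, _, Exec.put _ _ _ _, by simp [LP.time], ?_⟩
    rw [← Expr.eval_congr h.1 h.2 e hok.1, ← Expr.eval_congr h.1 h.2 f hok.2]
    exact ⟨by simp only [LP.run, State.setA, h.1], h.2⟩
  | seq P Q ih1 ih2 =>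
    intro hok hw s σ h
    simp only [LP.ok, Bool.and_eq_true] at hok
    simp only [LP.writesR, Bool.or_eq_false_iff] at hw
    obtain ⟨σ', t, h1, h2, h3⟩ := ih1 hok.1 hw.1 h
    obtain ⟨σ'', t', g1, g2, g3⟩ := ih2 hok.2 hw.2 h3
    rw [LP.run_reg β P hw.1] at g2
    refine ⟨σ'', _, Exec.seq h1 g1, ?_, g3⟩
    simp only [LP.time, Polynomial.eval_add]
    omega
  | cond φ P Q ih1 ih2 =>
    intro hok hw s σ h
    simp only [LP.ok, Bool.and_eq_true] at hok
    simp only [LP.writesR, Bool.or_eq_false_iff] at hw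
    obtain ⟨σ', t, h1, h2, h3, h4, h5⟩ := Fm.exec_sim hβ hok.1.1 h
    by_cases hφ : φ.Holds β s
    · obtain ⟨σ'', t', g1, g2, g3⟩ := ih1 hok.1.2 hw.1 h3
      refine ⟨σ'', _, Exec.seq h1 (Exec.cond_true (by simp [Expr.eval, h4 hφ]) g1), ?_, ?_⟩
      · simp only [LP.time, Polynomial.eval_add, Polynomial.eval_C, Expr.cost]
        omega
      · simp only [LP.run]; rwa [if_pos hφ]
    · obtain ⟨σ'', t', g1, g2, g3⟩ := ih2 hok.2 hw.2 h3
      refine ⟨σ'', _, Exec.seq h1 (Exec.cond_false (by simp [Expr.eval, h5 hφ]) g1), ?_, ?_⟩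
      · simp only [LP.time, Polynomial.eval_add, Polynomial.eval_C, Expr.cost]
        omega
      · simp only [LP.run]; rwa [if_neg hφ]
  | iter x P ih =>
    intro hok hw s σ h
    simp only [LP.ok, Bool.and_eq_true, decide_eq_true_eq, Bool.not_eq_true'] at hok
    simp only [LP.writesR, Bool.or_eq_false_iff, decide_eq_false_iff_not] at hw
    set N := s.reg β with hN
    have hβi : ∀ i, (forLoop (P.run β) x i s).reg β = N := by
      intro i
      induction i with
      | zero => rfl
      | succ i ihi => simp only [forLoop]; rw [LP.run_reg β P hw.2, State.setR_reg_ne _ _ hw.1, ihi]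
    let Inv : ℕ → State → Prop := fun i σ' => ((forLoop (P.run β) x i s).setR x i).Sim σ'
    obtain ⟨σ', t, h1, h2, h3⟩ := exec_count (β := β) (x := x) (N := N) (T := P.time.eval N + 4)
      (body := .seq (P.comp β) (.set x (.add (.reg x) (.lit 1)))) Inv
      (by
        intro i σ' hi
        rw [← hi.2 x hok.1.1, ← hi.2 β hβ, State.setR_reg_self, State.setR_reg_ne _ _ hw.1, hβi]
        exact ⟨rfl, rfl⟩)
      (by
        intro i hi σ' hσ
        obtain ⟨σ'', t, g1, g2, g3⟩ := ih hok.1.2 hw.2 hσ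
        rw [State.setR_reg_ne _ _ hw.1, hβi] at g2
        refine ⟨_, _, Exec.seq g1 (exec_set _ _ _), by simp only [Expr.cost]; omega, ?_⟩
        have hx : σ''.reg x = i := by
          rw [← g3.2 x hok.1.1, LP.run_reg β P hok.2, State.setR_reg_self]
        simp only [Inv, Expr.eval, hx]
        exact g3.setR _ _)
      N le_rfl (σ.setR x 0) (by
        rw [Nat.sub_self]
        exact h.setR _ _)
    refine ⟨σ', _, Exec.seq (exec_set _ _ _) h1, ?_, h3⟩
    simp only [LP.time, Polynomial.eval_add, Polynomial.eval_mul, Polynomial.eval_X,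
      Polynomial.eval_C, Expr.cost]
    ring_nf at h2 ⊢
    omega
  | choose x φ =>
    intro hok hw s σ h
    simp only [LP.ok, Bool.and_eq_true, decide_eq_true_eq] at hok
    simp only [LP.writesR, decide_eq_false_iff_not] at hw
    obtain ⟨σ', t, h1, h2, h3, h4, h5⟩ := Fm.exec_sim hβ hok.2 (h.setR x 0)
    rw [State.setR_reg_ne _ _ hw] at h2
    obtain ⟨σ'', t', g1, g2, g3⟩ := LP.exec_choose hβ hok.1 hw hok.2 s (s.reg β) 0 σ' (by omega)
      (Nat.zero_le _) h3 h4 h5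
    refine ⟨σ'', _, Exec.seq (exec_set _ _ _) (Exec.seq h1 g1), ?_, g3⟩
    simp only [LP.time, Polynomial.eval_add, Polynomial.eval_mul, Polynomial.eval_X,
      Polynomial.eval_C, Expr.cost]
    omega

/-- The invariant rule for loops. -/
theorem LP.run_iter {β x : ℕ} {P : LP} {s : State} (Inv : ℕ → State → Prop) (h0 : Inv 0 s)
    (hstep : ∀ i < s.reg β, ∀ s', Inv i s' → Inv (i + 1) (P.run β (s'.setR x i))) :
    ∃ s', Inv (s.reg β) s' ∧ (LP.iter x P).run β s = s'.setR x (s.reg β) := by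
  refine ⟨_, ?_, rfl⟩
  have : ∀ i ≤ s.reg β, Inv i (forLoop (P.run β) x i s) := by
    intro i
    induction i with
    | zero => exact fun _ => h0
    | succ i ih => exact fun hi => hstep i (by omega) _ (ih (by omega))
  exact this _ le_rfl

end FairAlloc

namespace FairAlloc

open Finset Relation

/-! ### Conditions on the current colouring

Register `0` holds the number of colours, `1` the number of items, `2` the number of vertices of the
padded graph, `3` the small colour, `4` the large colour, and only edges between vertices less
than register `5` are present. Array `1` holds the colouring, `4` marks the active colours, `5` the
accessible ones, and `10` holds the row offsets of the adjacency matrix in array `0`. -/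

section HoldsRules

variable {β : ℕ} {s : State}

theorem holds_eq {e f : Expr} : (Fm.atom (.eq e f)).Holds β s ↔ e.eval s = f.eval s := by
  simp only [Fm.Holds, Expr.eval]
  split_ifs with h <;> simp [h]

theorem holds_lt {e f : Expr} : (Fm.atom (.lt e f)).Holds β s ↔ e.eval s < f.eval s := by
  simp only [Fm.Holds, Expr.eval]
  split_ifs with h <;> simp [h]

theorem holds_get {a : ℕ} {e : Expr} : (Fm.atom (.get a e)).Holds β s ↔ s.arr a (e.eval s) ≠ 0 :=
  Iff.rfl

theorem holds_not {φ : Fm} : (Fm.not φ).Holds β s ↔ ¬ φ.Holds β s := Iff.rfl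

theorem holds_and {φ ψ : Fm} : (Fm.and φ ψ).Holds β s ↔ φ.Holds β s ∧ ψ.Holds β s := Iff.rfl

theorem holds_ex {x : ℕ} {φ : Fm} :
    (Fm.ex x φ).Holds β s ↔ ∃ i < s.reg β, φ.Holds β (s.setR x i) := Iff.rfl

end HoldsRules

/-- The disjunction is spelled with negations. The padding clique is not stored: vertices from
register `1` on are adjacent whenever they differ. -/
def adjF (v w : ℕ) : Fm :=
  .and (.and (.atom (.lt (.reg v) (.reg 5))) (.atom (.lt (.reg w) (.reg 5))))
    (.not (.and
      (.not (.and (.and (.atom (.lt (.reg v) (.reg 1))) (.atom (.lt (.reg w) (.reg 1))))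
        (.atom (.get 0 (.add (.get 10 (.reg v)) (.reg w))))))
      (.not (.and (.and (.not (.atom (.lt (.reg v) (.reg 1)))) (.not (.atom (.lt (.reg w) (.reg 1)))))
        (.not (.atom (.eq (.reg v) (.reg w))))))))

def State.Adj (s : State) (i j : ℕ) : Prop :=
  i < s.reg 5 ∧ j < s.reg 5 ∧ (i < s.reg 1 ∧ j < s.reg 1 ∧ s.arr 0 (s.arr 10 i + j) ≠ 0 ∨
    ¬ i < s.reg 1 ∧ ¬ j < s.reg 1 ∧ i ≠ j)

theorem adjF_holds (v w : ℕ) (s : State) :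
    (adjF v w).Holds 2 s ↔ s.Adj (s.reg v) (s.reg w) := by
  simp only [adjF, holds_eq, holds_lt, holds_get, holds_not, holds_and, Expr.eval, State.Adj]
  tauto

/-- The state represents the graph `A` on the vertices less than `N`. -/
def Env (A : ℕ → ℕ → Prop) (N : ℕ) (s : State) : Prop :=
  s.reg 2 = N ∧ ∀ i < N, ∀ j < N, s.Adj i j ↔ A i j

theorem Env.congr {A : ℕ → ℕ → Prop} {N : ℕ} {s σ : State} (h : Env A N s)
    (h1 : σ.reg 1 = s.reg 1) (h2 : σ.reg 2 = s.reg 2) (h5 : σ.reg 5 = s.reg 5)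
    (a0 : σ.arr 0 = s.arr 0) (a10 : σ.arr 10 = s.arr 10) : Env A N σ := by
  refine ⟨by rw [h2, h.1], fun i hi j hj => ?_⟩
  rw [← h.2 i hi j hj]
  simp only [State.Adj, h1, h5, a0, a10]

theorem Env.run {A : ℕ → ℕ → Prop} {N : ℕ} {s : State} (h : Env A N s) (P : LP)
    (hP : (P.writesR 1 || P.writesR 2 || P.writesR 5 || P.writesA 0 || P.writesA 10) = false) :
    Env A N (P.run 2 s) := by
  simp only [Bool.or_eq_false_iff] at hP
  obtain ⟨⟨⟨⟨h1, h2⟩, h5⟩, a0⟩, a10⟩ := hP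
  exact h.congr (P.run_reg 2 h1 s) (P.run_reg 2 h2 s) (P.run_reg 2 h5 s) (P.run_arr 2 a0 s)
    (P.run_arr 2 a10 s)

theorem Env.setR {A : ℕ → ℕ → Prop} {N : ℕ} {s : State} (h : Env A N s) {x : ℕ} (hx : 6 ≤ x)
    (v : ℕ) : Env A N (s.setR x v) :=
  h.congr (State.setR_reg_ne _ _ (by omega)) (State.setR_reg_ne _ _ (by omega))
    (State.setR_reg_ne _ _ (by omega)) rfl rfl

/-- The last argument is the register bound by the quantifier; it depends on the nesting depth at
which the formula is used. -/
def freeF (y d x : ℕ) : Fm :=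
  .not (.ex x (.and (adjF y x) (.atom (.eq (.get 1 (.reg x)) (.reg d)))))

def soloF (z y x : ℕ) : Fm :=
  .and (adjF y z) (.not (.ex x (.and (adjF y x)
    (.and (.atom (.eq (.get 1 (.reg x)) (.get 1 (.reg z)))) (.not (.atom (.eq (.reg x) (.reg z))))))))

section Holds

variable {A : ℕ → ℕ → Prop} {N : ℕ} {s : State}

theorem freeF_holds (hE : Env A N s) {y d x : ℕ} (hx : 6 ≤ x) (hyx : y ≠ x) (hdx : d ≠ x)
    (hy : s.reg y < N) : (freeF y d x).Holds 2 s ↔ Free N A (s.arr 1) (s.reg y) (s.reg d) := by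
  simp only [freeF, holds_eq, holds_not, holds_and, holds_ex, adjF_holds, Free, hE.1, State.setR_reg_ne _ _ hyx,
    State.setR_reg_ne _ _ hdx, State.setR_reg_self, Expr.eval, State.setR_arr]
  push Not
  refine forall_congr' fun w => forall_congr' fun hw => ?_
  rw [(hE.setR hx w).2 _ hy w hw]

theorem soloF_holds (hE : Env A N s) {z y x : ℕ} (hx : 6 ≤ x) (hzx : z ≠ x) (hyx : y ≠ x)
    (hz : s.reg z < N) (hy : s.reg y < N) :
    (soloF z y x).Holds 2 s ↔ Solo N A (s.arr 1) (s.reg z) (s.reg y) := by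
  simp only [soloF, holds_eq, holds_not, holds_and, holds_ex, adjF_holds, Solo, hE.1, State.setR_reg_ne _ _ hyx,
    State.setR_reg_ne _ _ hzx, State.setR_reg_self, Expr.eval, State.setR_arr, hz, hy, true_and]
  rw [hE.2 _ hy _ hz]
  refine and_congr_right fun _ => ?_
  push Not
  refine forall_congr' fun w => forall_congr' fun hw => ?_
  rw [(hE.setR hx w).2 _ hy w hw]

theorem run_choose {x : ℕ} {φ : Fm} (hN : s.reg 2 = N)
    (h : ∃ i < N, φ.Holds 2 (s.setR x i)) :
    ∃ v < N, φ.Holds 2 (s.setR x v) ∧ (LP.choose x φ).run 2 s = s.setR x v := by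
  subst hN
  obtain ⟨h1, h2⟩ := search_spec h
  exact ⟨_, h1, h2, rfl⟩

end Holds

/-- The numbers less than `N` that are marked in `g`. -/
def on (N : ℕ) (g : ℕ → ℕ) : Finset ℕ := (range N).filter (fun c => g c ≠ 0)

theorem mem_on {N c : ℕ} {g : ℕ → ℕ} : c ∈ on N g ↔ c < N ∧ g c ≠ 0 := by simp [on]

theorem on_congr {N : ℕ} {g g' : ℕ → ℕ} (h : ∀ c < N, (g c ≠ 0 ↔ g' c ≠ 0)) : on N g = on N g' :=
  filter_congr fun c hc => h c (mem_range.1 hc)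

/-- Fill array `a` with the values of `e`, as a function of register `10`. -/
def mapP (a : ℕ) (e : Expr) : LP := .iter 10 (.put a (.reg 10) e)

/-- The hypothesis on `e` ranges over all states that occur while array `a` is partly overwritten.
-/
theorem run_mapP {a N : ℕ} {e : Expr} {s : State} (g : ℕ → ℕ) (hN : s.reg 2 = N)
    (h : ∀ s' : State, (∀ b, b ≠ a → s'.arr b = s.arr b) → (∀ x, x ≠ 10 → s'.reg x = s.reg x) →
      e.eval s' = g (s'.reg 10)) :
    ∀ k < N, ((mapP a e).run 2 s).arr a k = g k := by
  let Inv : ℕ → State → Prop := fun i s' => (∀ b, b ≠ a → s'.arr b = s.arr b) ∧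
    (∀ x, x ≠ 10 → s'.reg x = s.reg x) ∧ ∀ k < i, s'.arr a k = g k
  obtain ⟨s', ⟨_, _, h3⟩, hrun⟩ := LP.run_iter (β := 2) (x := 10) (P := .put a (.reg 10) e) (s := s)
    Inv ⟨fun _ _ => rfl, fun _ _ => rfl, fun k hk => absurd hk (by omega)⟩ (by
      rintro i hi s' ⟨h1, h2, h3⟩
      have hr : ∀ x, x ≠ 10 → (s'.setR 10 i).reg x = s.reg x := fun x hx => by
        rw [State.setR_reg_ne _ _ hx, h2 x hx]
      refine ⟨fun b hb => ?_, hr, fun k hk => ?_⟩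
      · simp only [LP.run]
        rw [State.setA_arr_ne _ _ _ hb, State.setR_arr, h1 b hb]
      · simp only [LP.run, Expr.eval, State.setA_arr_self, State.setR_reg_self]
        rw [h (s'.setR 10 i) (fun b hb => h1 b hb) hr, State.setR_reg_self]
        by_cases hki : k = i
        · rw [hki, Function.update_self]
        · rw [Function.update_of_ne hki]
          exact h3 k (by omega))
  intro k hk
  rw [mapP, hrun, State.setR_arr]
  exact h3 k (by omega)

/-! ### Reachability in the digraph of colours -/

def linkF (y d x : ℕ) : Fm :=
  .and (.atom (.eq (.get 1 (.reg y)) (.reg 10))) (.and (.atom (.get 7 (.reg d))) (freeF y d x))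

def reachBody : LP :=
  .cond (.and (.and (.atom (.get 6 (.reg 10))) (.not (.atom (.get 7 (.reg 10)))))
      (.ex 100 (.ex 101 (linkF 100 101 102))))
    (.seq (.choose 12 (.ex 100 (linkF 12 100 101))) (.seq (.choose 13 (linkF 12 13 100))
      (.seq (.put 9 (.reg 10) (.reg 12)) (.seq (.put 8 (.reg 10) (.reg 13))
        (.put 7 (.reg 10) (.lit 1)))))) .skip

/-- Mark in array `7` the colours that reach the colour in register `6` by moves between colours
that are marked in array `6`; arrays `8` and `9` hold the next colour and the vertex to be moved. -/
def reach : LP :=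
  .seq (mapP 7 (.lit 0)) (.seq (.put 7 (.reg 6) (.lit 1)) (.iter 11 (.iter 10 reachBody)))

theorem linkF_holds {A : ℕ → ℕ → Prop} {N : ℕ} {s : State} (hE : Env A N s) {y d x : ℕ}
    (hx : 6 ≤ x) (hyx : y ≠ x) (hdx : d ≠ x) (hy : s.reg y < N) : (linkF y d x).Holds 2 s ↔
      s.arr 1 (s.reg y) = s.reg 10 ∧ s.arr 7 (s.reg d) ≠ 0 ∧
        Free N A (s.arr 1) (s.reg y) (s.reg d) := by
  simp only [linkF, holds_eq, holds_get, holds_and, freeF_holds hE hx hyx hdx hy, Expr.eval]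

theorem run_reachBody {A : ℕ → ℕ → Prop} {N : ℕ} {s : State} (hE : Env A N s) :
    (∃ y < N, ∃ d < N, s.arr 6 (s.reg 10) ≠ 0 ∧ s.arr 7 (s.reg 10) = 0 ∧
      s.arr 1 y = s.reg 10 ∧ s.arr 7 d ≠ 0 ∧ Free N A (s.arr 1) y d ∧
      (reachBody.run 2 s).arr 7 = Function.update (s.arr 7) (s.reg 10) 1 ∧
      (reachBody.run 2 s).arr 8 = Function.update (s.arr 8) (s.reg 10) d ∧
      (reachBody.run 2 s).arr 9 = Function.update (s.arr 9) (s.reg 10) y) ∨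
    (reachBody.run 2 s = s ∧ (s.arr 6 (s.reg 10) ≠ 0 → s.arr 7 (s.reg 10) = 0 →
      ∀ y < N, ∀ d < N, s.arr 1 y = s.reg 10 → s.arr 7 d ≠ 0 → ¬ Free N A (s.arr 1) y d)) := by
  have hiff : (Fm.and (.and (.atom (.get 6 (.reg 10))) (.not (.atom (.get 7 (.reg 10)))))
      (.ex 100 (.ex 101 (linkF 100 101 102)))).Holds 2 s ↔
      (s.arr 6 (s.reg 10) ≠ 0 ∧ s.arr 7 (s.reg 10) = 0) ∧ ∃ y < N, ∃ d < N,
        s.arr 1 y = s.reg 10 ∧ s.arr 7 d ≠ 0 ∧ Free N A (s.arr 1) y d := by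
    simp only [Fm.Holds, Expr.eval, not_not, hE.1, State.setR_reg_ne s _ (show 2 ≠ 100 by decide)]
    refine and_congr_right fun _ => exists_congr fun y => and_congr_right fun hy =>
      exists_congr fun d => and_congr_right fun hd => ?_
    rw [linkF_holds ((hE.setR (by norm_num) y).setR (by norm_num) d) (by norm_num) (by norm_num)
      (by norm_num) (by simpa [State.setR_reg] using hy)]
    simp [State.setR_reg]
  by_cases hc : (Fm.and (.and (.atom (.get 6 (.reg 10))) (.not (.atom (.get 7 (.reg 10)))))
      (.ex 100 (.ex 101 (linkF 100 101 102)))).Holds 2 s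
  · left
    obtain ⟨⟨h6, h7⟩, y, hy, d, hd, hlink⟩ := hiff.1 hc
    obtain ⟨y, hy, hy', hrun1⟩ := run_choose (x := 12) (φ := .ex 100 (linkF 12 100 101)) hE.1 (by
      refine ⟨y, hy, d, by simpa [State.setR_reg, hE.1] using hd, ?_⟩
      rw [linkF_holds ((hE.setR (by norm_num) y).setR (by norm_num) d) (by norm_num) (by norm_num)
        (by norm_num) (by simpa [State.setR_reg] using hy)]
      simpa [State.setR_reg] using hlink)
    have hE1 := hE.setR (x := 12) (by norm_num) y
    obtain ⟨d, hd, hd', hrun2⟩ := run_choose (x := 13) (φ := linkF 12 13 100) hE1.1 (by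
      obtain ⟨d, hd, hl⟩ := hy'
      rw [hE1.1] at hd
      refine ⟨d, hd, ?_⟩
      rw [linkF_holds (hE1.setR (by norm_num) d) (by norm_num) (by norm_num)
        (by norm_num) (by simpa [State.setR_reg] using hy)] at hl ⊢
      simpa [State.setR_reg] using hl)
    rw [linkF_holds (hE1.setR (by norm_num) d) (by norm_num) (by norm_num)
        (by norm_num) (by simpa [State.setR_reg] using hy)] at hd'
    have hd'' : s.arr 1 y = s.reg 10 ∧ s.arr 7 d ≠ 0 ∧ Free N A (s.arr 1) y d := by
      simpa [State.setR_reg] using hd'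
    refine ⟨y, hy, d, hd, h6, h7, hd''.1, hd''.2.1, hd''.2.2, ?_⟩
    have hrun : reachBody.run 2 s = ((((s.setR 12 y).setR 13 d).setA 9 (s.reg 10) y).setA 8
        (s.reg 10) d).setA 7 (s.reg 10) 1 := by
      rw [reachBody, LP.run, if_pos hc]
      simp only [LP.run] at hrun1 hrun2 ⊢
      rw [hrun1, hrun2]
      simp [Expr.eval, State.setR_reg]
    rw [hrun]
    simp [State.setA_arr_ne]
  · right
    refine ⟨by rw [reachBody, LP.run, if_neg hc]; rfl, fun h6 h7 y hy d hd h1 h2 h3 => ?_⟩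
    exact hc (hiff.2 ⟨⟨h6, h7⟩, y, hy, d, hd, h1, h2, h3⟩)

/-- What `reach` maintains: the marked colours `R` are routed to `t`. -/
structure ReachInv (N : ℕ) (A : ℕ → ℕ → Prop) (f al : ℕ → ℕ) (t : ℕ) (s : State) : Prop where
  env : Env A N s
  f_eq : s.arr 1 = f
  al_eq : s.arr 6 = al
  mem : t ∈ on N (s.arr 7)
  sub : ∀ c ∈ on N (s.arr 7), c ≠ t → al c ≠ 0
  routed : ∃ ρ, ∀ r, Routed N A f t (· ∈ on N (s.arr 7)) (s.arr 8) (s.arr 9) ρ r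

theorem ReachInv.congr {N : ℕ} {A : ℕ → ℕ → Prop} {f al : ℕ → ℕ} {t : ℕ} {s : State}
    (h : ReachInv N A f al t s) {x : ℕ} (hx : 6 ≤ x) (v : ℕ) :
    ReachInv N A f al t (s.setR x v) :=
  ⟨h.env.setR hx v, h.f_eq, h.al_eq, h.mem, h.sub, h.routed⟩

theorem on_update {N c : ℕ} (hc : c < N) (g : ℕ → ℕ) :
    on N (Function.update g c 1) = insert c (on N g) := by
  ext x
  rw [mem_insert, mem_on, mem_on]
  by_cases h : x = c
  · subst h; simp [hc]
  · rw [Function.update_of_ne h]; simp [h]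

theorem ReachInv.step {N : ℕ} {A : ℕ → ℕ → Prop} {f al : ℕ → ℕ} {t : ℕ} {s : State}
    (h : ReachInv N A f al t s) (hc : s.reg 10 < N) :
    ReachInv N A f al t (reachBody.run 2 s) ∧
    ((∃ d ∈ on N (s.arr 7), al (s.reg 10) ≠ 0 ∧ s.reg 10 ∉ on N (s.arr 7) ∧
      Mov N A f (s.reg 10) d ∧
      on N ((reachBody.run 2 s).arr 7) = insert (s.reg 10) (on N (s.arr 7))) ∨
    (on N ((reachBody.run 2 s).arr 7) = on N (s.arr 7) ∧ (al (s.reg 10) ≠ 0 →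
      s.reg 10 ∉ on N (s.arr 7) → ∀ d ∈ on N (s.arr 7), ¬ Mov N A f (s.reg 10) d))) := by
  set c := s.reg 10 with hc'
  rcases run_reachBody h.env with ⟨y, hy, d, hd, h6, h7, hyc, hd7, hfree, r7, r8, r9⟩ | ⟨hrun, hno⟩
  · rw [← hc'] at h6 h7 hyc r7 r8 r9
    rw [h.f_eq] at hyc hfree
    rw [h.al_eq] at h6
    have hdon : d ∈ on N (s.arr 7) := mem_on.2 ⟨hd, hd7⟩
    have hcn : c ∉ on N (s.arr 7) := fun h' => (mem_on.1 h').2 h7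
    have hct : c ≠ t := fun h' => hcn (h' ▸ h.mem)
    have hon : on N ((reachBody.run 2 s).arr 7) = insert c (on N (s.arr 7)) := by
      rw [r7, on_update hc]
    refine ⟨⟨h.env.run _ rfl, ?_, ?_, ?_, ?_, ?_⟩, Or.inl ⟨d, hdon, h6, hcn, ⟨y, hy, hyc, hfree⟩, hon⟩⟩
    · rw [LP.run_arr 2 _ rfl, h.f_eq]
    · rw [LP.run_arr 2 _ rfl, h.al_eq]
    · rw [hon]; exact mem_insert_of_mem h.mem
    · rw [hon]
      intro x hx hxt
      rcases mem_insert.1 hx with rfl | hx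
      · exact h6
      · exact h.sub x hx hxt
    · obtain ⟨ρ, hρ⟩ := h.routed
      -- The new colour ranks just above its parent. It was unmarked, so it is nobody's parent and
      -- older rank comparisons are unaffected.
      refine ⟨Function.update ρ c (ρ d + 1), fun r x hx hxt _ => ?_⟩
      simp only at hx ⊢
      rw [hon] at hx ⊢
      rw [r8, r9]
      have hdc : d ≠ c := fun h' => hcn (h' ▸ hdon)
      by_cases hxc : x = c
      · subst hxc
        simp only [Function.update_self]
        rw [Function.update_of_ne hdc]
        exact ⟨mem_insert_of_mem hdon, by omega, hy, hyc, hfree⟩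
      · obtain ⟨h1, h2, h3⟩ := hρ (ρ x) x ((mem_insert.1 hx).resolve_left hxc) hxt le_rfl
        have hpc : s.arr 8 x ≠ c := fun h' => hcn (h' ▸ h1)
        rw [Function.update_of_ne hxc, Function.update_of_ne hxc, Function.update_of_ne hxc,
          Function.update_of_ne hpc]
        exact ⟨mem_insert_of_mem h1, h2, h3⟩
  · rw [hrun]
    refine ⟨h, Or.inr ⟨rfl, fun h6 hcn d hd ⟨y, hy, hyc, hfree⟩ => ?_⟩⟩
    refine hno (by rwa [h.al_eq]) ?_ y hy d (mem_on.1 hd).1 (by rwa [h.f_eq]) (mem_on.1 hd).2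
      (by rwa [h.f_eq])
    by_contra h'
    exact hcn (mem_on.2 ⟨hc, h'⟩)

/-- No further colour can be marked. -/
def ReachClosed (N : ℕ) (A : ℕ → ℕ → Prop) (f al : ℕ → ℕ) (R : Finset ℕ) : Prop :=
  ∀ c < N, al c ≠ 0 → ∀ d ∈ R, Mov N A f c d → c ∈ R

/-- A round marks every colour with a move into the set marked at its start. So if it marks nothing
new, the set is closed. -/
theorem ReachInv.round {N : ℕ} {A : ℕ → ℕ → Prop} {f al : ℕ → ℕ} {t : ℕ} {s : State}
    (h : ReachInv N A f al t s) :
    ReachInv N A f al t ((LP.iter 10 reachBody).run 2 s) ∧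
    (ReachClosed N A f al (on N (((LP.iter 10 reachBody).run 2 s).arr 7)) ∨
      (¬ ReachClosed N A f al (on N (s.arr 7)) ∧
        (on N (s.arr 7)).card < (on N (((LP.iter 10 reachBody).run 2 s).arr 7)).card)) := by
  set R := on N (s.arr 7) with hR
  let Inv : ℕ → State → Prop := fun i s' => ReachInv N A f al t s' ∧ R ⊆ on N (s'.arr 7) ∧
    (ReachClosed N A f al R → on N (s'.arr 7) ⊆ R) ∧
    ∀ c < i, al c ≠ 0 → ∀ d ∈ R, Mov N A f c d → c ∈ on N (s'.arr 7)
  obtain ⟨s', ⟨h1, h2, h3, h4⟩, hrun⟩ := LP.run_iter (β := 2) (x := 10) (P := reachBody) (s := s) Inv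
    ⟨h, subset_rfl, fun _ => subset_rfl, fun c hc => absurd hc (by omega)⟩ (by
      rintro i hi s' ⟨h1, h2, h3, h4⟩
      rw [h.env.1] at hi
      have h1' := h1.congr (x := 10) (by norm_num) i
      have hst := h1'.step (by rwa [State.setR_reg_self])
      rw [State.setR_reg_self, State.setR_arr] at hst
      obtain ⟨g1, g2⟩ := hst
      rcases g2 with ⟨d, hd, hal, hin, hm, hon⟩ | ⟨hon, hno⟩
      · refine ⟨g1, ?_, ?_, ?_⟩
        · rw [hon]; exact h2.trans (subset_insert _ _)
        · intro hcl
          exact absurd (h2 (hcl i hi hal d (h3 hcl hd) hm)) hin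
        · intro c hc hal' e he hme
          rw [hon]
          rcases Nat.lt_succ_iff_lt_or_eq.1 hc with h' | rfl
          · exact mem_insert_of_mem (h4 c h' hal' e he hme)
          · exact mem_insert_self _ _
      · refine ⟨g1, by rwa [hon], by rwa [hon], ?_⟩
        intro c hc hal' e he hme
        rw [hon]
        rcases Nat.lt_succ_iff_lt_or_eq.1 hc with h' | rfl
        · exact h4 c h' hal' e he hme
        · by_contra hcn
          exact hno hal' hcn e (h2 he) hme)
  rw [hrun]
  refine ⟨h1.congr (by norm_num) _, ?_⟩
  rw [State.setR_arr]
  rw [h.env.1] at h4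
  by_cases hsub : on N (s'.arr 7) ⊆ R
  · left
    intro c hc hal d hd hm
    exact h4 c hc hal d (hsub hd) hm
  · right
    exact ⟨fun hcl => hsub (h3 hcl), card_lt_card ⟨h2, hsub⟩⟩

theorem run_reach {N : ℕ} {A : ℕ → ℕ → Prop} {s : State} (hE : Env A N s) (ht : s.reg 6 < N) :
    ReachInv N A (s.arr 1) (s.arr 6) (s.reg 6) (reach.run 2 s) ∧
      ReachClosed N A (s.arr 1) (s.arr 6) (on N ((reach.run 2 s).arr 7)) := by
  set s1 := (mapP 7 (.lit 0)).run 2 s with hs1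
  have hE1 : Env A N s1 := hE.run _ rfl
  have h7 : ∀ k < N, s1.arr 7 k = 0 := run_mapP (fun _ => 0) hE.1 (fun _ _ _ => rfl)
  set s2 := (LP.put 7 (.reg 6) (.lit 1)).run 2 s1 with hs2
  have hE2 : Env A N s2 := hE1.run _ rfl
  have h6 : s1.reg 6 = s.reg 6 := LP.run_reg 2 _ rfl s
  have hs2' : on N (s2.arr 7) = {s.reg 6} := by
    have : s2.arr 7 = Function.update (s1.arr 7) (s.reg 6) 1 := by
      rw [hs2, ← h6]
      simp [LP.run, Expr.eval]
    rw [this, on_update ht]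
    have : on N (s1.arr 7) = ∅ := by
      ext c
      rw [mem_on]
      constructor
      · rintro ⟨h, h'⟩; exact absurd (h7 c h) h'
      · simp
    rw [this]; rfl
  have hinv : ReachInv N A (s.arr 1) (s.arr 6) (s.reg 6) s2 := by
    refine ⟨hE2, ?_, ?_, by rw [hs2']; simp, ?_, fun _ => 0, ?_⟩
    · rw [hs2, LP.run_arr 2 _ rfl, hs1, LP.run_arr 2 _ rfl]
    · rw [hs2, LP.run_arr 2 _ rfl, hs1, LP.run_arr 2 _ rfl]
    · intro c hc hct
      rw [hs2', mem_singleton] at hc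
      exact absurd hc hct
    · intro r c hc hct
      rw [hs2', mem_singleton] at hc
      exact absurd hc hct
  -- One colour is marked at the start and each unfinished round adds another; after `N` unfinished
  -- rounds there would be more than `N`.
  let Inv : ℕ → State → Prop := fun i s' => ReachInv N A (s.arr 1) (s.arr 6) (s.reg 6) s' ∧
    (ReachClosed N A (s.arr 1) (s.arr 6) (on N (s'.arr 7)) ∨ i + 1 ≤ (on N (s'.arr 7)).card)
  obtain ⟨s3, ⟨h1, h2⟩, hrun⟩ := LP.run_iter (β := 2) (x := 11) (P := .iter 10 reachBody) (s := s2) Inv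
    ⟨hinv, Or.inr (by rw [hs2']; simp)⟩ (by
      rintro i hi s' ⟨h1, h2⟩
      obtain ⟨g1, g2⟩ := (h1.congr (x := 11) (by norm_num) i).round
      rw [State.setR_arr] at g2
      refine ⟨g1, ?_⟩
      rcases g2 with g2 | ⟨g2, g3⟩
      · exact Or.inl g2
      · right
        have := h2.resolve_left g2
        omega)
  have hreach : reach.run 2 s = s3.setR 11 (s2.reg 2) := hrun
  rw [hreach]
  refine ⟨h1.congr (by norm_num) _, ?_⟩
  rw [State.setR_arr]
  refine h2.resolve_right fun h' => ?_
  rw [hE2.1] at h'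
  have : (on N (s3.arr 7)).card ≤ N := by
    exact (card_filter_le (range N) _).trans_eq (card_range N)
  omega

theorem ReachInv.conn {N : ℕ} {A : ℕ → ℕ → Prop} {f al : ℕ → ℕ} {t : ℕ} {s : State}
    (h : ReachInv N A f al t s) : ∀ c ∈ on N (s.arr 7), Conn N A f (on N (s.arr 7)) c t := by
  obtain ⟨ρ, hρ⟩ := h.routed
  have : ∀ k, ∀ c ∈ on N (s.arr 7), ρ c < k → Conn N A f (on N (s.arr 7)) c t := by
    intro k
    induction k with
    | zero => intro c _ hk; omega
    | succ k ih =>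
      intro c hc hk
      by_cases hct : c = t
      · rw [hct]; exact .refl
      · obtain ⟨h1, h2, h3, h4, h5⟩ := hρ (ρ c) c hc hct le_rfl
        exact ReflTransGen.head ⟨hc, h1, _, h3, h4, h5⟩ (ih _ h1 (by omega))
  exact fun c hc => this _ c hc (Nat.lt_succ_self _)

theorem ReachInv.sub_on {N : ℕ} {A : ℕ → ℕ → Prop} {f al : ℕ → ℕ} {t : ℕ} {s : State}
    (h : ReachInv N A f al t s) (ht : t ∈ on N al) : on N (s.arr 7) ⊆ on N al := by
  intro c hc
  by_cases hct : c = t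
  · rwa [hct]
  · exact mem_on.2 ⟨(mem_on.1 hc).1, h.sub c hc hct⟩

theorem ReachInv.mem_of_conn {N : ℕ} {A : ℕ → ℕ → Prop} {f al : ℕ → ℕ} {t c : ℕ} {s : State}
    (h : ReachInv N A f al t s) (hcl : ReachClosed N A f al (on N (s.arr 7)))
    (hc : Conn N A f (on N al) c t) : c ∈ on N (s.arr 7) := by
  unfold Conn at hc
  induction hc using ReflTransGen.head_induction_on with
  | refl => exact h.mem
  | head hab _ ih =>
    obtain ⟨ha, _, hm⟩ := hab
    rw [mem_on] at ha
    exact hcl _ ha.1 ha.2 _ ih hm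

/-! ### Moving the surplus vertex along a route -/

def shiftBody : LP :=
  .cond (.not (.atom (.eq (.reg 7) (.reg 6))))
    (.seq (.put 1 (.get 9 (.reg 7)) (.get 8 (.reg 7))) (.set 7 (.get 8 (.reg 7)))) .skip

/-- Move a surplus vertex from the colour in register `7` to the colour in register `6`. -/
def shift : LP := .iter 10 shiftBody

/-- The number of colours of `R` ranked below the current one drops with each move, so `N` rounds
suffice. Only routes of rank at most the current one are needed, and `Routed.update` preserves them.
-/
theorem run_shift {N : ℕ} {A : ℕ → ℕ → Prop} (hA : ∀ v w, A v w → A w v) {s : State}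
    (hN : s.reg 2 = N) {R : Finset ℕ} (hR : R ⊆ range N) {ρ : ℕ → ℕ} (hp : Proper N A (s.arr 1))
    (hx : s.reg 7 ∈ R)
    (hr : Routed N A (s.arr 1) (s.reg 6) (· ∈ R) (s.arr 8) (s.arr 9) ρ (ρ (s.reg 7))) :
    Shifted N A (s.arr 1) (s.reg 7) (s.reg 6) (· ∈ R) ((shift.run 2 s).arr 1) (s.reg 6) := by
  let Inv : ℕ → State → Prop := fun i s' =>
    (s'.reg 6 = s.reg 6 ∧ s'.arr 8 = s.arr 8 ∧ s'.arr 9 = s.arr 9) ∧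
    Shifted N A (s.arr 1) (s.reg 7) (s.reg 6) (· ∈ R) (s'.arr 1) (s'.reg 7) ∧ s'.reg 7 ∈ R ∧
    Routed N A (s'.arr 1) (s.reg 6) (· ∈ R) (s.arr 8) (s.arr 9) ρ (ρ (s'.reg 7)) ∧
    (s'.reg 7 = s.reg 6 ∨ (R.filter (fun c => ρ c < ρ (s'.reg 7))).card + i ≤ N)
  obtain ⟨s', ⟨-, h1, h2, h3, h4⟩, hrun⟩ := LP.run_iter (β := 2) (x := 10) (P := shiftBody) (s := s) Inv
    ⟨⟨rfl, rfl, rfl⟩, Shifted.refl hp _ _ _, hx, hr, Or.inr (by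
      have := (card_filter_le R (fun c => ρ c < ρ (s.reg 7))).trans (card_le_card hR)
      simpa using this)⟩ (by
      rintro i hi s' ⟨⟨e1, e2, e3⟩, h1, h2, h3, h4⟩
      by_cases hst : s'.reg 7 = s.reg 6
      · have hrun : shiftBody.run 2 (s'.setR 10 i) = s'.setR 10 i := by
          rw [shiftBody, LP.run, if_neg]
          · rfl
          · simp [Fm.Holds, Expr.eval, State.setR_reg, e1, hst]
        rw [hrun]
        simp only [Inv, State.setR_arr, State.setR_reg_ne _ _ (show 6 ≠ 10 by decide),
          State.setR_reg_ne _ _ (show 7 ≠ 10 by decide)]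
        exact ⟨⟨e1, e2, e3⟩, h1, h2, h3, Or.inl hst⟩
      · set x := s'.reg 7 with hx'
        set d := s.arr 8 x with hd
        set y := s.arr 9 x with hy
        obtain ⟨g1, g2, g3, g4, g5⟩ := h3 x h2 hst le_rfl
        have hrun : shiftBody.run 2 (s'.setR 10 i) = ((s'.setR 10 i).setA 1 y d).setR 7 d := by
          rw [shiftBody, LP.run, if_pos]
          · simp [LP.run, Expr.eval, State.setR_reg, State.setA_arr_ne, e2, e3, ← hx', ← hd, ← hy]
          · simpa [Fm.Holds, Expr.eval, State.setR_reg, e1] using hst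
        rw [hrun]
        have k1 : (((s'.setR 10 i).setA 1 y d).setR 7 d).arr 1 = Function.update (s'.arr 1) y d := by
          simp
        have k2 : (((s'.setR 10 i).setA 1 y d).setR 7 d).reg 7 = d := by simp
        simp only [Inv, k1, k2]
        refine ⟨⟨by simp [State.setR_reg, e1], by simp [State.setA_arr_ne, e2],
          by simp [State.setA_arr_ne, e3]⟩, ?_, g1, ?_, Or.inr ?_⟩
        · exact h1.step hA h2 hst g1 g3 g4 g5
        · refine h3.update g4 g2.le fun c hc hcd hcx => ?_
          rw [hcx] at hcd
          exact absurd g2 (not_lt.2 hcd)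
        · have h4' := h4.resolve_left hst
          have : (R.filter (fun c => ρ c < ρ d)).card < (R.filter (fun c => ρ c < ρ x)).card := by
            refine card_lt_card ⟨fun c hc => ?_, fun hsub => ?_⟩
            · rw [mem_filter] at hc ⊢
              exact ⟨hc.1, hc.2.trans g2⟩
            · have := hsub (mem_filter.2 ⟨g1, g2⟩)
              rw [mem_filter] at this
              exact lt_irrefl _ this.2
          omega)
  have hend : s'.reg 7 = s.reg 6 := by
    by_contra hst
    have h4' := h4.resolve_left hst
    obtain ⟨g1, g2, _⟩ := h3 _ h2 hst le_rfl
    have : 0 < (R.filter (fun c => ρ c < ρ (s'.reg 7))).card :=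
      card_pos.2 ⟨_, mem_filter.2 ⟨g1, g2⟩⟩
    omega
  rw [hend] at h1
  rw [shift, hrun, State.setR_arr]
  exact h1

end FairAlloc

namespace FairAlloc

open Finset Relation

/-- `R` consists of the colours of `L` that reach `t` within `L`, with a route to `t`. -/
structure Reached (N : ℕ) (A : ℕ → ℕ → Prop) (f : ℕ → ℕ) (L : Finset ℕ) (t : ℕ) (R : Finset ℕ)
    (par wit : ℕ → ℕ) : Prop where
  mem : t ∈ R
  sub : R ⊆ L
  conn : ∀ c ∈ R, Conn N A f R c t
  of_conn : ∀ c, Conn N A f L c t → c ∈ R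
  closed : ∀ c ∈ L \ R, ∀ d ∈ R, ¬ Mov N A f c d
  routed : ∃ ρ, ∀ r, Routed N A f t (· ∈ R) par wit ρ r

theorem run_reach_reached {N : ℕ} {A : ℕ → ℕ → Prop} {s : State} (hE : Env A N s)
    (ht : s.reg 6 ∈ on N (s.arr 6)) :
    Reached N A (s.arr 1) (on N (s.arr 6)) (s.reg 6) (on N ((reach.run 2 s).arr 7))
      ((reach.run 2 s).arr 8) ((reach.run 2 s).arr 9) := by
  obtain ⟨h1, h2⟩ := run_reach hE (mem_on.1 ht).1
  refine ⟨h1.mem, h1.sub_on ht, h1.conn, fun c hc => h1.mem_of_conn h2 hc, ?_, h1.routed⟩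
  intro c hc d hd hm
  rw [mem_sdiff] at hc
  have := mem_on.1 hc.1
  exact hc.2 (h2 c this.1 this.2 d hd hm)

/-- The components of the state that describe the colouring problem are the same. -/
def Same (s s' : State) : Prop :=
  s'.arr 1 = s.arr 1 ∧ s'.arr 4 = s.arr 4 ∧ s'.reg 3 = s.reg 3 ∧ s'.reg 4 = s.reg 4 ∧
    s'.reg 8 = s.reg 8 ∧ s'.reg 9 = s.reg 9

theorem Same.trans {s s' s'' : State} (h : Same s s') (h' : Same s' s'') : Same s s'' := by
  obtain ⟨a1, a2, a3, a4, a5, a6⟩ := h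
  obtain ⟨b1, b2, b3, b4, b5, b6⟩ := h'
  exact ⟨b1.trans a1, b2.trans a2, b3.trans a3, b4.trans a4, b5.trans a5, b6.trans a6⟩

theorem LP.run_same (P : LP) (s : State) (h : (P.writesA 1 || P.writesA 4 || P.writesR 3 ||
    P.writesR 4 || P.writesR 8 || P.writesR 9) = false) : Same s (P.run 2 s) := by
  simp only [Bool.or_eq_false_iff] at h
  obtain ⟨⟨⟨⟨⟨h1, h2⟩, h3⟩, h4⟩, h5⟩, h6⟩ := h
  exact ⟨P.run_arr 2 h1 s, P.run_arr 2 h2 s, P.run_reg 2 h3 s, P.run_reg 2 h4 s, P.run_reg 2 h5 s,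
    P.run_reg 2 h6 s⟩

/-- The state holds a proper colouring with `n` colours of the graph `A`, whose classes have size
`k`, apart from the small and the large one. -/
structure Good (A : ℕ → ℕ → Prop) (N n k : ℕ) (s : State) : Prop where
  env : Env A N s
  le : n ≤ N
  near : Near N A n k (s.arr 1) (on N (s.arr 4)) (s.reg 3) (s.reg 4)

theorem Good.same {A : ℕ → ℕ → Prop} {N n k : ℕ} {s s' : State} (h : Good A N n k s)
    (hs : Same s s') (hE : Env A N s') : Good A N n k s' := by
  obtain ⟨a1, a2, a3, a4, -, -⟩ := hs
  refine ⟨hE, h.le, ?_⟩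
  rw [a1, a2, a3, a4]
  exact h.near

theorem Good.col {A : ℕ → ℕ → Prop} {N n k : ℕ} {s : State} (h : Good A N n k s) {v : ℕ}
    (hv : v < N) : s.arr 1 v < N := (h.near.col v hv).trans_le h.le

/-! ### The single improvement steps -/

/-- Which colours reach the small colour? -/
def prepAcc : LP := .seq (mapP 6 (.get 4 (.reg 10))) (.seq (.set 6 (.reg 3)) reach)

/-- Which colours reach the small colour without the one in register `8`? -/
def prepTerminal : LP :=
  .seq (mapP 6 (.lt (.eq (.reg 10) (.reg 8)) (.lt (.lit 0) (.get 5 (.reg 10))))) reach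

/-- Which inaccessible colours reach the one in register `9`? -/
def prepSwap : LP :=
  .seq (mapP 6 (.lt (.lt (.lit 0) (.get 5 (.reg 10))) (.lt (.lit 0) (.get 4 (.reg 10)))))
    (.seq (.set 6 (.reg 9)) reach)

theorem on_map_active {N : ℕ} {s : State} (hN : s.reg 2 = N) :
    on N (((mapP 6 (.get 4 (.reg 10))).run 2 s).arr 6) = on N (s.arr 4) := by
  refine on_congr fun c hc => ?_
  rw [run_mapP (fun c => s.arr 4 c) hN (fun s' ha _ => ?_) c hc]
  simp only [Expr.eval]
  rw [ha 4 (by norm_num)]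

/-- As `.lt` of truth values means "not the first, but the second", it serves here as set
difference. -/
theorem on_map_erase {N : ℕ} {s : State} (hN : s.reg 2 = N) :
    on N (((mapP 6 (.lt (.eq (.reg 10) (.reg 8)) (.lt (.lit 0) (.get 5 (.reg 10))))).run 2 s).arr 6)
      = (on N (s.arr 5)).erase (s.reg 8) := by
  ext c
  rw [mem_on, mem_erase, mem_on]
  by_cases hc : c < N
  · rw [run_mapP (fun c => if (if c = s.reg 8 then 1 else 0) < (if 0 < s.arr 5 c then 1 else 0)
      then 1 else 0) hN (fun s' ha hr => ?_) c hc]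
    · by_cases h1 : c = s.reg 8 <;> by_cases h2 : s.arr 5 c = 0 <;>
        simp [h1, h2, hc, Nat.pos_of_ne_zero]
      all_goals (try rw [← h1]; simp [h2, hc, Nat.pos_of_ne_zero])
    · rw [← ha 5 (by norm_num), ← hr 8 (by norm_num)]
      rfl
  · simp [hc]

theorem on_map_sdiff {N : ℕ} {s : State} (hN : s.reg 2 = N) :
    on N (((mapP 6 (.lt (.lt (.lit 0) (.get 5 (.reg 10)))
      (.lt (.lit 0) (.get 4 (.reg 10))))).run 2 s).arr 6) = on N (s.arr 4) \ on N (s.arr 5) := by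
  ext c
  rw [mem_on, mem_sdiff, mem_on, mem_on]
  by_cases hc : c < N
  · rw [run_mapP (fun c => if (if 0 < s.arr 5 c then 1 else 0) < (if 0 < s.arr 4 c then 1 else 0)
      then 1 else 0) hN (fun s' ha hr => ?_) c hc]
    · by_cases h1 : s.arr 4 c = 0 <;> by_cases h2 : s.arr 5 c = 0 <;>
        simp [h1, h2, hc, Nat.pos_of_ne_zero]
    · rw [← ha 5 (by norm_num), ← ha 4 (by norm_num)]
      rfl
  · simp [hc]

section Prep

variable {A : ℕ → ℕ → Prop} {N n k : ℕ} {s : State}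

theorem run_prepAcc (h : Good A N n k s) :
    Reached N A (s.arr 1) (on N (s.arr 4)) (s.reg 3) (on N ((prepAcc.run 2 s).arr 7))
      ((prepAcc.run 2 s).arr 8) ((prepAcc.run 2 s).arr 9) ∧ (prepAcc.run 2 s).reg 6 = s.reg 3 := by
  set s1 := (mapP 6 (.get 4 (.reg 10))).run 2 s with hs1
  set s2 := (LP.set 6 (.reg 3)).run 2 s1 with hs2
  have hE2 : Env A N s2 := (h.env.run _ rfl : Env A N s1).run _ rfl
  have h6 : s2.reg 6 = s.reg 3 := by
    have : s1.reg 3 = s.reg 3 := LP.run_reg 2 _ rfl s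
    rw [hs2, ← this]
    simp [LP.run, Expr.eval]
  have hon : on N (s2.arr 6) = on N (s.arr 4) := by
    rw [hs2, LP.run_arr 2 _ rfl, hs1, on_map_active h.env.1]
  have hf : s2.arr 1 = s.arr 1 := by
    rw [hs2, LP.run_arr 2 _ rfl, hs1, LP.run_arr 2 _ rfl]
  have := run_reach_reached hE2 (by rw [h6, hon]; exact h.near.lo_mem)
  rw [h6, hon, hf] at this
  refine ⟨this, ?_⟩
  have h6' : (reach.run 2 s2).reg 6 = s2.reg 6 := LP.run_reg 2 _ rfl _
  rw [← h6, ← h6']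
  rfl

/-- Register `6` is not set here; it still holds the small colour from `prepAcc`. -/
theorem run_prepTerminal (h : Good A N n k s) (ht : s.reg 6 = s.reg 3)
    (hlo : s.reg 3 ∈ on N (s.arr 5)) (hW : s.reg 8 ≠ s.reg 3) :
    Reached N A (s.arr 1) ((on N (s.arr 5)).erase (s.reg 8)) (s.reg 3)
      (on N ((prepTerminal.run 2 s).arr 7)) ((prepTerminal.run 2 s).arr 8)
      ((prepTerminal.run 2 s).arr 9) ∧
      on N ((prepTerminal.run 2 s).arr 6) = (on N (s.arr 5)).erase (s.reg 8) := by
  set s1 := (mapP 6 (.lt (.eq (.reg 10) (.reg 8)) (.lt (.lit 0) (.get 5 (.reg 10))))).run 2 s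
    with hs1
  have hE1 : Env A N s1 := h.env.run _ rfl
  have h6 : s1.reg 6 = s.reg 3 := by rw [hs1, LP.run_reg 2 _ rfl, ht]
  have hon : on N (s1.arr 6) = (on N (s.arr 5)).erase (s.reg 8) := by
    rw [hs1, on_map_erase h.env.1]
  have hf : s1.arr 1 = s.arr 1 := by rw [hs1, LP.run_arr 2 _ rfl]
  have := run_reach_reached hE1 (by rw [h6, hon]; exact mem_erase.2 ⟨hW.symm, hlo⟩)
  rw [h6, hon, hf] at this
  refine ⟨this, ?_⟩
  have h6' : (reach.run 2 s1).arr 6 = s1.arr 6 := LP.run_arr 2 _ rfl _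
  rw [← hon, ← h6']
  rfl

theorem run_prepSwap (h : Good A N n k s) (hY : s.reg 9 ∈ on N (s.arr 4) \ on N (s.arr 5)) :
    Reached N A (s.arr 1) (on N (s.arr 4) \ on N (s.arr 5)) (s.reg 9)
      (on N ((prepSwap.run 2 s).arr 7)) ((prepSwap.run 2 s).arr 8)
      ((prepSwap.run 2 s).arr 9) ∧ (prepSwap.run 2 s).reg 6 = s.reg 9 := by
  set s1 := (mapP 6 (.lt (.lt (.lit 0) (.get 5 (.reg 10))) (.lt (.lit 0) (.get 4 (.reg 10))))).run 2 s
    with hs1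
  set s2 := (LP.set 6 (.reg 9)).run 2 s1 with hs2
  have hE2 : Env A N s2 := (h.env.run _ rfl : Env A N s1).run _ rfl
  have h6 : s2.reg 6 = s.reg 9 := by
    have : s1.reg 9 = s.reg 9 := LP.run_reg 2 _ rfl s
    rw [hs2, ← this]
    simp [LP.run, Expr.eval]
  have hon : on N (s2.arr 6) = on N (s.arr 4) \ on N (s.arr 5) := by
    rw [hs2, LP.run_arr 2 _ rfl, hs1, on_map_sdiff h.env.1]
  have hf : s2.arr 1 = s.arr 1 := by
    rw [hs2, LP.run_arr 2 _ rfl, hs1, LP.run_arr 2 _ rfl]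
  have := run_reach_reached hE2 (by rwa [h6, hon])
  rw [h6, hon, hf] at this
  refine ⟨this, ?_⟩
  have h6' : (reach.run 2 s2).reg 6 = s2.reg 6 := LP.run_reg 2 _ rfl _
  rw [← h6, ← h6']
  rfl

end Prep

def releaseF (z y X x : ℕ) : Fm :=
  .and (soloF z y x) (.and (.atom (.eq (.get 1 (.reg z)) (.reg 8)))
    (.and (.and (.atom (.get 4 (.get 1 (.reg y)))) (.not (.atom (.get 5 (.get 1 (.reg y))))))
      (.and (.atom (.get 5 (.reg X))) (.and (.not (.atom (.eq (.reg X) (.reg 8)))) (freeF z X x)))))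

def swapF (z y y' x : ℕ) : Fm :=
  .and (soloF z y x) (.and (soloF z y' x) (.and (.atom (.eq (.get 1 (.reg z)) (.reg 8)))
    (.and (.atom (.eq (.get 1 (.reg y)) (.reg 9)))
      (.and (.and (.atom (.get 4 (.get 1 (.reg y')))) (.not (.atom (.get 5 (.get 1 (.reg y'))))))
        (.and (.not (.atom (.eq (.reg y) (.reg y')))) (.not (adjF y y')))))))

section HoldsSteps

variable {A : ℕ → ℕ → Prop} {N : ℕ} {s : State}

theorem releaseF_holds (hE : Env A N s) (hcol : ∀ v < N, s.arr 1 v < N) {z y X x : ℕ} (hx : 6 ≤ x)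
    (hzx : z ≠ x) (hyx : y ≠ x) (hXx : X ≠ x) (hz : s.reg z < N) (hy : s.reg y < N)
    (hX : s.reg X < N) : (releaseF z y X x).Holds 2 s ↔
      CanRelease N A (s.arr 1) (on N (s.arr 5)) (on N (s.arr 4)) (s.reg 8) (s.reg z) (s.reg y)
        (s.reg X) := by
  simp only [releaseF, holds_and, holds_not, holds_eq, holds_get, soloF_holds hE hx hzx hyx hz hy,
    freeF_holds hE hx hzx hXx hz, CanRelease, mem_sdiff, mem_on, Expr.eval, hcol _ hy, hX, true_and,
    Ne]

theorem swapF_holds (hE : Env A N s) (hcol : ∀ v < N, s.arr 1 v < N) {z y y' x : ℕ} (hx : 6 ≤ x)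
    (hzx : z ≠ x) (hyx : y ≠ x) (hyx' : y' ≠ x) (hz : s.reg z < N) (hy : s.reg y < N)
    (hy' : s.reg y' < N) : (swapF z y y' x).Holds 2 s ↔
      CanSwap N A (s.arr 1) (on N (s.arr 5)) (on N (s.arr 4)) (s.reg 8) (s.reg 9) (s.reg z)
        (s.reg y) (s.reg y') := by
  simp only [swapF, holds_and, holds_not, holds_eq, holds_get, soloF_holds hE hx hzx hyx hz hy,
    soloF_holds hE hx hzx hyx' hz hy', adjF_holds, hE.2 _ hy _ hy', CanSwap, mem_sdiff, mem_on,
    Expr.eval, hcol _ hy', true_and, Ne]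

theorem ex_releaseF_holds (hE : Env A N s) (hcol : ∀ v < N, s.arr 1 v < N) :
    (Fm.ex 100 (.ex 101 (.ex 102 (releaseF 100 101 102 103)))).Holds 2 s ↔
      ∃ z < N, ∃ y < N, ∃ X < N, CanRelease N A (s.arr 1) (on N (s.arr 5)) (on N (s.arr 4))
        (s.reg 8) z y X := by
  simp only [holds_ex, State.setR_reg_ne _ _ (show 2 ≠ 100 by decide),
    State.setR_reg_ne _ _ (show 2 ≠ 101 by decide), hE.1]
  refine exists_congr fun z => and_congr_right fun hz => exists_congr fun y =>
    and_congr_right fun hy => exists_congr fun X => and_congr_right fun hX => ?_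
  rw [releaseF_holds (((hE.setR (by norm_num) z).setR (by norm_num) y).setR (by norm_num) X) hcol
    (by norm_num) (by norm_num) (by norm_num) (by norm_num) (by simpa [State.setR_reg] using hz)
    (by simpa [State.setR_reg] using hy) (by simpa [State.setR_reg] using hX)]
  simp [State.setR_reg]

theorem ex_swapF_holds (hE : Env A N s) (hcol : ∀ v < N, s.arr 1 v < N) :
    (Fm.ex 100 (.ex 101 (.ex 102 (swapF 100 101 102 103)))).Holds 2 s ↔
      ∃ z < N, ∃ y < N, ∃ y' < N, CanSwap N A (s.arr 1) (on N (s.arr 5)) (on N (s.arr 4))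
        (s.reg 8) (s.reg 9) z y y' := by
  simp only [holds_ex, State.setR_reg_ne _ _ (show 2 ≠ 100 by decide),
    State.setR_reg_ne _ _ (show 2 ≠ 101 by decide), hE.1]
  refine exists_congr fun z => and_congr_right fun hz => exists_congr fun y =>
    and_congr_right fun hy => exists_congr fun X => and_congr_right fun hX => ?_
  rw [swapF_holds (((hE.setR (by norm_num) z).setR (by norm_num) y).setR (by norm_num) X) hcol
    (by norm_num) (by norm_num) (by norm_num) (by norm_num) (by simpa [State.setR_reg] using hz)
    (by simpa [State.setR_reg] using hy) (by simpa [State.setR_reg] using hX)]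
  simp [State.setR_reg]

end HoldsSteps

def chooseRelease : LP :=
  .seq (.choose 14 (.ex 100 (.ex 101 (releaseF 14 100 101 102))))
    (.seq (.choose 12 (.ex 100 (releaseF 14 12 100 101))) (.choose 16 (releaseF 14 12 16 100)))

/-- Move `z` within the accessible colours, and its private neighbour `y` to the colour of `z`;
then drop the accessible colours. -/
def releaseP : LP :=
  .seq chooseRelease (.seq (.put 1 (.reg 14) (.reg 16)) (.seq (.set 7 (.reg 16)) (.seq shift
    (.seq (.set 3 (.get 1 (.reg 12))) (.seq (.put 1 (.reg 12) (.reg 8))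
      (.seq (mapP 6 (.lt (.lt (.lit 0) (.get 5 (.reg 10))) (.lt (.lit 0) (.get 4 (.reg 10)))))
        (mapP 4 (.get 6 (.reg 10)))))))))

def chooseSwap : LP :=
  .seq (.choose 14 (.ex 100 (.ex 101 (swapF 14 100 101 102))))
    (.choose 12 (.ex 100 (swapF 14 12 100 101)))

def freeClassF : Fm :=
  .and (.and (.atom (.get 4 (.reg 16))) (.not (.atom (.get 5 (.reg 16)))))
    (.not (.ex 100 (.and (adjF 14 100) (.and (.atom (.eq (.get 1 (.reg 100)) (.reg 16)))
      (.not (.atom (.eq (.reg 100) (.reg 12))))))))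

/-- Move the surplus vertex to the colour of `y`, then `y` to the colour of `z`, and `z` to an
inaccessible colour. -/
def swapP : LP :=
  .seq chooseSwap (.seq (.set 7 (.reg 4)) (.seq shift (.seq (.choose 16 freeClassF)
    (.seq (.put 1 (.reg 12) (.reg 8)) (.seq (.put 1 (.reg 14) (.reg 16)) (.set 4 (.reg 16)))))))

section RunSteps

variable {A : ℕ → ℕ → Prop} {N : ℕ} {s : State}

/-- The vertices and the colour are found one at a time; quantifying the later ones in each search
guarantees that the choice can be completed. -/
theorem run_chooseRelease (hE : Env A N s) (hcol : ∀ v < N, s.arr 1 v < N)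
    (h : ∃ z < N, ∃ y < N, ∃ X < N, CanRelease N A (s.arr 1) (on N (s.arr 5)) (on N (s.arr 4))
        (s.reg 8) z y X) :
    ∃ z < N, ∃ y < N, ∃ X < N, CanRelease N A (s.arr 1) (on N (s.arr 5)) (on N (s.arr 4))
        (s.reg 8) z y X ∧ chooseRelease.run 2 s = ((s.setR 14 z).setR 12 y).setR 16 X := by
  obtain ⟨z, hz, y, hy, X, hX, hr⟩ := h
  obtain ⟨z, hz, hz', hrun1⟩ := run_choose (x := 14)
    (φ := .ex 100 (.ex 101 (releaseF 14 100 101 102))) hE.1 (by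
      refine ⟨z, hz, y, by simpa [State.setR_reg, hE.1] using hy, X,
        by simpa [State.setR_reg, hE.1] using hX, ?_⟩
      rw [releaseF_holds (((hE.setR (by norm_num) z).setR (by norm_num) y).setR (by norm_num) X) hcol
        (by norm_num) (by norm_num) (by norm_num) (by norm_num) (by simpa [State.setR_reg] using hz)
        (by simpa [State.setR_reg] using hy) (by simpa [State.setR_reg] using hX)]
      simpa [State.setR_reg] using hr)
  obtain ⟨y, hy, X, hX, hr⟩ := hz'
  have hE1 := hE.setR (x := 14) (by norm_num) z
  rw [hE1.1] at hy
  rw [(hE1.setR (by norm_num) y).1] at hX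
  rw [releaseF_holds ((hE1.setR (by norm_num) y).setR (by norm_num) X) hcol
    (by norm_num) (by norm_num) (by norm_num) (by norm_num) (by simpa [State.setR_reg] using hz)
    (by simpa [State.setR_reg] using hy) (by simpa [State.setR_reg] using hX)] at hr
  obtain ⟨y, hy, hy', hrun2⟩ := run_choose (x := 12)
    (φ := .ex 100 (releaseF 14 12 100 101)) hE1.1 (by
      refine ⟨y, hy, X, by simpa [State.setR_reg, hE.1] using hX, ?_⟩
      rw [releaseF_holds ((hE1.setR (by norm_num) y).setR (by norm_num) X) hcol
        (by norm_num) (by norm_num) (by norm_num) (by norm_num) (by simpa [State.setR_reg] using hz)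
        (by simpa [State.setR_reg] using hy) (by simpa [State.setR_reg] using hX)]
      simpa [State.setR_reg] using hr)
  obtain ⟨X, hX, hr⟩ := hy'
  have hE2 := hE1.setR (x := 12) (by norm_num) y
  rw [hE2.1] at hX
  rw [releaseF_holds (hE2.setR (by norm_num) X) hcol
    (by norm_num) (by norm_num) (by norm_num) (by norm_num) (by simpa [State.setR_reg] using hz)
    (by simpa [State.setR_reg] using hy) (by simpa [State.setR_reg] using hX)] at hr
  obtain ⟨X, hX, hr, hrun3⟩ := run_choose (x := 16) (φ := releaseF 14 12 16 100) hE2.1 (by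
      refine ⟨X, hX, ?_⟩
      rw [releaseF_holds (hE2.setR (by norm_num) X) hcol
        (by norm_num) (by norm_num) (by norm_num) (by norm_num) (by simpa [State.setR_reg] using hz)
        (by simpa [State.setR_reg] using hy) (by simpa [State.setR_reg] using hX)]
      simpa [State.setR_reg] using hr)
  rw [releaseF_holds (hE2.setR (by norm_num) X) hcol
    (by norm_num) (by norm_num) (by norm_num) (by norm_num) (by simpa [State.setR_reg] using hz)
    (by simpa [State.setR_reg] using hy) (by simpa [State.setR_reg] using hX)] at hr
  refine ⟨z, hz, y, hy, X, hX, by simpa [State.setR_reg] using hr, ?_⟩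
  simp only [chooseRelease, LP.run] at hrun1 hrun2 hrun3 ⊢
  rw [hrun1, hrun2, hrun3]

theorem run_chooseSwap (hE : Env A N s) (hcol : ∀ v < N, s.arr 1 v < N)
    (h : ∃ z < N, ∃ y < N, ∃ y' < N, CanSwap N A (s.arr 1) (on N (s.arr 5)) (on N (s.arr 4))
        (s.reg 8) (s.reg 9) z y y') :
    ∃ z < N, ∃ y < N, (∃ y', CanSwap N A (s.arr 1) (on N (s.arr 5)) (on N (s.arr 4))
        (s.reg 8) (s.reg 9) z y y') ∧ chooseSwap.run 2 s = (s.setR 14 z).setR 12 y := by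
  obtain ⟨z, hz, y, hy, X, hX, hr⟩ := h
  obtain ⟨z, hz, hz', hrun1⟩ := run_choose (x := 14)
    (φ := .ex 100 (.ex 101 (swapF 14 100 101 102))) hE.1 (by
      refine ⟨z, hz, y, by simpa [State.setR_reg, hE.1] using hy, X,
        by simpa [State.setR_reg, hE.1] using hX, ?_⟩
      rw [swapF_holds (((hE.setR (by norm_num) z).setR (by norm_num) y).setR (by norm_num) X) hcol
        (by norm_num) (by norm_num) (by norm_num) (by norm_num) (by simpa [State.setR_reg] using hz)
        (by simpa [State.setR_reg] using hy) (by simpa [State.setR_reg] using hX)]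
      simpa [State.setR_reg] using hr)
  obtain ⟨y, hy, X, hX, hr⟩ := hz'
  have hE1 := hE.setR (x := 14) (by norm_num) z
  rw [hE1.1] at hy
  rw [(hE1.setR (by norm_num) y).1] at hX
  rw [swapF_holds ((hE1.setR (by norm_num) y).setR (by norm_num) X) hcol
    (by norm_num) (by norm_num) (by norm_num) (by norm_num) (by simpa [State.setR_reg] using hz)
    (by simpa [State.setR_reg] using hy) (by simpa [State.setR_reg] using hX)] at hr
  obtain ⟨y, hy, hy', hrun2⟩ := run_choose (x := 12)
    (φ := .ex 100 (swapF 14 12 100 101)) hE1.1 (by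
      refine ⟨y, hy, X, by simpa [State.setR_reg, hE.1] using hX, ?_⟩
      rw [swapF_holds ((hE1.setR (by norm_num) y).setR (by norm_num) X) hcol
        (by norm_num) (by norm_num) (by norm_num) (by norm_num) (by simpa [State.setR_reg] using hz)
        (by simpa [State.setR_reg] using hy) (by simpa [State.setR_reg] using hX)]
      simpa [State.setR_reg] using hr)
  obtain ⟨X, hX, hr⟩ := hy'
  have hE2 := hE1.setR (x := 12) (by norm_num) y
  rw [hE2.1] at hX
  rw [swapF_holds (hE2.setR (by norm_num) X) hcol
    (by norm_num) (by norm_num) (by norm_num) (by norm_num) (by simpa [State.setR_reg] using hz)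
    (by simpa [State.setR_reg] using hy) (by simpa [State.setR_reg] using hX)] at hr
  refine ⟨z, hz, y, hy, ⟨X, by simpa [State.setR_reg] using hr⟩, ?_⟩
  simp only [chooseSwap, LP.run] at hrun1 hrun2 ⊢
  rw [hrun1, hrun2]

end RunSteps

end FairAlloc

/-! ### Correctness of the programs for release and swap. -/

namespace FairAlloc

open Finset Relation

variable {A : ℕ → ℕ → Prop} {N n k : ℕ} {s : State}

theorem run_put_arr (s : State) (a : ℕ) (e f : Expr) :
    ((LP.put a e f).run 2 s).arr a = Function.update (s.arr a) (e.eval s) (f.eval s) := by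
  simp [LP.run]

theorem run_set_reg (s : State) (x : ℕ) (e : Expr) :
    ((LP.set x e).run 2 s).reg x = e.eval s := by
  simp [LP.run]

theorem on_map_copy (hN : s.reg 2 = N) :
    on N (((mapP 4 (.get 6 (.reg 10))).run 2 s).arr 4) = on N (s.arr 6) := by
  refine on_congr fun c hc => ?_
  rw [run_mapP (fun c => s.arr 6 c) hN (fun s' ha _ => ?_) c hc]
  simp only [Expr.eval]
  rw [ha 6 (by norm_num)]

theorem on_map_store (hN : s.reg 2 = N) :
    on N (((mapP 5 (.get 7 (.reg 10))).run 2 s).arr 5) = on N (s.arr 7) := by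
  refine on_congr fun c hc => ?_
  rw [run_mapP (fun c => s.arr 7 c) hN (fun s' ha _ => ?_) c hc]
  simp only [Expr.eval]
  rw [ha 7 (by norm_num)]

theorem on_sub_range (N : ℕ) (g : ℕ → ℕ) : on N g ⊆ range N := filter_subset _ _

/-- That the reached set in `hr` is all of `S.erase W` expresses that `W` is terminal and supplies
the routes for the shift. -/
theorem run_releaseP (hA : ∀ v w, A v w → A w v) (h : Good A N n k s)
    (hS : on N (s.arr 5) ⊆ on N (s.arr 4)) (hhi : s.reg 4 ∉ on N (s.arr 5))
    (hcl : ∀ c ∈ on N (s.arr 4) \ on N (s.arr 5), ∀ d ∈ on N (s.arr 5), ¬ Mov N A (s.arr 1) c d)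
    (hW : s.reg 8 ∈ on N (s.arr 5))
    (hr : Reached N A (s.arr 1) ((on N (s.arr 5)).erase (s.reg 8)) (s.reg 3)
      ((on N (s.arr 5)).erase (s.reg 8)) (s.arr 8) (s.arr 9))
    (h6 : s.reg 6 = s.reg 3)
    (hex : ∃ z < N, ∃ y < N, ∃ X < N, CanRelease N A (s.arr 1) (on N (s.arr 5)) (on N (s.arr 4))
        (s.reg 8) z y X) :
    Good A N n k (releaseP.run 2 s) ∧
      (on N ((releaseP.run 2 s).arr 4)).card < (on N (s.arr 4)).card := by
  obtain ⟨z, hz, y, hy, X, hX, hrel, hrun⟩ := run_chooseRelease h.env (fun v hv => h.col hv) hex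
  have hz' := hrel.2.1
  have hXS := hrel.2.2.2.1
  have hXW := hrel.2.2.2.2.1
  have hfree := hrel.2.2.2.2.2
  set S := on N (s.arr 5) with hSdef
  set K := on N (s.arr 4) with hKdef
  set s1 := chooseRelease.run 2 s with hs1
  have e14 : s1.reg 14 = z := by rw [hrun]; simp [State.setR_reg]
  have e12 : s1.reg 12 = y := by rw [hrun]; simp [State.setR_reg]
  have e16 : s1.reg 16 = X := by rw [hrun]; simp
  have a1 : s1.arr = s.arr := by rw [hrun]; simp
  set s2 := (LP.put 1 (.reg 14) (.reg 16)).run 2 s1 with hs2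
  have b1 : s2.arr 1 = Function.update (s.arr 1) z X := by
    rw [hs2, run_put_arr, a1]; simp only [Expr.eval, e14, e16]
  set s3 := (LP.set 7 (.reg 16)).run 2 s2 with hs3
  have c7 : s3.reg 7 = X := by
    rw [hs3, run_set_reg]; simp only [Expr.eval]; rw [hs2, LP.run_reg 2 _ rfl, e16]
  have c6 : s3.reg 6 = s.reg 3 := by
    rw [hs3, LP.run_reg 2 _ rfl, hs2, LP.run_reg 2 _ rfl, hs1, LP.run_reg 2 _ rfl, h6]
  have c2 : s3.reg 2 = N := by
    rw [hs3, LP.run_reg 2 _ rfl, hs2, LP.run_reg 2 _ rfl, hs1, LP.run_reg 2 _ rfl, h.env.1]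
  have c1 : s3.arr 1 = Function.update (s.arr 1) z X := by rw [hs3, LP.run_arr 2 _ rfl, b1]
  have c8 : s3.arr 8 = s.arr 8 := by
    rw [hs3, LP.run_arr 2 _ rfl, hs2, LP.run_arr 2 _ rfl, a1]
  have c9 : s3.arr 9 = s.arr 9 := by
    rw [hs3, LP.run_arr 2 _ rfl, hs2, LP.run_arr 2 _ rfl, a1]
  obtain ⟨ρ, hρ⟩ := hr.routed
  have hshift := run_shift hA (s := s3) (R := S.erase (s.reg 8)) (ρ := ρ) c2
    ((erase_subset _ _).trans (on_sub_range _ _))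
    (by rw [c1]; exact Proper.update hA h.near.proper hz hfree)
    (by rw [c7]; exact mem_erase.2 ⟨hXW, hXS⟩)
    (by
      rw [c1, c6, c7, c8, c9]
      -- The vertex `z` comes from `W`, which lies on none of the routes, so they survive its move
      -- to `X`.
      exact (hρ (ρ X)).update hz' le_rfl fun c hc _ => (mem_erase.1 hc).1)
  rw [c1, c6, c7] at hshift
  set s4 := shift.run 2 s3 with hs4
  obtain ⟨hgy, hnear⟩ := h.near.release hA hS hhi hcl hW hrel hshift
  have d12 : s4.reg 12 = y := by
    rw [hs4, LP.run_reg 2 _ rfl, hs3, LP.run_reg 2 _ rfl, hs2, LP.run_reg 2 _ rfl, e12]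
  set s5 := (LP.set 3 (.get 1 (.reg 12))).run 2 s4 with hs5
  have f3 : s5.reg 3 = s.arr 1 y := by
    rw [hs5, run_set_reg]; simp only [Expr.eval]; rw [d12, hgy]
  set s6 := (LP.put 1 (.reg 12) (.reg 8)).run 2 s5 with hs6
  have g1 : s6.arr 1 = Function.update (s4.arr 1) y (s.reg 8) := by
    rw [hs6, run_put_arr]
    simp only [Expr.eval]
    rw [hs5, LP.run_arr 2 _ rfl, LP.run_reg 2 _ rfl, d12, LP.run_reg 2 _ rfl, hs4,
      LP.run_reg (y := 8) 2 _ rfl, hs3, LP.run_reg 2 _ rfl, hs2, LP.run_reg 2 _ rfl, hs1,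
      LP.run_reg 2 _ rfl]
  set s7 := (mapP 6 (.lt (.lt (.lit 0) (.get 5 (.reg 10))) (.lt (.lit 0) (.get 4 (.reg 10))))).run 2 s6
    with hs7
  have hs8 : releaseP.run 2 s = (mapP 4 (.get 6 (.reg 10))).run 2 s7 := rfl
  have hE : Env A N (releaseP.run 2 s) := h.env.run _ rfl
  have k6 : s6.reg 2 = N := by
    rw [hs6, LP.run_reg 2 _ rfl, hs5, LP.run_reg 2 _ rfl, hs4, LP.run_reg 2 _ rfl, c2]
  have k7 : s7.reg 2 = N := by rw [hs7, LP.run_reg 2 _ rfl, k6]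
  have l4 : s6.arr 4 = s.arr 4 := by
    rw [hs6, LP.run_arr 2 _ rfl, hs5, LP.run_arr 2 _ rfl, hs4, LP.run_arr 2 _ rfl, hs3,
      LP.run_arr 2 _ rfl, hs2, LP.run_arr 2 _ rfl, a1]
  have l5 : s6.arr 5 = s.arr 5 := by
    rw [hs6, LP.run_arr 2 _ rfl, hs5, LP.run_arr 2 _ rfl, hs4, LP.run_arr 2 _ rfl, hs3,
      LP.run_arr 2 _ rfl, hs2, LP.run_arr 2 _ rfl, a1]
  have m4 : on N ((releaseP.run 2 s).arr 4) = K \ S := by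
    rw [hs8, on_map_copy k7, hs7, on_map_sdiff k6, l4, l5]
  have m1 : (releaseP.run 2 s).arr 1 = Function.update (s4.arr 1) y (s.reg 8) := by
    rw [hs8, LP.run_arr 2 _ rfl, hs7, LP.run_arr 2 _ rfl, g1]
  have m3 : (releaseP.run 2 s).reg 3 = s.arr 1 y := by
    rw [hs8, LP.run_reg 2 _ rfl, hs7, LP.run_reg 2 _ rfl, hs6, LP.run_reg 2 _ rfl, f3]
  have mhi : (releaseP.run 2 s).reg 4 = s.reg 4 := LP.run_reg 2 _ rfl _
  refine ⟨⟨hE, h.le, by rw [m1, m4, m3, mhi]; exact hnear⟩, ?_⟩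
  rw [m4]
  exact card_lt_card ⟨sdiff_subset, fun hsub => (mem_sdiff.1 (hsub (hS hW))).2 hW⟩

theorem freeClassF_holds (hE : Env A N s) (hz : s.reg 14 < N) (hQ : s.reg 16 < N) :
    freeClassF.Holds 2 s ↔ s.reg 16 ∈ on N (s.arr 4) \ on N (s.arr 5) ∧
      ∀ w < N, A (s.reg 14) w → s.arr 1 w = s.reg 16 → w = s.reg 12 := by
  simp only [freeClassF, holds_and, holds_not, holds_get, holds_ex, holds_eq, adjF_holds, Expr.eval,
    mem_sdiff, mem_on, hQ, true_and, hE.1, State.setR_arr, State.setR_reg_self,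
    State.setR_reg_ne _ _ (show 14 ≠ 100 by decide), State.setR_reg_ne _ _ (show 16 ≠ 100 by decide),
    State.setR_reg_ne _ _ (show 12 ≠ 100 by decide)]
  refine and_congr_right fun _ => ?_
  push Not
  refine forall_congr' fun w => forall_congr' fun hw => ?_
  rw [(hE.setR (by norm_num) w).2 _ hz w hw]

theorem run_swapP (hA : ∀ v w, A v w → A w v) (h : Good A N n k s)
    (hS : on N (s.arr 5) ⊆ on N (s.arr 4))
    (hconn : ∀ c ∈ on N (s.arr 5), Conn N A (s.arr 1) (on N (s.arr 5)) c (s.reg 3))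
    (hW : Terminal N A (s.arr 1) (on N (s.arr 5)) (s.reg 3) (s.reg 8))
    (hno : ∀ z y X, ¬ CanRelease N A (s.arr 1) (on N (s.arr 5)) (on N (s.arr 4)) (s.reg 8) z y X)
    {R : Finset ℕ}
    (hr : Reached N A (s.arr 1) (on N (s.arr 4) \ on N (s.arr 5)) (s.reg 9) R (s.arr 8) (s.arr 9))
    (hhi : s.reg 4 ∈ R) (h6 : s.reg 6 = s.reg 9)
    (hex : ∃ z < N, ∃ y < N, ∃ y' < N, CanSwap N A (s.arr 1) (on N (s.arr 5)) (on N (s.arr 4))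
        (s.reg 8) (s.reg 9) z y y') :
    Good A N n k (swapP.run 2 s) ∧ (swapP.run 2 s).arr 4 = s.arr 4 ∧
      (swapP.run 2 s).reg 3 = s.reg 3 ∧ (on N (s.arr 5)).card <
      (acc N A ((swapP.run 2 s).arr 1) (on N (s.arr 4)) (s.reg 3)).card := by
  obtain ⟨z, hz, y, hy, ⟨y', hsw⟩, hrun⟩ := run_chooseSwap h.env (fun v hv => h.col hv) hex
  set S := on N (s.arr 5) with hSdef
  set K := on N (s.arr 4) with hKdef
  have hY : s.reg 9 ∈ K \ S := hr.sub hr.mem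
  set s1 := chooseSwap.run 2 s with hs1
  have e14 : s1.reg 14 = z := by rw [hrun]; simp [State.setR_reg]
  have e12 : s1.reg 12 = y := by rw [hrun]; simp
  have a1 : s1.arr = s.arr := by rw [hrun]; simp
  set s2 := (LP.set 7 (.reg 4)).run 2 s1 with hs2
  have a2 : s2.arr = s.arr := by rw [← a1]; rfl
  have b7 : s2.reg 7 = s.reg 4 := by
    rw [hs2, run_set_reg]; simp only [Expr.eval]; rw [hs1, LP.run_reg 2 _ rfl]
  have b6 : s2.reg 6 = s.reg 9 := by
    rw [hs2, LP.run_reg 2 _ rfl, hs1, LP.run_reg 2 _ rfl, h6]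
  have b2 : s2.reg 2 = N := by
    rw [hs2, LP.run_reg 2 _ rfl, hs1, LP.run_reg 2 _ rfl, h.env.1]
  obtain ⟨ρ, hρ⟩ := hr.routed
  have hshift := run_shift hA (s := s2) (R := R) (ρ := ρ) b2
    (hr.sub.trans (sdiff_subset.trans (on_sub_range _ _)))
    (by rw [a2]; exact h.near.proper) (by rw [b7]; exact hhi)
    (by rw [a2, b6]; exact hρ _)
  rw [a2, b6, b7] at hshift
  set s3 := shift.run 2 s2 with hs3
  have hshift' : Shifted N A (s.arr 1) (s.reg 4) (s.reg 9) (· ∈ K \ S) (s3.arr 1) (s.reg 9) :=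
    ⟨hshift.proper, hshift.card, fun v => (hshift.stay v).imp_right fun h' =>
      ⟨hr.sub h'.1, hr.sub h'.2⟩, hshift.target⟩
  have hE3 : Env A N s3 := ((h.env.run _ rfl : Env A N s1).run _ rfl : Env A N s2).run _ rfl
  have c14 : s3.reg 14 = z := by
    rw [hs3, LP.run_reg 2 _ rfl, hs2, LP.run_reg 2 _ rfl, e14]
  have c12 : s3.reg 12 = y := by
    rw [hs3, LP.run_reg 2 _ rfl, hs2, LP.run_reg 2 _ rfl, e12]
  have c4 : s3.arr 4 = s.arr 4 := by rw [hs3, LP.run_arr 2 _ rfl, a2]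
  have c5 : s3.arr 5 = s.arr 5 := by rw [hs3, LP.run_arr 2 _ rfl, a2]
  have hfc : ∀ Q < N, freeClassF.Holds 2 (s3.setR 16 Q) ↔
      Q ∈ K \ S ∧ ∀ w < N, A z w → s3.arr 1 w = Q → w = y := by
    intro Q hQ
    rw [freeClassF_holds (hE3.setR (by norm_num) Q) (by simpa [State.setR_reg, c14] using hz)
      (by simpa using hQ)]
    simp [State.setR_reg, c14, c12, c4, c5, ← hSdef, ← hKdef]
  -- The search for `Q` must follow the shift, which recolours vertices outside `S`.
  obtain ⟨Q, hQ, hQf, hrun4⟩ := run_choose (x := 16) (φ := freeClassF) hE3.1 (by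
    obtain ⟨Q, hQ, hQf⟩ := h.near.exists_free_class hA hS hW.1 hY hno hsw hshift'
    have hQN : Q < N := (mem_on.1 (mem_sdiff.1 hQ).1).1
    exact ⟨Q, hQN, (hfc Q hQN).2 ⟨hQ, hQf⟩⟩)
  rw [hfc Q hQ] at hQf
  set s4 := (LP.choose 16 freeClassF).run 2 s3 with hs4
  set s5 := (LP.put 1 (.reg 12) (.reg 8)).run 2 s4 with hs5
  set s6 := (LP.put 1 (.reg 14) (.reg 16)).run 2 s5 with hs6
  have hs7 : swapP.run 2 s = (LP.set 4 (.reg 16)).run 2 s6 := rfl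
  have d5 : s5.arr 1 = Function.update (s3.arr 1) y (s.reg 8) := by
    rw [hs5, run_put_arr]
    simp only [Expr.eval]
    rw [hs4, LP.run_arr 2 _ rfl, LP.run_reg 2 _ rfl, c12, LP.run_reg 2 _ rfl, hs3,
      LP.run_reg (y := 8) 2 _ rfl, hs2, LP.run_reg 2 _ rfl, hs1, LP.run_reg 2 _ rfl]
  have d14 : s5.reg 14 = z := by rw [hs5, LP.run_reg 2 _ rfl, hs4, LP.run_reg 2 _ rfl, c14]
  have d16 : s5.reg 16 = Q := by rw [hs5, LP.run_reg 2 _ rfl, hrun4]; simp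
  have m1 : (swapP.run 2 s).arr 1 =
      Function.update (Function.update (s3.arr 1) y (s.reg 8)) z Q := by
    rw [hs7, LP.run_arr 2 _ rfl, hs6, run_put_arr]
    simp only [Expr.eval]
    rw [d5, d14, d16]
  have m4 : (swapP.run 2 s).arr 4 = s.arr 4 := LP.run_arr 2 _ rfl _
  have m3 : (swapP.run 2 s).reg 3 = s.reg 3 := LP.run_reg 2 _ rfl _
  have mhi : (swapP.run 2 s).reg 4 = Q := by
    rw [hs7, run_set_reg]
    simp only [Expr.eval]
    rw [hs6, LP.run_reg 2 _ rfl, d16]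
  obtain ⟨hnear, hacc⟩ := h.near.swap hA hS hconn hW hY hno hsw hshift' hQf.1 hQf.2
  refine ⟨⟨h.env.run _ rfl, h.le, by rw [m1, m4, m3, mhi]; exact hnear⟩, m4, m3, ?_⟩
  rw [m1]
  exact hacc

/-! ### Improving the colouring -/

def tryAt : LP :=
  .cond (.and (.atom (.get 5 (.reg 8))) (.not (.atom (.eq (.reg 8) (.reg 3)))))
    (.seq prepTerminal
      (.cond (.not (.ex 100 (.and (.atom (.get 6 (.reg 100))) (.not (.atom (.get 7 (.reg 100)))))))
        (.cond (.ex 100 (.ex 101 (.ex 102 (releaseF 100 101 102 103)))) releaseP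
          (.cond (.and (.atom (.get 4 (.reg 9))) (.not (.atom (.get 5 (.reg 9)))))
            (.seq prepSwap
              (.cond (.and (.atom (.get 7 (.reg 4)))
                (.ex 100 (.ex 101 (.ex 102 (swapF 100 101 102 103))))) swapP .skip))
            .skip))
        .skip))
    .skip

/-- Try to improve the colouring, with the colour in register `8` as terminal colour, and the
colour in register `9` for the vertex to be swapped. -/
def tryStep : LP :=
  .cond (.not (.atom (.eq (.reg 3) (.reg 4))))
    (.seq prepAcc (.cond (.atom (.get 7 (.reg 4)))
      (.seq (.set 7 (.reg 4)) (.seq shift (.set 4 (.reg 3))))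
      (.seq (mapP 5 (.get 7 (.reg 10))) tryAt)))
    .skip

noncomputable def accS (N : ℕ) (A : ℕ → ℕ → Prop) (s : State) : Finset ℕ :=
  acc N A (s.arr 1) (on N (s.arr 4)) (s.reg 3)

/-- The colouring is equitable, or the number of active colours went down, or the number of
accessible colours went up. -/
def Progress (N : ℕ) (A : ℕ → ℕ → Prop) (s s' : State) : Prop :=
  s'.reg 3 = s'.reg 4 ∨ (on N (s'.arr 4)).card < (on N (s.arr 4)).card ∨
    ((on N (s'.arr 4)).card = (on N (s.arr 4)).card ∧ (accS N A s).card < (accS N A s').card)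

/-- An improvement is possible at the colours `W` and `Y`. -/
def Possible (N : ℕ) (A : ℕ → ℕ → Prop) (s : State) (W Y : ℕ) : Prop :=
  s.reg 3 = s.reg 4 ∨ s.reg 4 ∈ accS N A s ∨
    (Terminal N A (s.arr 1) (accS N A s) (s.reg 3) W ∧
      ((∃ z y X, CanRelease N A (s.arr 1) (accS N A s) (on N (s.arr 4)) W z y X) ∨
      ∃ z y y', Conn N A (s.arr 1) (on N (s.arr 4) \ accS N A s) (s.reg 4) Y ∧
        Y ∈ on N (s.arr 4) \ accS N A s ∧
        CanSwap N A (s.arr 1) (accS N A s) (on N (s.arr 4)) W Y z y y'))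

theorem Same.accS {s s' : State} (h : Same s s') : accS N A s' = accS N A s := by
  obtain ⟨a1, a2, a3, -⟩ := h
  simp only [FairAlloc.accS, a1, a2, a3]

/-- Each test that fails refutes `Possible` at the pair tried, and the state is then unchanged where
it matters. An exhaustive search over pairs needs both facts. -/
theorem run_tryAt (hA : ∀ v w, A v w → A w v) (h : Good A N n k s)
    (hr : Reached N A (s.arr 1) (on N (s.arr 4)) (s.reg 3) (on N (s.arr 5)) (s.arr 8) (s.arr 9))
    (hacc : on N (s.arr 5) = accS N A s)
    (h6 : s.reg 6 = s.reg 3) (hhi : s.reg 4 ∉ on N (s.arr 5)) (hne : s.reg 3 ≠ s.reg 4)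
    (hW : s.reg 8 < N) (hY : s.reg 9 < N) :
    Good A N n k (tryAt.run 2 s) ∧ (Progress N A s (tryAt.run 2 s) ∨
      (Same s (tryAt.run 2 s) ∧ ¬ Possible N A s (s.reg 8) (s.reg 9))) := by
  have hposs : ∀ {W Y}, Possible N A s W Y →
      (Terminal N A (s.arr 1) (on N (s.arr 5)) (s.reg 3) W ∧
      ((∃ z y X, CanRelease N A (s.arr 1) (on N (s.arr 5)) (on N (s.arr 4)) W z y X) ∨
      ∃ z y y', Conn N A (s.arr 1) (on N (s.arr 4) \ on N (s.arr 5)) (s.reg 4) Y ∧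
        Y ∈ on N (s.arr 4) \ on N (s.arr 5) ∧
        CanSwap N A (s.arr 1) (on N (s.arr 5)) (on N (s.arr 4)) W Y z y y')) := by
    intro W Y hp
    rw [hacc]
    rw [hacc] at hhi
    exact (hp.resolve_left hne).resolve_left hhi
  have same_refl : Same s s := ⟨rfl, rfl, rfl, rfl, rfl, rfl⟩
  rw [tryAt]
  by_cases hc1 : (Fm.and (.atom (.get 5 (.reg 8))) (.not (.atom (.eq (.reg 8) (.reg 3))))).Holds 2 s
  swap
  · rw [LP.run, if_neg hc1]
    refine ⟨h, Or.inr ⟨same_refl, fun hp => hc1 ?_⟩⟩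
    obtain ⟨⟨t1, t2, _⟩, _⟩ := hposs hp
    rw [holds_and, holds_get, holds_not, holds_eq]
    exact ⟨(mem_on.1 t1).2, t2⟩
  rw [LP.run, if_pos hc1]
  rw [holds_and, holds_get, holds_not, holds_eq] at hc1
  have hWS : s.reg 8 ∈ on N (s.arr 5) := mem_on.2 ⟨hW, hc1.1⟩
  have hWlo : s.reg 8 ≠ s.reg 3 := hc1.2
  rw [LP.run]
  set s1 := prepTerminal.run 2 s with hs1
  have hsame1 : Same s s1 := LP.run_same _ _ rfl
  have hE1 : Env A N s1 := h.env.run _ rfl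
  have hG1 : Good A N n k s1 := h.same hsame1 hE1
  have a5 : s1.arr 5 = s.arr 5 := LP.run_arr 2 _ rfl _
  obtain ⟨hR1, hal⟩ := run_prepTerminal h h6 hr.mem hWlo
  rw [← hs1] at hR1 hal
  obtain ⟨q1, q4, q3, qh, q8, q9⟩ := id hsame1
  -- The test asks whether every colour allowed in array `6` was reached in array `7`, that is,
  -- whether `W` is terminal.
  have hterm : (Fm.not (.ex 100 (.and (.atom (.get 6 (.reg 100)))
      (.not (.atom (.get 7 (.reg 100))))))).Holds 2 s1 ↔
      (on N (s.arr 5)).erase (s.reg 8) ⊆ on N (s1.arr 7) := by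
    simp only [holds_not, holds_ex, holds_and, holds_get, Expr.eval, State.setR_reg_self,
      State.setR_arr, hE1.1]
    push Not
    constructor
    · intro h' c hc
      rw [← hal, mem_on] at hc
      exact mem_on.2 ⟨hc.1, h' c hc.1 hc.2⟩
    · intro h' c hc hc6
      have : c ∈ on N (s1.arr 6) := mem_on.2 ⟨hc, hc6⟩
      rw [hal] at this
      exact (mem_on.1 (h' this)).2
  by_cases hc2 : (Fm.not (.ex 100 (.and (.atom (.get 6 (.reg 100)))
      (.not (.atom (.get 7 (.reg 100))))))).Holds 2 s1
  swap
  · rw [LP.run, if_neg hc2]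
    refine ⟨hG1, Or.inr ⟨hsame1, fun hp => hc2 (hterm.2 fun c hc => ?_)⟩⟩
    exact hR1.of_conn c ((hposs hp).1.2.2 c hc)
  rw [LP.run, if_pos hc2]
  have hReq : on N (s1.arr 7) = (on N (s.arr 5)).erase (s.reg 8) :=
    subset_antisymm hR1.sub (hterm.1 hc2)
  rw [hReq] at hR1
  have hT : Terminal N A (s.arr 1) (on N (s.arr 5)) (s.reg 3) (s.reg 8) :=
    ⟨hWS, hWlo, hR1.conn⟩
  have hexr := ex_releaseF_holds hE1 (fun v hv => hG1.col hv)
  by_cases hc3 : (Fm.ex 100 (.ex 101 (.ex 102 (releaseF 100 101 102 103)))).Holds 2 s1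
  · rw [LP.run, if_pos hc3]
    obtain ⟨g1, g2⟩ := run_releaseP hA hG1 (by rw [a5, q4]; exact hr.sub) (by rwa [a5, qh])
      (by rw [a5, q4, q1]; exact hr.closed) (by rwa [a5, q8]) (by rwa [a5, q8, q1, q3])
      (by rw [q3, ← h6]; exact LP.run_reg 2 _ rfl _) (hexr.1 hc3)
    rw [q4] at g2
    exact ⟨g1, Or.inl (Or.inr (Or.inl g2))⟩
  rw [LP.run, if_neg hc3]
  have hno : ∀ z y X, ¬ CanRelease N A (s.arr 1) (on N (s.arr 5)) (on N (s.arr 4)) (s.reg 8) z y X := by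
    intro z y X hrel
    refine hc3 (hexr.2 ⟨z, hrel.1.1, y, hrel.1.2.1, X, (mem_on.1 hrel.2.2.2.1).1, ?_⟩)
    rwa [q1, q4, q8, a5]
  by_cases hc4 : (Fm.and (.atom (.get 4 (.reg 9))) (.not (.atom (.get 5 (.reg 9))))).Holds 2 s1
  swap
  · rw [LP.run, if_neg hc4]
    refine ⟨hG1, Or.inr ⟨hsame1, fun hp => hc4 ?_⟩⟩
    rcases (hposs hp).2 with ⟨z, y, X, hrel⟩ | ⟨z, y, y', -, hYm, -⟩
    · exact absurd hrel (hno z y X)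
    · rw [holds_and, holds_get, holds_not, holds_get]
      simp only [Expr.eval]
      rw [q4, a5, q9]
      rw [mem_sdiff, mem_on, mem_on] at hYm
      exact ⟨hYm.1.2, fun h' => hYm.2 ⟨hYm.1.1, h'⟩⟩
  rw [LP.run, if_pos hc4, LP.run]
  rw [holds_and, holds_get, holds_not, holds_get] at hc4
  simp only [Expr.eval] at hc4
  have hYm : s1.reg 9 ∈ on N (s1.arr 4) \ on N (s1.arr 5) := by
    rw [mem_sdiff, mem_on, mem_on]
    exact ⟨⟨by rwa [q9], hc4.1⟩, fun h' => hc4.2 h'.2⟩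
  obtain ⟨hR2, h62⟩ := run_prepSwap hG1 hYm
  set s2 := prepSwap.run 2 s1 with hs2
  have hsame2 : Same s1 s2 := LP.run_same _ _ rfl
  have hE2 : Env A N s2 := hE1.run _ rfl
  have hG2 : Good A N n k s2 := hG1.same hsame2 hE2
  have hsame : Same s s2 := hsame1.trans hsame2
  have b5 : s2.arr 5 = s.arr 5 := by rw [hs2, LP.run_arr 2 _ rfl, a5]
  obtain ⟨p1, p4, p3, ph, p8, p9⟩ := id hsame
  rw [q1, q4, a5, q9] at hR2
  rw [q9] at h62
  have hexs := ex_swapF_holds hE2 (fun v hv => hG2.col hv)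
  by_cases hc5 : (Fm.and (.atom (.get 7 (.reg 4)))
      (.ex 100 (.ex 101 (.ex 102 (swapF 100 101 102 103))))).Holds 2 s2
  · rw [LP.run, if_pos hc5]
    rw [holds_and, holds_get, hexs] at hc5
    simp only [Expr.eval] at hc5
    have hhiN : s.reg 4 < N := (mem_on.1 h.near.hi_mem).1
    obtain ⟨g1, g2, g3, g4⟩ := run_swapP (R := on N (s2.arr 7)) hA hG2
      (by rw [b5, p4]; exact hr.sub) (by rw [b5, p1, p3]; exact hr.conn)
      (by rwa [p1, b5, p3, p8]) (by rwa [p1, b5, p4, p8]) (by rwa [p1, p4, b5, p9])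
      (mem_on.2 ⟨by rwa [ph], hc5.1⟩) (by rwa [p9]) hc5.2
    refine ⟨g1, Or.inl (Or.inr (Or.inr ⟨by rw [g2, p4], ?_⟩))⟩
    rw [← hacc, accS, g2, g3]
    rwa [b5] at g4
  · rw [LP.run, if_neg hc5]
    refine ⟨hG2, Or.inr ⟨hsame, fun hp => hc5 ?_⟩⟩
    rcases (hposs hp).2 with ⟨z, y, X, hrel⟩ | ⟨z, y, y', hcn, hYm', hsw⟩
    · exact absurd hrel (hno z y X)
    · rw [holds_and, holds_get, hexs]
      simp only [Expr.eval]
      rw [ph, p1, p4, b5, p8, p9]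
      exact ⟨(mem_on.1 (hR2.of_conn _ hcn)).2, z, hsw.1.1, y, hsw.1.2.1, y', hsw.2.1.2.1, hsw⟩

theorem run_tryStep (hA : ∀ v w, A v w → A w v) (h : Good A N n k s)
    (hW : s.reg 8 < N) (hY : s.reg 9 < N) :
    Good A N n k (tryStep.run 2 s) ∧ (Progress N A s (tryStep.run 2 s) ∨
      (Same s (tryStep.run 2 s) ∧ ¬ Possible N A s (s.reg 8) (s.reg 9))) := by
  rw [tryStep]
  by_cases hc1 : (Fm.not (.atom (.eq (.reg 3) (.reg 4)))).Holds 2 s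
  swap
  · rw [LP.run, if_neg hc1]
    refine ⟨h, Or.inl (Or.inl ?_)⟩
    rw [holds_not, holds_eq, not_not] at hc1
    exact hc1
  rw [LP.run, if_pos hc1, LP.run]
  rw [holds_not, holds_eq] at hc1
  have hne : s.reg 3 ≠ s.reg 4 := hc1
  obtain ⟨hR, h6⟩ := run_prepAcc h
  set s1 := prepAcc.run 2 s with hs1
  have hsame1 : Same s s1 := LP.run_same _ _ rfl
  have hE1 : Env A N s1 := h.env.run _ rfl
  have hG1 : Good A N n k s1 := h.same hsame1 hE1
  obtain ⟨q1, q4, q3, qh, q8, q9⟩ := id hsame1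
  have hhiN : s.reg 4 < N := (mem_on.1 h.near.hi_mem).1
  have hacc : on N (s1.arr 7) = accS N A s := by
    classical
    ext c
    rw [accS, acc, mem_filter]
    exact ⟨fun hc => ⟨hR.sub hc, (hR.conn c hc).mono hR.sub⟩, fun hc => hR.of_conn c hc.2⟩
  by_cases hc2 : (Fm.atom (.get 7 (.reg 4))).Holds 2 s1
  · rw [LP.run, if_pos hc2]
    rw [holds_get] at hc2
    simp only [Expr.eval] at hc2
    have hhi : s.reg 4 ∈ on N (s1.arr 7) := mem_on.2 ⟨hhiN, by rwa [qh] at hc2⟩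
    rw [LP.run]
    set s2 := (LP.set 7 (.reg 4)).run 2 s1 with hs2
    rw [LP.run]
    have b7 : s2.reg 7 = s.reg 4 := by rw [hs2, run_set_reg]; exact qh
    have b6 : s2.reg 6 = s.reg 3 := by rw [hs2, LP.run_reg 2 _ rfl, h6]
    have b2 : s2.reg 2 = N := by rw [hs2, LP.run_reg 2 _ rfl, hE1.1]
    have b1 : s2.arr = s1.arr := rfl
    obtain ⟨ρ, hρ⟩ := hR.routed
    have hshift := run_shift hA (s := s2) (R := on N (s1.arr 7)) (ρ := ρ) b2 (on_sub_range _ _)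
      (by rw [b1, q1]; exact h.near.proper) (by rw [b7]; exact hhi)
      (by rw [b1, b6, q1]; exact hρ _)
    rw [b1, q1, b6, b7] at hshift
    have hnear := h.near.shift (fun c hc => hR.sub hc) hshift
    set s3 := shift.run 2 s2 with hs3
    set s4 := (LP.set 4 (.reg 3)).run 2 s3 with hs4
    have d3 : s4.reg 3 = s.reg 3 := by
      rw [hs4, LP.run_reg 2 _ rfl, hs3, LP.run_reg 2 _ rfl, hs2, LP.run_reg 2 _ rfl, q3]
    have d4 : s4.reg 4 = s.reg 3 := by
      rw [hs4, run_set_reg]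
      simp only [Expr.eval]
      rw [hs3, LP.run_reg 2 _ rfl, hs2, LP.run_reg 2 _ rfl, q3]
    have e1 : s4.arr 1 = s3.arr 1 := rfl
    have e4 : s4.arr 4 = s.arr 4 := by
      rw [hs4, LP.run_arr 2 _ rfl, hs3, LP.run_arr 2 _ rfl, b1, q4]
    have hE4 : Env A N s4 := ((hE1.run _ rfl : Env A N s2).run _ rfl : Env A N s3).run _ rfl
    exact ⟨⟨hE4, h.le, by rw [e1, e4, d3, d4]; exact hnear⟩, Or.inl (Or.inl (by rw [d3, d4]))⟩
  · rw [LP.run, if_neg hc2, LP.run]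
    rw [holds_get] at hc2
    simp only [Expr.eval] at hc2
    set s2 := (mapP 5 (.get 7 (.reg 10))).run 2 s1 with hs2
    have hsame2 : Same s1 s2 := LP.run_same _ _ rfl
    have hE2 : Env A N s2 := hE1.run _ rfl
    have hG2 : Good A N n k s2 := hG1.same hsame2 hE2
    have hsame : Same s s2 := hsame1.trans hsame2
    obtain ⟨p1, p4, p3, ph, p8, p9⟩ := id hsame
    have h5 : on N (s2.arr 5) = on N (s1.arr 7) := on_map_store hE1.1
    have a8 : s2.arr 8 = s1.arr 8 := LP.run_arr 2 _ rfl _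
    have a9 : s2.arr 9 = s1.arr 9 := LP.run_arr 2 _ rfl _
    have h62 : s2.reg 6 = s1.reg 6 := LP.run_reg 2 _ rfl _
    obtain ⟨g1, g2⟩ := run_tryAt hA hG2 (by rwa [p1, p4, p3, h5, a8, a9])
      (by rw [h5, hacc, hsame.accS]) (by rw [h62, h6, p3])
      (by rw [ph, h5]; exact fun h' => hc2 (by rw [qh]; exact (mem_on.1 h').2))
      (by rwa [p3, ph]) (by rwa [p8]) (by rwa [p9])
    refine ⟨g1, ?_⟩
    rcases g2 with g2 | ⟨g2, g3⟩
    · left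
      simp only [Progress] at g2 ⊢
      rwa [p4, hsame.accS] at g2
    · right
      refine ⟨hsame.trans g2, fun hp => g3 ?_⟩
      simp only [Possible] at hp ⊢
      rwa [p1, p3, p4, ph, p8, p9, hsame.accS]

end FairAlloc

/-! ### Sweeps over all pairs of colours, and termination. -/

namespace FairAlloc

open Finset Relation

variable {A : ℕ → ℕ → Prop} {N n k : ℕ} {s : State}

theorem tryStep_of_eq (h : s.reg 3 = s.reg 4) : tryStep.run 2 s = s := by
  rw [tryStep, LP.run, if_neg]
  · rfl
  · rw [holds_not, holds_eq, not_not]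
    exact h

/-- This is `Same` without registers `8` and `9`, which the sweep uses as counters. -/
def Core (s s' : State) : Prop :=
  s'.arr 1 = s.arr 1 ∧ s'.arr 4 = s.arr 4 ∧ s'.reg 3 = s.reg 3 ∧ s'.reg 4 = s.reg 4

def Better (N : ℕ) (A : ℕ → ℕ → Prop) (s s' : State) : Prop :=
  (on N (s'.arr 4)).card < (on N (s.arr 4)).card ∨
    ((on N (s'.arr 4)).card = (on N (s.arr 4)).card ∧ (accS N A s).card < (accS N A s').card)

theorem Better.trans {s s' s'' : State} (h : Better N A s s') (h' : Better N A s' s'') :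
    Better N A s s'' := by
  simp only [Better] at *
  omega

theorem Core.accS {s s' : State} (h : Core s s') : accS N A s' = accS N A s := by
  obtain ⟨a1, a2, a3, -⟩ := h
  simp only [FairAlloc.accS, a1, a2, a3]

theorem Better.core {s s' s'' : State} (h : Better N A s s') (h' : Core s' s'') :
    Better N A s s'' := by
  simp only [Better] at *
  rwa [h'.accS, h'.2.1]

theorem Core.better {s s' s'' : State} (h : Core s s') (h' : Better N A s' s'') :
    Better N A s s'' := by
  simp only [Better] at *
  rwa [h.accS, h.2.1] at h'

theorem Core.possible {s s' : State} (h : Core s s') {W Y : ℕ} :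
    Possible N A s' W Y ↔ Possible N A s W Y := by
  obtain ⟨a1, a2, a3, a4⟩ := id h
  simp only [Possible, h.accS, a1, a2, a3, a4]

theorem Core.trans {s s' s'' : State} (h : Core s s') (h' : Core s' s'') : Core s s'' :=
  ⟨h'.1.trans h.1, h'.2.1.trans h.2.1, h'.2.2.1.trans h.2.2.1, h'.2.2.2.trans h.2.2.2⟩

theorem Core.setR (s : State) {x : ℕ} (hx : 6 ≤ x) (v : ℕ) : Core s (s.setR x v) :=
  ⟨rfl, rfl, State.setR_reg_ne _ _ (by omega), State.setR_reg_ne _ _ (by omega)⟩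

theorem Good.setR (h : Good A N n k s) {x : ℕ} (hx : 6 ≤ x) (v : ℕ) : Good A N n k (s.setR x v) := by
  refine ⟨h.env.setR hx v, h.le, ?_⟩
  obtain ⟨a1, a2, a3, a4⟩ := Core.setR s hx v
  rw [a1, a2, a3, a4]
  exact h.near

/-- Every colour on a walk to `lo` is itself accessible. So walks within the active colours stay
within the accessible ones, as `exists_improvement` requires. -/
theorem Good.exists_possible (hA : ∀ v w, A v w → A w v) (h : Good A N n k s) :
    ∃ W < N, ∃ Y < N, Possible N A s W Y := by
  classical
  have hloN : s.reg 3 < N := (mem_on.1 h.near.lo_mem).1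
  by_cases hne : s.reg 3 = s.reg 4
  · exact ⟨_, hloN, _, hloN, Or.inl hne⟩
  by_cases hhi : s.reg 4 ∈ accS N A s
  · exact ⟨_, hloN, _, hloN, Or.inr (Or.inl hhi)⟩
  have hmem : ∀ c, c ∈ accS N A s ↔
      c ∈ on N (s.arr 4) ∧ Conn N A (s.arr 1) (on N (s.arr 4)) c (s.reg 3) := by
    intro c; rw [accS, acc, mem_filter]
  have hsub : accS N A s ⊆ on N (s.arr 4) := fun c hc => ((hmem c).1 hc).1
  have hlo : s.reg 3 ∈ accS N A s := (hmem _).2 ⟨h.near.lo_mem, .refl⟩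
  obtain ⟨W, hW, hp⟩ := exists_improvement hA h.near hsub hlo hhi
    (by
      intro c hc d hd hm
      rw [mem_sdiff] at hc
      exact hc.2 ((hmem c).2 ⟨hc.1, ReflTransGen.head ⟨hc.1, hsub hd, hm⟩ ((hmem d).1 hd).2⟩))
    (by
      intro c hc
      have hc' := ((hmem c).1 hc).2
      clear hc
      unfold Conn at hc'
      induction hc' using ReflTransGen.head_induction_on with
      | refl => exact .refl
      | head hab hb ih =>
        exact ReflTransGen.head ⟨(hmem _).2 ⟨hab.1, ReflTransGen.head hab hb⟩,
          (hmem _).2 ⟨hab.2.1, hb⟩, hab.2.2⟩ ih)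
  have hWN : W < N := (mem_on.1 (hsub hW.1)).1
  rcases hp with hp | ⟨Y, z, y, y', h1, h2, h3⟩
  · exact ⟨W, hWN, _, hloN, Or.inr (Or.inr ⟨hW, Or.inl hp⟩)⟩
  · exact ⟨W, hWN, Y, (mem_on.1 (mem_sdiff.1 h2).1).1,
      Or.inr (Or.inr ⟨hW, Or.inr ⟨z, y, y', h1, h2, h3⟩⟩)⟩

/-- Try to improve the colouring at all pairs of colours. -/
def sweep : LP := .iter 8 (.iter 9 tryStep)

/-- What holds in the course of a sweep that started in `s₀`, if the pairs in `T` were tried. -/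
def SweepInv (A : ℕ → ℕ → Prop) (N n k : ℕ) (s₀ : State) (T : ℕ → ℕ → Prop) (s : State) : Prop :=
  Good A N n k s ∧ (s.reg 3 = s.reg 4 ∨ (s₀.reg 3 ≠ s₀.reg 4 ∧
    (Better N A s₀ s ∨ Core s₀ s ∧ ∀ W Y, T W Y → ¬ Possible N A s₀ W Y)))

theorem SweepInv.setR {s₀ : State} {T : ℕ → ℕ → Prop} (h : SweepInv A N n k s₀ T s) {x : ℕ}
    (hx : 6 ≤ x) (v : ℕ) : SweepInv A N n k s₀ T (s.setR x v) := by
  obtain ⟨h1, h2⟩ := h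
  refine ⟨h1.setR hx v, ?_⟩
  have hc := Core.setR s hx v
  rw [hc.2.2.1, hc.2.2.2]
  rcases h2 with h2 | ⟨h0, h2 | ⟨h2, h3⟩⟩
  · exact Or.inl h2
  · exact Or.inr ⟨h0, Or.inl (h2.core hc)⟩
  · exact Or.inr ⟨h0, Or.inr ⟨h2.trans hc, h3⟩⟩

theorem SweepInv.mono {s₀ : State} {T T' : ℕ → ℕ → Prop} (h : SweepInv A N n k s₀ T s)
    (hT : ∀ W Y, T' W Y → T W Y) : SweepInv A N n k s₀ T' s := by
  obtain ⟨h1, h2⟩ := h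
  refine ⟨h1, ?_⟩
  rcases h2 with h2 | ⟨h0, h2 | ⟨h2, h3⟩⟩
  · exact Or.inl h2
  · exact Or.inr ⟨h0, Or.inl h2⟩
  · exact Or.inr ⟨h0, Or.inr ⟨h2, fun W Y hWY => h3 W Y (hT W Y hWY)⟩⟩

theorem SweepInv.step (hA : ∀ v w, A v w → A w v) {s₀ : State} {T : ℕ → ℕ → Prop}
    (h : SweepInv A N n k s₀ T s) (hW : s.reg 8 < N) (hY : s.reg 9 < N) :
    SweepInv A N n k s₀ (fun W Y => T W Y ∨ W = s.reg 8 ∧ Y = s.reg 9) (tryStep.run 2 s) := by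
  obtain ⟨h1, h2⟩ := h
  by_cases hfin : s.reg 3 = s.reg 4
  · rw [tryStep_of_eq hfin]
    exact ⟨h1, Or.inl hfin⟩
  obtain ⟨h0, h2⟩ := h2.resolve_left hfin
  obtain ⟨g1, g2⟩ := run_tryStep hA h1 hW hY
  refine ⟨g1, ?_⟩
  rcases g2 with (g2 | g2) | ⟨g2, g3⟩
  · exact Or.inl g2
  · refine Or.inr ⟨h0, Or.inl ?_⟩
    rcases h2 with h2 | ⟨h2, -⟩
    · exact h2.trans g2
    · exact h2.better g2
  · have hc : Core s (tryStep.run 2 s) := ⟨g2.1, g2.2.1, g2.2.2.1, g2.2.2.2.1⟩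
    refine Or.inr ⟨h0, ?_⟩
    rcases h2 with h2 | ⟨h2, h3⟩
    · exact Or.inl (h2.core hc)
    · refine Or.inr ⟨h2.trans hc, fun W Y hWY => ?_⟩
      rcases hWY with hWY | ⟨rfl, rfl⟩
      · exact h3 W Y hWY
      · rwa [h2.possible] at g3

/-- If no attempt changed the colouring, all pairs have been refuted for the initial state, against
`Good.exists_possible`. -/
theorem run_sweep (hA : ∀ v w, A v w → A w v) (h : Good A N n k s) :
    Good A N n k (sweep.run 2 s) ∧ ((sweep.run 2 s).reg 3 = (sweep.run 2 s).reg 4 ∨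
      (s.reg 3 ≠ s.reg 4 ∧ Better N A s (sweep.run 2 s))) := by
  obtain ⟨s', h', hrun⟩ := LP.run_iter (β := 2) (x := 8) (P := .iter 9 tryStep) (s := s)
    (fun i s' => SweepInv A N n k s (fun W Y => W < i ∧ Y < N) s') (by
      refine ⟨h, ?_⟩
      by_cases hfin : s.reg 3 = s.reg 4
      · exact Or.inl hfin
      · exact Or.inr ⟨hfin, Or.inr ⟨⟨rfl, rfl, rfl, rfl⟩, fun W Y hWY => absurd hWY.1 (by omega)⟩⟩)
    (by
      intro i hi s' hs'
      rw [h.env.1] at hi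
      have hs1 := hs'.setR (x := 8) (by norm_num) i
      obtain ⟨s2, ⟨h2, -⟩, hrun⟩ := LP.run_iter (β := 2) (x := 9) (P := tryStep) (s := s'.setR 8 i)
        (fun j s2 => SweepInv A N n k s (fun W Y => W < i ∧ Y < N ∨ W = i ∧ Y < j) s2 ∧ s2.reg 8 = i)
        ⟨hs1.mono (fun W Y hWY => hWY.resolve_right (by omega)), by simp⟩
        (by
          rintro j hj s2 ⟨hs2, h8⟩
          rw [hs1.1.env.1] at hj
          have hs3 := hs2.setR (x := 9) (by norm_num) j
          have h8' : (s2.setR 9 j).reg 8 = i := by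
            rw [State.setR_reg_ne _ _ (by norm_num), h8]
          have hst := hs3.step hA (by rwa [h8']) (by rwa [State.setR_reg_self])
          refine ⟨hst.mono fun W Y hWY => ?_, by rw [LP.run_reg 2 _ rfl, h8']⟩
          rw [h8', State.setR_reg_self]
          omega)
      rw [hrun]
      refine (h2.setR (by norm_num) _).mono fun W Y hWY => ?_
      rw [hs1.1.env.1]
      omega)
  have h'' := h'.setR (x := 8) (by norm_num) (s.reg 2)
  rw [sweep, hrun]
  refine ⟨h''.1, ?_⟩
  rcases h''.2 with h2 | ⟨h0, h2 | ⟨-, h3⟩⟩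
  · exact Or.inl h2
  · exact Or.inr ⟨h0, h2⟩
  · obtain ⟨W, hW, Y, hY, hp⟩ := h.exists_possible hA
    exact absurd hp (h3 W Y ⟨by rwa [h.env.1], hY⟩)

/-- Make the colouring equitable. -/
def improve : LP := .iter 18 (.iter 19 sweep)

theorem accS_card_le : (accS N A s).card ≤ N := by
  classical
  calc (accS N A s).card ≤ (on N (s.arr 4)).card := card_le_card (filter_subset _ _)
    _ ≤ (range N).card := card_le_card (on_sub_range _ _)
    _ = N := card_range N

/-- During `N` sweeps without a drop in active colours, the accessible colours, at least one at the
start, would grow beyond `N`. So each outer round removes an active colour or finishes; as `lo`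
stays active, `N` outer rounds suffice. -/
theorem run_improve (hA : ∀ v w, A v w → A w v) (h : Good A N n k s) :
    Good A N n k (improve.run 2 s) ∧ (improve.run 2 s).reg 3 = (improve.run 2 s).reg 4 := by
  obtain ⟨s', ⟨h1, h2⟩, hrun⟩ := LP.run_iter (β := 2) (x := 18) (P := .iter 19 sweep) (s := s)
    (fun i s' => Good A N n k s' ∧ (s'.reg 3 = s'.reg 4 ∨ (on N (s'.arr 4)).card + i ≤ N))
    ⟨h, Or.inr (by
      have := card_le_card (on_sub_range N (s.arr 4))
      rwa [card_range] at this)⟩ (by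
      rintro i hi s' ⟨hs', hK⟩
      have hs1 := hs'.setR (x := 18) (by norm_num) i
      obtain ⟨s2, ⟨g1, g2⟩, hrun⟩ := LP.run_iter (β := 2) (x := 19) (P := sweep) (s := s'.setR 18 i)
        (fun j s2 => Good A N n k s2 ∧ (s2.reg 3 = s2.reg 4 ∨ (on N (s2.arr 4)).card + i + 1 ≤ N ∨
          ((on N (s2.arr 4)).card + i ≤ N ∧ j + 1 ≤ (accS N A s2).card))) (by
          refine ⟨hs1, ?_⟩
          obtain ⟨-, c4, c3, ch⟩ := Core.setR s' (show 6 ≤ 18 by norm_num) i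
          rw [c3, ch]
          rcases hK with hK | hK
          · exact Or.inl hK
          · refine Or.inr (Or.inr ⟨by rwa [c4], ?_⟩)
            classical
            refine card_pos.2 ⟨(s'.setR 18 i).reg 3, mem_filter.2 ⟨hs1.near.lo_mem, .refl⟩⟩)
        (by
          rintro j hj s2 ⟨g1, g2⟩
          have g1' := g1.setR (x := 19) (by norm_num) j
          have hc := Core.setR s2 (show 6 ≤ 19 by norm_num) j
          obtain ⟨f1, f2⟩ := run_sweep hA g1'
          refine ⟨f1, ?_⟩
          rcases f2 with f2 | ⟨f2, f3⟩
          · exact Or.inl f2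
          · rw [hc.2.2.1, hc.2.2.2] at f2
            have g2' := g2.resolve_left f2
            have f3' := hc.better f3
            simp only [Better] at f3'
            right
            omega)
      rw [hrun]
      refine ⟨g1.setR (by norm_num) _, ?_⟩
      obtain ⟨-, c4, c3, ch⟩ := Core.setR s2 (show 6 ≤ 19 by norm_num) ((s'.setR 18 i).reg 2)
      rw [c3, ch, c4]
      rcases g2 with g2 | g2 | ⟨-, g2⟩
      · exact Or.inl g2
      · exact Or.inr (by omega)
      · have := accS_card_le (N := N) (A := A) (s := s2)
        rw [hs1.env.1] at g2
        omega)
  rw [improve, hrun]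
  refine ⟨h1.setR (by norm_num) _, ?_⟩
  obtain ⟨-, -, c3, ch⟩ := Core.setR s' (show 6 ≤ 18 by norm_num) (s.reg 2)
  rw [c3, ch]
  refine h2.resolve_right fun h' => ?_
  have : 0 < (on N (s'.arr 4)).card := card_pos.2 ⟨_, h1.near.lo_mem⟩
  rw [h.env.1] at h'
  omega

/-! ### Adding the edges at one vertex after another -/

def pickF : Fm := .and (.atom (.lt (.reg 13) (.reg 0))) (freeF 17 13 100)

/-- Add the edges between the vertex in register `17` and the smaller vertices. -/
def stage : LP :=
  .seq (.set 5 (.add (.reg 17) (.lit 1))) (.seq (.choose 13 pickF) (.seq (.set 3 (.get 1 (.reg 17)))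
    (.seq (.set 4 (.reg 13)) (.seq (.put 1 (.reg 17) (.reg 13))
      (.seq (mapP 4 (.lt (.reg 10) (.reg 0))) improve)))))

/-- The subgraph of `H` induced by the vertices less than `u`. -/
def upTo (H : ℕ → ℕ → Prop) (u i j : ℕ) : Prop := i < u ∧ j < u ∧ H i j

/-- The state represents the graph `H` and an equitable colouring of its first `u` vertices. -/
structure StageInv (H : ℕ → ℕ → Prop) (N n k u : ℕ) (s : State) : Prop where
  size : s.reg 2 = N
  colours : s.reg 0 = n
  graph : ∀ i < N, ∀ j < N, (i < s.reg 1 ∧ j < s.reg 1 ∧ s.arr 0 (s.arr 10 i + j) ≠ 0 ∨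
    ¬ i < s.reg 1 ∧ ¬ j < s.reg 1 ∧ i ≠ j) ↔ H i j
  col : ∀ v < N, s.arr 1 v < n
  proper : Proper N (upTo H u) (s.arr 1)
  card : ∀ c < n, (cls N (s.arr 1) c).card = k

open Classical in
theorem exists_free_colour {f : ℕ → ℕ} {v : ℕ}
    (hdeg : ((range N).filter (fun w => A v w)).card < n) : ∃ c < n, Free N A f v c := by
  by_contra hcon
  push Not at hcon
  have hsub : range n ⊆ ((range N).filter (fun w => A v w)).image f := by
    intro c hc
    have := hcon c (mem_range.1 hc)
    simp only [Free] at this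
    push Not at this
    obtain ⟨w, hw, hvw, hfw⟩ := this
    exact mem_image.2 ⟨w, mem_filter.2 ⟨mem_range.2 hw, hvw⟩, hfw⟩
  have := (card_le_card hsub).trans card_image_le
  rw [card_range] at this
  omega

-- New edges all meet `u`, so the old colouring can be improper only there. Moving `u` to a free
-- colour `d` makes its old class small and `d` large. All colours are active again, and the degree
-- bound for `K = range n` is `hdeg`.
open Classical in
theorem run_stage {H : ℕ → ℕ → Prop} (hH : ∀ v w, H v w → H w v) (hirr : ∀ v, ¬ H v v)
    (hdeg : ∀ v < N, ((range N).filter (fun w => H v w)).card < n) (hn : n ≤ N)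
    {u : ℕ} (hu : u < N) (h17 : s.reg 17 = u) (h : StageInv H N n k u s) :
    StageInv H N n k (u + 1) (stage.run 2 s) := by
  have hA : ∀ v w, upTo H (u + 1) v w → upTo H (u + 1) w v := fun v w hvw =>
    ⟨hvw.2.1, hvw.1, hH _ _ hvw.2.2⟩
  have hdegA : ∀ v < N, ((range N).filter (fun w => upTo H (u + 1) v w)).card < n := fun v hv =>
    (card_le_card (monotone_filter_right _ fun w _ hw => hw.2.2)).trans_lt (hdeg v hv)
  set s1 := (LP.set 5 (.add (.reg 17) (.lit 1))).run 2 s with hs1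
  have a5 : s1.reg 5 = u + 1 := by rw [hs1, run_set_reg]; simp only [Expr.eval, h17]
  have a1 : s1.reg 1 = s.reg 1 := LP.run_reg 2 _ rfl _
  have a0 : s1.reg 0 = n := by rw [hs1, LP.run_reg 2 _ rfl, h.colours]
  have a17 : s1.reg 17 = u := by rw [hs1, LP.run_reg 2 _ rfl, h17]
  have aa : s1.arr = s.arr := rfl
  have hE1 : Env (upTo H (u + 1)) N s1 := by
    refine ⟨by rw [hs1, LP.run_reg 2 _ rfl, h.size], fun i hi j hj => ?_⟩
    simp only [State.Adj, upTo]
    rw [a5, a1, aa, h.graph i hi j hj]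
  have hpick : ∀ d, pickF.Holds 2 (s1.setR 13 d) ↔
      d < n ∧ Free N (upTo H (u + 1)) (s.arr 1) u d := by
    intro d
    rw [pickF, holds_and, holds_lt, freeF_holds (hE1.setR (by norm_num) d) (by norm_num)
      (by norm_num) (by norm_num) (by simpa [State.setR_reg, a17] using hu)]
    simp [Expr.eval, State.setR_reg, a0, a17, aa]
  obtain ⟨d, hd, hd', hrun2⟩ := run_choose (x := 13) (φ := pickF) hE1.1 (by
    obtain ⟨d, hd, hf⟩ := exists_free_colour (f := s.arr 1) (hdegA u hu)
    exact ⟨d, by omega, (hpick d).2 ⟨hd, hf⟩⟩)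
  rw [hpick] at hd'
  set s2 := (LP.choose 13 pickF).run 2 s1 with hs2
  set s3 := (LP.set 3 (.get 1 (.reg 17))).run 2 s2 with hs3
  set s4 := (LP.set 4 (.reg 13)).run 2 s3 with hs4
  set s5 := (LP.put 1 (.reg 17) (.reg 13)).run 2 s4 with hs5
  set s6 := (mapP 4 (.lt (.reg 10) (.reg 0))).run 2 s5 with hs6
  have hs7 : stage.run 2 s = improve.run 2 s6 := rfl
  have b13 : s2.reg 13 = d := by rw [hrun2]; simp
  have b17 : s2.reg 17 = u := by rw [hs2, LP.run_reg 2 _ rfl, a17]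
  have ba : s2.arr = s.arr := rfl
  have c3 : s3.reg 3 = s.arr 1 u := by
    rw [hs3, run_set_reg]; simp only [Expr.eval]; rw [b17, ba]
  have d4 : s4.reg 4 = d := by
    rw [hs4, run_set_reg]; simp only [Expr.eval]; rw [hs3, LP.run_reg 2 _ rfl, b13]
  have e1 : s5.arr 1 = Function.update (s.arr 1) u d := by
    rw [hs5, run_put_arr]
    simp only [Expr.eval]
    have x17 : s4.reg 17 = u := by rw [hs4, LP.run_reg 2 _ rfl, hs3, LP.run_reg 2 _ rfl, b17]
    have x13 : s4.reg 13 = d := by rw [hs4, LP.run_reg 2 _ rfl, hs3, LP.run_reg 2 _ rfl, b13]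
    have xa : s4.arr 1 = s.arr 1 := rfl
    rw [x17, x13, xa]
  have e0 : s5.reg 0 = n := by
    rw [hs5, LP.run_reg 2 _ rfl, hs4, LP.run_reg 2 _ rfl, hs3, LP.run_reg 2 _ rfl, hs2,
      LP.run_reg 2 _ rfl, a0]
  have hE5 : Env (upTo H (u + 1)) N s5 :=
    (((hE1.run _ rfl : Env _ N s2).run _ rfl : Env _ N s3).run _ rfl : Env _ N s4).run _ rfl
  have hE6 : Env (upTo H (u + 1)) N s6 := hE5.run _ rfl
  have f4 : on N (s6.arr 4) = range n := by
    ext c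
    rw [mem_on, mem_range]
    constructor
    · rintro ⟨hc, h'⟩
      rw [run_mapP (fun c => if c < n then 1 else 0) hE5.1 (fun s' _ hr => ?_) c hc] at h'
      · by_contra hcn
        rw [if_neg hcn] at h'
        exact h' rfl
      · rw [← e0, ← hr 0 (by norm_num)]; rfl
    · intro hc
      refine ⟨by omega, ?_⟩
      rw [run_mapP (fun c => if c < n then 1 else 0) hE5.1 (fun s' _ hr => ?_) c (by omega)]
      · rw [if_pos hc]; norm_num
      · rw [← e0, ← hr 0 (by norm_num)]; rfl
  have f1 : s6.arr 1 = Function.update (s.arr 1) u d := by rw [hs6, LP.run_arr 2 _ rfl, e1]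
  have f3 : s6.reg 3 = s.arr 1 u := by
    rw [hs6, LP.run_reg 2 _ rfl, hs5, LP.run_reg 2 _ rfl, hs4, LP.run_reg 2 _ rfl, c3]
  have fh : s6.reg 4 = d := by rw [hs6, LP.run_reg 2 _ rfl, hs5, LP.run_reg 2 _ rfl, d4]
  have hprop : Proper N (upTo H (u + 1)) (Function.update (s.arr 1) u d) := by
    have hfr : ∀ v < N, upTo H (u + 1) u v → v ≠ u →
        Function.update (s.arr 1) u d u ≠ Function.update (s.arr 1) u d v := by
      intro v hv huv hne
      rw [Function.update_self, Function.update_of_ne hne]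
      exact (hd'.2 v hv huv).symm
    intro v hv w hw hvw
    by_cases hvu : v = u
    · subst hvu
      exact hfr w hw hvw fun hwv => hirr v (hwv ▸ hvw.2.2)
    by_cases hwu : w = u
    · subst hwu
      exact (hfr v hv (hA _ _ hvw) hvu).symm
    rw [Function.update_of_ne hvu, Function.update_of_ne hwu]
    obtain ⟨h1, h2, h3⟩ := hvw
    exact h.proper v hv w hw ⟨by omega, by omega, h3⟩
  have hG : Good (upTo H (u + 1)) N n k s6 := by
    refine ⟨hE6, hn, ?_⟩
    rw [f1, f4, f3, fh]
    refine ⟨?_, hprop, subset_rfl, ?_, ?_, mem_range.2 (h.col u hu), mem_range.2 hd'.1⟩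
    · intro v hv
      by_cases hvu : v = u
      · subst hvu; rw [Function.update_self]; exact hd'.1
      · rw [Function.update_of_ne hvu]; exact h.col v hv
    · intro v hv _
      rw [sum_nb, card_range]
      exact (card_le_card (filter_subset_filter _ (filter_subset _ _))).trans_lt (hdegA v hv)
    · intro c hc
      rw [card_cls_update hu d c, h.card c hc]
  obtain ⟨g1, g2⟩ := run_improve hA hG
  rw [hs7]
  refine ⟨g1.env.1, ?_, ?_, g1.near.col, g1.near.proper, ?_⟩
  · rw [LP.run_reg 2 _ rfl, hs6, LP.run_reg 2 _ rfl, e0]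
  · have r1 : (improve.run 2 s6).reg 1 = s.reg 1 := by
      rw [← hs7]; exact LP.run_reg 2 _ rfl _
    have r0 : (improve.run 2 s6).arr 0 = s.arr 0 := by
      rw [← hs7]; exact LP.run_arr 2 _ rfl _
    have r10 : (improve.run 2 s6).arr 10 = s.arr 10 := by
      rw [← hs7]; exact LP.run_arr 2 _ rfl _
    rw [r1, r0, r10]
    exact h.graph
  · intro c hc
    have := g1.near.bal c hc
    rw [g2] at this
    omega

end FairAlloc

namespace FairAlloc

open Finset Relation

/-! ### The whole program -/

/-- Compute the least multiple of register `0` that is at least register `1`. -/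
def padSize : LP :=
  .iter 20 (.cond (.atom (.lt (.reg 2) (.reg 1))) (.set 2 (.add (.reg 2) (.reg 0))) .skip)

/-- Loops are bounded by register `1` here, since register `2` is being computed. Each addition
contributes at least one, so that many rounds suffice. -/
theorem run_padSize {s : State} (h2 : s.reg 2 = 0) (h0 : 0 < s.reg 0) :
    ∃ k, (padSize.run 1 s).reg 2 = s.reg 0 * k ∧ s.reg 1 ≤ s.reg 0 * k ∧
      s.reg 0 * k < s.reg 1 + s.reg 0 := by
  obtain ⟨s', ⟨-, -, k, i1, i2, i3⟩, hrun⟩ := LP.run_iter (β := 1) (x := 20)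
    (P := .cond (.atom (.lt (.reg 2) (.reg 1))) (.set 2 (.add (.reg 2) (.reg 0))) .skip) (s := s)
    (fun i s' => s'.reg 0 = s.reg 0 ∧ s'.reg 1 = s.reg 1 ∧ ∃ k, s'.reg 2 = s.reg 0 * k ∧
      s'.reg 2 < s.reg 1 + s.reg 0 ∧ (s.reg 1 ≤ s'.reg 2 ∨ i ≤ s'.reg 2))
    ⟨rfl, rfl, 0, by simp [h2], by omega, by omega⟩ (by
      rintro i hi s' ⟨g0, g1, k, i1, i2, i3⟩
      refine ⟨by rw [LP.run_reg 1 _ rfl, State.setR_reg_ne _ _ (by norm_num), g0],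
        by rw [LP.run_reg 1 _ rfl, State.setR_reg_ne _ _ (by norm_num), g1], ?_⟩
      have e0 : (s'.setR 20 i).reg 0 = s'.reg 0 := State.setR_reg_ne _ _ (by norm_num)
      have e1 : (s'.setR 20 i).reg 1 = s'.reg 1 := State.setR_reg_ne _ _ (by norm_num)
      have e2 : (s'.setR 20 i).reg 2 = s'.reg 2 := State.setR_reg_ne _ _ (by norm_num)
      simp only [LP.run, holds_lt, Expr.eval, e0, e1, e2]
      split_ifs with hlt
      · refine ⟨k + 1, ?_⟩
        rw [State.setR_reg_self, g0, mul_add, mul_one]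
        omega
      · refine ⟨k, ?_⟩
        rw [e2]
        omega)
  refine ⟨k, ?_⟩
  rw [padSize, hrun, State.setR_reg_ne _ _ (by norm_num), ← i1]
  omega

/-- Compute the row offsets of the adjacency matrix, and an equitable colouring of the empty graph. -/
def initialise : LP :=
  .iter 10 (.seq (.put 10 (.reg 10) (.reg 21)) (.seq (.set 21 (.add (.reg 21) (.reg 1)))
    (.seq (.put 1 (.reg 10) (.reg 22)) (.seq (.set 22 (.add (.reg 22) (.lit 1)))
      (.cond (.atom (.eq (.reg 22) (.reg 0))) (.set 22 (.lit 0)) .skip)))))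

theorem succ_mod_eq {n : ℕ} (hn : 0 < n) (i : ℕ) :
    (i + 1) % n = if i % n + 1 = n then 0 else i % n + 1 := by
  have h := Nat.mod_lt i hn
  rw [Nat.add_mod_eq_ite]
  rcases Nat.lt_or_ge 1 n with h1 | h1
  · rw [Nat.mod_eq_of_lt h1]
    split_ifs <;> omega
  · obtain rfl : n = 1 := by omega
    simp [Nat.mod_one]

/-- The machine neither multiplies nor divides: register `21` accumulates the row offset, and
register `22` counts modulo the number of colours. -/
theorem run_initialise {s : State} (h0 : 0 < s.reg 0) (h21 : s.reg 21 = 0) (h22 : s.reg 22 = 0) :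
    ∀ i < s.reg 2, (initialise.run 2 s).arr 10 i = i * s.reg 1 ∧
      (initialise.run 2 s).arr 1 i = i % s.reg 0 := by
  obtain ⟨s', ⟨-, -, -, -, h⟩, hrun⟩ := LP.run_iter (β := 2) (x := 10)
    (P := .seq (.put 10 (.reg 10) (.reg 21)) (.seq (.set 21 (.add (.reg 21) (.reg 1)))
      (.seq (.put 1 (.reg 10) (.reg 22)) (.seq (.set 22 (.add (.reg 22) (.lit 1)))
      (.cond (.atom (.eq (.reg 22) (.reg 0))) (.set 22 (.lit 0)) .skip))))) (s := s)
    (fun i s' => s'.reg 0 = s.reg 0 ∧ s'.reg 1 = s.reg 1 ∧ s'.reg 21 = i * s.reg 1 ∧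
      s'.reg 22 = i % s.reg 0 ∧ ∀ j < i, s'.arr 10 j = j * s.reg 1 ∧ s'.arr 1 j = j % s.reg 0)
    ⟨rfl, rfl, by simp [h21], by simp [h22], fun j hj => absurd hj (by omega)⟩ (by
      rintro i hi s' ⟨g0, g1, g21, g22, g⟩
      refine ⟨by rw [LP.run_reg 2 _ rfl, State.setR_reg_ne _ _ (by norm_num), g0],
        by rw [LP.run_reg 2 _ rfl, State.setR_reg_ne _ _ (by norm_num), g1], ?_, ?_, ?_⟩
      · simp only [LP.run, holds_eq, Expr.eval]
        split_ifs <;> simp [State.setR_reg, g21, g1] <;> ring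
      · rw [succ_mod_eq h0, ← g22, ← g0]
        simp only [LP.run, holds_eq, Expr.eval]
        simp only [State.setR_reg, State.setA_reg]
        norm_num
        split_ifs <;> simp
      · intro j hj
        simp only [LP.run, holds_eq, Expr.eval]
        have key : ∀ t : State, t.arr = (((s'.setR 10 i).setA 10 i (i * s.reg 1)).setA 1 i
            (i % s.reg 0)).arr → t.arr 10 j = j * s.reg 1 ∧ t.arr 1 j = j % s.reg 0 := by
          intro t ht
          rw [ht, State.setA_arr_self, State.setA_arr_ne _ _ _ (by norm_num), State.setA_arr_self,
            State.setA_arr_ne _ _ _ (by norm_num), State.setR_arr]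
          rcases Nat.lt_succ_iff_lt_or_eq.1 hj with hji | rfl
          · rw [Function.update_of_ne (by omega), Function.update_of_ne (by omega)]
            exact g j hji
          · simp
        split_ifs <;> refine key _ ?_ <;>
          simp [State.setA, State.setR, g21, g22])
  intro i hi
  rw [initialise, hrun]
  exact h i hi

theorem card_cls_mod {n k c : ℕ} (hc : c < n) : (cls (n * k) (fun i => i % n) c).card = k := by
  have : cls (n * k) (fun i => i % n) c = (range k).image (fun q => c + n * q) := by
    ext i
    rw [mem_cls, mem_image]
    constructor
    · rintro ⟨hi, h⟩
      refine ⟨i / n, mem_range.2 (Nat.div_lt_of_lt_mul hi), ?_⟩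
      rw [← h]
      exact Nat.mod_add_div i n
    · rintro ⟨q, hq, rfl⟩
      rw [mem_range] at hq
      refine ⟨?_, by simp [Nat.mod_eq_of_lt hc]⟩
      calc c + n * q < n * (q + 1) := by rw [mul_add]; omega
        _ ≤ n * k := Nat.mul_le_mul_left _ hq
  rw [this, card_image_of_injective, card_range]
  intro a b hab
  have : n * a = n * b := by simpa using hab
  exact Nat.eq_of_mul_eq_mul_left (by omega) this

/-- Colour the padded graph. -/
def colourAll : LP := .seq initialise (.iter 17 stage)

open Classical in
theorem run_colourAll {H : ℕ → ℕ → Prop} (hH : ∀ v w, H v w → H w v) (hirr : ∀ v, ¬ H v v)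
    {N n m k : ℕ} (hdeg : ∀ v < N, ((range N).filter (fun w => H v w)).card < n) {s : State}
    (h0 : s.reg 0 = n) (hn : 0 < n) (h1 : s.reg 1 = m) (h2 : s.reg 2 = N) (hN : N = n * k)
    (h21 : s.reg 21 = 0) (h22 : s.reg 22 = 0)
    (hG : ∀ i < N, ∀ j < N, (i < m ∧ j < m ∧ s.arr 0 (i * m + j) ≠ 0 ∨
      ¬ i < m ∧ ¬ j < m ∧ i ≠ j) ↔ H i j) :
    StageInv H N n k N (colourAll.run 2 s) := by
  have hi := run_initialise (s := s) (by omega) h21 h22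
  rw [h2, h1, h0] at hi
  set s1 := initialise.run 2 s with hs1
  have a0 : s1.reg 0 = n := by rw [hs1, LP.run_reg 2 _ rfl, h0]
  have a1 : s1.reg 1 = m := by rw [hs1, LP.run_reg 2 _ rfl, h1]
  have a2 : s1.reg 2 = N := by rw [hs1, LP.run_reg 2 _ rfl, h2]
  have b0 : s1.arr 0 = s.arr 0 := LP.run_arr 2 _ rfl _
  obtain ⟨s', h', hrun⟩ := LP.run_iter (β := 2) (x := 17) (P := stage) (s := s1)
    (fun u s' => StageInv H N n k u s')
    (by
      refine ⟨a2, a0, fun i hi' j hj => ?_, fun v hv => ?_, fun v _ w _ hvw => ?_, fun c hc => ?_⟩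
      · rw [a1, b0, (hi i hi').1]
        exact hG i hi' j hj
      · rw [(hi v hv).2]
        exact Nat.mod_lt _ hn
      · exact absurd hvw.1 (by omega)
      · rw [← card_cls_mod (k := k) hc, ← hN]
        congr 1
        ext v
        rw [mem_cls, mem_cls]
        exact and_congr_right fun hv => by rw [(hi v hv).2])
    (by
      intro u hu t ht
      rw [a2] at hu
      -- This could fail only for `N = 0`, and then no stage is run.
      have hnN : n ≤ N := by
        rw [hN] at hu ⊢
        exact Nat.le_mul_of_pos_right _ (Nat.pos_of_ne_zero fun hk => by simp [hk] at hu)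
      refine run_stage hH hirr hdeg hnN hu (State.setR_reg_self _ _ _) ?_
      refine ⟨?_, ?_, ?_, ht.col, ht.proper, ht.card⟩
      · rw [State.setR_reg_ne _ _ (by norm_num), ht.size]
      · rw [State.setR_reg_ne _ _ (by norm_num), ht.colours]
      · rw [State.setR_reg_ne _ _ (by norm_num)]
        exact ht.graph)
  rw [a2] at h' hrun
  have hc : colourAll.run 2 s = s'.setR 17 N := hrun
  rw [hc]
  refine ⟨?_, ?_, ?_, h'.col, h'.proper, h'.card⟩
  · rw [State.setR_reg_ne _ _ (by norm_num), h'.size]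
  · rw [State.setR_reg_ne _ _ (by norm_num), h'.colours]
  · rw [State.setR_reg_ne _ _ (by norm_num)]
    exact h'.graph

/-! ### The padded graph -/

/-- The disjoint union of `G` and a clique. -/
def padded {m : ℕ} (G : SimpleGraph (Fin m)) (i j : ℕ) : Prop :=
  (∃ (hi : i < m) (hj : j < m), G.Adj ⟨i, hi⟩ ⟨j, hj⟩) ∨ ¬ i < m ∧ ¬ j < m ∧ i ≠ j

theorem padded_symm {m : ℕ} (G : SimpleGraph (Fin m)) (i j : ℕ) (h : padded G i j) :
    padded G j i := by
  rcases h with ⟨hi, hj, h⟩ | ⟨hi, hj, h⟩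
  · exact Or.inl ⟨hj, hi, h.symm⟩
  · exact Or.inr ⟨hj, hi, h.symm⟩

theorem padded_irrefl {m : ℕ} (G : SimpleGraph (Fin m)) (i : ℕ) : ¬ padded G i i := by
  rintro (⟨_, _, h⟩ | ⟨_, _, h⟩)
  · exact h.ne rfl
  · exact h rfl

-- Since `N < m + n`, the clique has fewer than `n` vertices.
open Classical in
theorem padded_degree {n m N : ℕ} (G : SimpleGraph (Fin m)) [DecidableRel G.Adj]
    (hG : G.maxDegree < n) (hN : N < m + n) {v : ℕ} (hv : v < N) :
    ((range N).filter (fun w => padded G v w)).card < n := by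
  by_cases hm : v < m
  · have hsub : (range N).filter (fun w => padded G v w) ⊆
        (G.neighborFinset ⟨v, hm⟩).map Fin.valEmbedding := by
      intro w hw
      rcases (mem_filter.1 hw).2 with ⟨_, hj, h⟩ | ⟨h, _⟩
      · exact mem_map.2 ⟨⟨w, hj⟩, by simpa using h, rfl⟩
      · exact absurd hm h
    have := card_le_card hsub
    rw [card_map, SimpleGraph.card_neighborFinset_eq_degree] at this
    exact this.trans_lt ((G.degree_le_maxDegree _).trans_lt hG)
  · have hsub : (range N).filter (fun w => padded G v w) ⊆ (Ico m N).erase v := by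
      intro w hw
      rw [mem_filter, mem_range] at hw
      rcases hw.2 with ⟨h, _⟩ | ⟨_, h, hne⟩
      · exact absurd h hm
      · rw [mem_erase, mem_Ico]
        omega
    have := card_le_card hsub
    rw [card_erase_of_mem (mem_Ico.2 ⟨by omega, hv⟩), Nat.card_Ico] at this
    omega

/-- As `j < m`, the address `i * m + j` determines `i` as its quotient and `j` as its remainder. -/
theorem inputState_adj (n : ℕ) {m : ℕ} (G : SimpleGraph (Fin m)) (i j : ℕ) :
    (i < m ∧ j < m ∧ (inputState n G).arr 0 (i * m + j) ≠ 0 ∨ ¬ i < m ∧ ¬ j < m ∧ i ≠ j) ↔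
      padded G i j := by
  refine or_congr_left ?_
  constructor
  · rintro ⟨hi, hj, h⟩
    refine ⟨hi, hj, ?_⟩
    simp only [inputState, true_and, ne_eq, ite_eq_right_iff, one_ne_zero, imp_false, not_not] at h
    obtain ⟨a, b, hab, h⟩ := h
    have e1 : i = a := by
      have := congrArg (· / m) hab
      simpa [Nat.add_div_of_dvd_right, Nat.mul_div_cancel _ (show 0 < m by omega),
        Nat.div_eq_of_lt hj, Nat.div_eq_of_lt b.2] using this
    have e2 : j = b := by
      rw [e1] at hab
      omega
    subst e1 e2
    exact h
  · rintro ⟨hi, hj, h⟩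
    refine ⟨hi, hj, ?_⟩
    simp only [inputState]
    rw [if_pos ⟨rfl, ⟨i, hi⟩, ⟨j, hj⟩, rfl, h⟩]
    exact one_ne_zero

/-! ### Allocations and equitable colourings -/

section EF1

variable {n m : ℕ} {I : Instance n m}

/-- Without agents or without items there is no value to take, and `0` serves as a default. -/
theorem Instance.HasIdenticalValues.exists_eq (h : I.HasIdenticalValues) :
    ∃ c : ℝ, 0 ≤ c ∧ ∀ i j, I.v i {j} = c := by
  by_cases hne : Nonempty (Fin n) ∧ Nonempty (Fin m)
  · obtain ⟨⟨i⟩, ⟨j⟩⟩ := hne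
    exact ⟨I.v i {j}, I.nonneg _ _, fun i' j' => h _ _ _ _⟩
  · exact ⟨0, le_rfl, fun i j => absurd ⟨⟨i⟩, ⟨j⟩⟩ hne⟩

theorem Instance.isEF1_iff {c : ℝ} (h : ∀ i j, I.v i {j} = c) (A : Allocation n m) :
    I.IsEF1 A ↔ A.IsFeasible I.G ∧ ∀ i i', (A.bundle i').Nonempty →
      ((A.bundle i').card : ℝ) * c ≤ ((A.bundle i).card + 1) * c := by
  have hv : ∀ i S, I.v i S = S.card * c := fun i S => by
    rw [I.additive, sum_congr rfl fun j _ => h i j, sum_const, nsmul_eq_mul]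
  refine and_congr_right fun _ => forall_congr' fun i => forall_congr' fun i' =>
    forall_congr' fun hne => ?_
  have : (A.bundle i').sup' hne (fun j => I.v i {j}) = c := by
    simp only [h, sup'_const]
  rw [this, hv, hv, ge_iff_le, sub_le_iff_le_add, add_mul, one_mul]

theorem Allocation.isEquitableColoring_iff {G : SimpleGraph (Fin m)} (A : Allocation n m) :
    A.IsEquitableColoring G ↔ A.IsFeasible G ∧
      ∀ i i', (A.bundle i').card ≤ (A.bundle i).card + 1 := by
  constructor
  · rintro ⟨C, hC, hE⟩
    have hb : ∀ i, A.bundle i = univ.filter (fun j => C j = i) := fun i => by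
      ext j; simp [hC]
    refine ⟨fun i j hj j' hj' hadj => C.valid hadj ?_, fun i i' => ?_⟩
    · rw [(hC i j).1 hj, (hC i j').1 hj']
    · rw [hb, hb]
      exact hE i' i
  · rintro ⟨hF, hE⟩
    choose f hf using A.cover
    have hmem : ∀ i j, j ∈ A.bundle i ↔ f j = i := by
      intro i j
      refine ⟨fun hj => ?_, fun hj => hj ▸ hf j⟩
      by_contra hne
      exact disjoint_left.1 (A.disjoint _ _ hne) (hf j) hj
    refine ⟨SimpleGraph.Coloring.mk f fun {j j'} hadj heq =>
      hF (f j) j (hf j) j' (heq ▸ hf j') hadj, hmem, fun a b => ?_⟩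
    have hb : ∀ i, univ.filter (fun j => f j = i) = A.bundle i := fun i => by
      ext j; simp [hmem]
    have := hE b a
    rwa [← hb, ← hb] at this

theorem Allocation.IsEquitableColoring.isEF1 (h : I.HasIdenticalValues) {A : Allocation n m}
    (hA : A.IsEquitableColoring I.G) : I.IsEF1 A := by
  obtain ⟨c, hc, hv⟩ := h.exists_eq
  obtain ⟨hF, hE⟩ := A.isEquitableColoring_iff.1 hA
  refine (Instance.isEF1_iff hv A).2 ⟨hF, fun i i' _ => mul_le_mul_of_nonneg_right ?_ hc⟩
  exact_mod_cast hE i i'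

theorem Instance.IsEF1.isEquitableColoring (h : I.HasIdenticalValues)
    (h0 : ∀ i j, I.v i {j} ≠ 0) {A : Allocation n m} (hA : I.IsEF1 A) :
    A.IsEquitableColoring I.G := by
  obtain ⟨c, hc, hv⟩ := h.exists_eq
  obtain ⟨hF, hE⟩ := (Instance.isEF1_iff hv A).1 hA
  refine A.isEquitableColoring_iff.2 ⟨hF, fun i i' => ?_⟩
  -- EF1 says nothing about an empty bundle, for which the size bound is trivial; a nonempty one
  -- supplies an item that shows `c ≠ 0`.
  rcases (A.bundle i').eq_empty_or_nonempty with he | hne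
  · rw [he, card_empty]
    exact Nat.zero_le _
  · obtain ⟨j, -⟩ := id hne
    have hpos : 0 < c := hc.lt_of_ne fun h' => h0 i j (by rw [hv, ← h'])
    exact_mod_cast le_of_mul_le_mul_right (hE i i' hne) hpos

end EF1

/-- A balanced colouring of the padded graph restricts to an equitable colouring. -/
theorem exists_allocation {n m k N : ℕ} {G : SimpleGraph (Fin m)} (hmN : m ≤ N) {f : ℕ → ℕ}
    (hcol : ∀ v < N, f v < n) (hprop : Proper N (padded G) f)
    (hcard : ∀ c < n, (cls N f c).card = k) :
    ∃ A : Allocation n m, (∀ (i : Fin n) (j : Fin m), j ∈ A.bundle i ↔ f j = i) ∧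
      A.IsEquitableColoring G := by
  let A : Allocation n m :=
    { bundle := fun i => univ.filter (fun j => f j = i)
      disjoint := fun i i' hne => disjoint_left.2 fun j hj hj' => hne (Fin.ext (by
        rw [← (mem_filter.1 hj).2, ← (mem_filter.1 hj').2]))
      cover := fun j => ⟨⟨f j, hcol j (j.2.trans_le hmN)⟩, by simp⟩ }
  have hA : ∀ (i : Fin n) (j : Fin m), j ∈ A.bundle i ↔ f j = i := fun i j => by simp [A]
  refine ⟨A, hA, A.isEquitableColoring_iff.2 ⟨fun i j hj j' hj' hadj => ?_, ?_⟩⟩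
  · exact hprop j (j.2.trans_le hmN) j' (j'.2.trans_le hmN) (Or.inl ⟨j.2, j'.2, hadj⟩)
      (((hA i j).1 hj).trans ((hA i j').1 hj').symm)
  -- A class of size `k` contains at most one vertex of the clique.
  · have key : ∀ i : Fin n, (A.bundle i).card ≤ k ∧ k ≤ (A.bundle i).card + 1 := by
      intro i
      have hsplit := card_filter_add_card_filter_not (s := cls N f i) (fun v => v < m)
      have h1 : (cls N f i).filter (fun v => v < m) = (A.bundle i).map Fin.valEmbedding := by
        ext v
        simp only [mem_filter, mem_cls, mem_map, hA, Fin.valEmbedding_apply]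
        constructor
        · rintro ⟨⟨-, h⟩, hv⟩
          exact ⟨⟨v, hv⟩, h, rfl⟩
        · rintro ⟨j, h, rfl⟩
          exact ⟨⟨j.2.trans_le hmN, h⟩, j.2⟩
      have h2 : ((cls N f i).filter (fun v => ¬ v < m)).card ≤ 1 := by
        rw [card_le_one]
        intro a ha b hb
        simp only [mem_filter, mem_cls] at ha hb
        by_contra hne
        exact hprop a ha.1.1 b hb.1.1 (Or.inr ⟨ha.2, hb.2, hne⟩) (ha.1.2.trans hb.1.2.symm)
      rw [h1, card_map, hcard i i.2] at hsplit
      omega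
    intro i i'
    exact (key i').1.trans (key i).2

theorem eval_mono (p : Polynomial ℕ) {a b : ℕ} (h : a ≤ b) : p.eval a ≤ p.eval b := by
  rw [Polynomial.eval_eq_sum_range, Polynomial.eval_eq_sum_range]
  gcongr

theorem exec_colouring {n m : ℕ} (G : SimpleGraph (Fin m)) [DecidableRel G.Adj]
    (hG : G.maxDegree < n) :
    ∃ (s : State) (t : ℕ) (A : Allocation n m),
      Exec (.seq (padSize.comp 1) (colourAll.comp 2)) (inputState n G) s t ∧
      t ≤ (padSize.time + colourAll.time).eval (n + m) ∧ s.Outputs A ∧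
      A.IsEquitableColoring G := by
  set s := inputState n G with hs
  have r0 : s.reg 0 = n := rfl
  have r1 : s.reg 1 = m := rfl
  obtain ⟨k, hk, hmk, hkm⟩ := run_padSize (s := s) rfl (by omega)
  rw [r0, r1] at hmk hkm
  rw [r0] at hk
  obtain ⟨σ, t, he, ht, hsim⟩ := LP.exec_comp (β := 1) (by norm_num) padSize rfl rfl
    (s := s) (σ := s) ⟨rfl, fun _ _ => rfl⟩
  obtain ⟨σ', t', he', ht', hsim'⟩ := LP.exec_comp (β := 2) (by norm_num) colourAll rfl rfl hsim
  have hfin := run_colourAll (padded_symm G) (padded_irrefl G) (N := n * k) (n := n) (m := m)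
    (fun v hv => padded_degree G hG hkm hv) (s := padSize.run 1 s)
    (LP.run_reg 1 _ rfl _) (by omega) (LP.run_reg 1 _ rfl _) hk rfl
    (LP.run_reg 1 _ rfl _) (LP.run_reg 1 _ rfl _) (fun i _ j _ => by
      rw [LP.run_arr 1 _ rfl]
      exact inputState_adj n G i j)
  obtain ⟨A, hA, hE⟩ := exists_allocation (G := G) hmk hfin.col (fun v hv w hw hvw =>
    hfin.proper v hv w hw ⟨hv, hw, hvw⟩) hfin.card
  refine ⟨σ', _, A, Exec.seq he he', ?_, fun i j => ?_, hE⟩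
  · rw [Polynomial.eval_add]
    rw [r1] at ht
    rw [hk] at ht'
    -- The loop bounds of the two programs are `m` and `n * k < m + n`.
    exact Nat.add_le_add (ht.trans (eval_mono _ (by omega))) (ht'.trans (eval_mono _ (by omega)))
  · rw [hA, hsim'.1]

end FairAlloc

theorem mainTheorem8 :
    -- an EF1 allocation exists
    (∀ (n m : ℕ) (I : FairAlloc.Instance n m) [DecidableRel I.G.Adj],
      I.G.maxDegree < n → I.HasIdenticalValues →
        ∃ A : FairAlloc.Allocation n m, I.IsEF1 A) ∧
    -- one program finds it in time polynomial in the numbers of agents and items; it does not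
    -- even read the valuations, and its output is an equitable colouring
    (∃ (P : FairAlloc.Program) (p : Polynomial ℕ),
      ∀ (n m : ℕ) (G : SimpleGraph (Fin m)) [DecidableRel G.Adj], G.maxDegree < n →
        ∃ (s : FairAlloc.State) (t : ℕ) (A : FairAlloc.Allocation n m),
          FairAlloc.Exec P (FairAlloc.inputState n G) s t ∧ t ≤ p.eval (n + m) ∧
          s.Outputs A ∧ A.IsEquitableColoring G ∧
          ∀ I : FairAlloc.Instance n m, I.G = G → I.HasIdenticalValues → I.IsEF1 A) ∧
    -- for identical values, EF1 allocations and equitable `n`-colourings are the same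
    (∀ (n m : ℕ) (I : FairAlloc.Instance n m), I.HasIdenticalValues →
      ∀ A : FairAlloc.Allocation n m,
        (A.IsEquitableColoring I.G → I.IsEF1 A) ∧
        ((∀ i j, I.v i {j} ≠ 0) → (I.IsEF1 A ↔ A.IsEquitableColoring I.G))) := by
  refine ⟨?_, ⟨.seq (FairAlloc.padSize.comp 1) (FairAlloc.colourAll.comp 2),
    FairAlloc.padSize.time + FairAlloc.colourAll.time, ?_⟩, ?_⟩
  · intro n m I _ hG hI
    obtain ⟨_, _, A, -, -, -, hA⟩ := FairAlloc.exec_colouring I.G hG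
    exact ⟨A, hA.isEF1 hI⟩
  · intro n m G _ hG
    obtain ⟨s, t, A, h1, h2, h3, h4⟩ := FairAlloc.exec_colouring G hG
    exact ⟨s, t, A, h1, h2, h3, h4, fun I hI hv => (hI ▸ h4).isEF1 hv⟩
  · intro n m I hI A
    exact ⟨fun h => h.isEF1 hI, fun h0 => ⟨fun h => h.isEquitableColoring hI h0,
      fun h => h.isEF1 hI⟩⟩
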